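/- For $n,k\ge 1$ and $A,B\in[0,1]$, a pair $(X,G)$ is drawn under $\mathrm{SSBM}(n,k,A,B)$ if $X=(X_1,\dots,X_n)$ has i.i.d. components uniformly distributed on $[k]=\{1,\dots,k\}$ and, conditionally on $X$, $G$ is a random simple graph on the vertex set $[n]$ in which each pair of vertices $u\neq v$ is joined, independently of all other pairs, with probability $A$ if $X_u=X_v$ and with probability $B$ if $X_u\ne X_v$. The agreement of $x,y\in[k]^n$ is $$A(x,y)=\max_{\pi\in S_k}\frac1n\sum_{i=1}^n \mathbf 1(x_i=\pi(y_i)).$$ Exact recovery is \emph{solvable} in a sequence of such models, with fixed $k$ and indexed by $n$, if there is a sequence of (possibly randomized) estimators $\hat X=\hat X(G)\in[k]^n$, which may depend on the parameters of the model, such that $\mathbb P\{A(X,\hat X)=1\}\to 1$ as $n\to\infty$. It is \emph{efficiently solvable} if moreover, for a given sequence of models, such $\hat X$ can be computed from $G$ for all $n$ by one deterministic algorithm (a program of a random access machine with addition and subtraction at unit cost) whose running time is bounded by a polynomial in $n$ for all graphs on $n$ vertices. \textbf{Theorem.} Let $a,b\ge 0$ be real numbers. Consider $\mathrm{SSBM}(n,2,a\ln(n)/n,b\ln(n)/n)$,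 which is defined for all sufficiently large $n$. If $|\sqrt a-\sqrt b|>\sqrt2$, then exact recovery is solvable, and efficiently so. If $|\sqrt a-\sqrt b|<\sqrt 2$, then exact recovery is not solvable. -/

import Mathlib

open Filter Topology

namespace BlockModel

noncomputable section

open scoped Classical in
/-- A simple graph on `Fin n` is the same as a choice, for each pair `u < v`, of whether it is
an edge. -/
def graphEquiv (n : ℕ) :
    SimpleGraph (Fin n) ≃ ({e : Fin n × Fin n // e.1 < e.2} → Bool) where
  toFun G e := decide (G.Adj e.1.1 e.1.2)
  invFun f :=
    { Adj := fun u v => (∃ h : u < v, f ⟨(u, v), h⟩ = true) ∨ (∃ h : v < u, f ⟨(v, u), h⟩ = true)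
      symm := ⟨fun _ _ h => h.symm⟩
      loopless := ⟨fun u h => by rcases h with ⟨h, _⟩ | ⟨h, _⟩ <;> exact lt_irrefl u h⟩ }
  left_inv G := by
    ext u v
    simp only [decide_eq_true_eq, exists_prop]
    constructor
    · rintro (⟨_, h⟩ | ⟨_, h⟩)
      · exact h
      · exact h.symm
    · intro h
      rcases lt_or_gt_of_ne h.ne with h' | h'
      · exact Or.inl ⟨h', h⟩
      · exact Or.inr ⟨h', h.symm⟩
  right_inv f := by
    funext ⟨⟨u, v⟩, h⟩
    have h : u < v := h
    simp [h, h.not_gt]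

/-- The law of `n` i.i.d. community labels with common distribution `p`. -/
def labelLaw (n : ℕ) {k : ℕ} (p : PMF (Fin k)) : PMF (Fin n → Fin k) :=
  PMF.ofFintype (fun x => ∏ u, p (x u)) (by
    have h := Finset.prod_univ_sum (fun _ : Fin n => (Finset.univ : Finset (Fin k)))
      (fun _ i => p i)
    rw [Fintype.piFinset_univ] at h
    have hp : ∑ i, p i = 1 := by rw [← tsum_fintype (L := .unconditional _)]; exact p.tsum_coe
    rw [← h, hp, Finset.prod_const_one])

open scoped Classical in
/-- The law of the random simple graph on `Fin n` in which, independently for all pairs `u < v`,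
the vertices `u` and `v` are adjacent with probability `q u v`. -/
def graphLaw (n : ℕ) (q : Fin n → Fin n → unitInterval) : PMF (SimpleGraph (Fin n)) :=
  PMF.ofFintype
    (fun G => ∏ e : Fin n × Fin n with e.1 < e.2,
      ENNReal.ofReal (if G.Adj e.1 e.2 then (q e.1 e.2 : ℝ) else 1 - q e.1 e.2)) (by
    let f : {e : Fin n × Fin n // e.1 < e.2} → Bool → ENNReal := fun e c =>
      ENNReal.ofReal (if c = true then (q e.1.1 e.1.2 : ℝ) else 1 - q e.1.1 e.1.2)
    have h := Finset.prod_univ_sum (fun _ : {e : Fin n × Fin n // e.1 < e.2} =>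
      (Finset.univ : Finset Bool)) f
    rw [Fintype.piFinset_univ] at h
    have hone : ∀ e, ∑ c, f e c = 1 := by
      intro e
      have h0 := (q e.1.1 e.1.2).2.1
      have h1 := (q e.1.1 e.1.2).2.2
      simp only [f, Fintype.sum_bool, if_true, Bool.false_eq_true, if_false]
      rw [← ENNReal.ofReal_add h0 (by linarith)]
      simp
    rw [Finset.prod_congr rfl (fun e _ => hone e), Finset.prod_const_one] at h
    rw [h, ← Equiv.sum_comp (graphEquiv n)]
    refine Finset.sum_congr rfl fun G _ => ?_
    rw [Finset.prod_subtype (Finset.univ.filter fun e : Fin n × Fin n => e.1 < e.2)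
      (p := fun e => e.1 < e.2) (by simp)]
    refine Finset.prod_congr rfl fun e _ => ?_
    simp [f, graphEquiv])

/-- The stochastic block model `SBM(n, p, W)`, as the joint law of the labels `X` and the
graph `G`: the labels are i.i.d. with law `p` and, given `X = x`, each pair of vertices `u`, `v` is
joined with probability `W s(x u, x v)`, independently of the other pairs. The symmetric matrix `W`
of connection probabilities is a function on unordered pairs of communities. -/
def SBM (n : ℕ) {k : ℕ} (p : PMF (Fin k)) (W : Sym2 (Fin k) → unitInterval) :
    PMF ((Fin n → Fin k) × SimpleGraph (Fin n)) :=
  (labelLaw n p).bind fun x => (graphLaw n fun u v => W s(x u, x v)).map fun G => (x, G)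

/-- The symmetric stochastic block model `SSBM(n, k, A, B)`: uniform prior on `k` communities,
connection probability `A` inside the communities and `B` across. -/
def SSBM (n k : ℕ) [NeZero k] (A B : unitInterval) :
    PMF ((Fin n → Fin k) × SimpleGraph (Fin n)) :=
  SBM n (PMF.uniformOfFintype (Fin k)) fun e => if e.IsDiag then A else B

/-- The connection probability `c ln n / n`. For `c ≥ 0` this number lies in `[0, 1]` for all but
finitely many `n`; for the remaining `n` it is replaced by `1`. -/
def logProb (c : ℝ) (n : ℕ) : unitInterval :=
  Set.projIcc 0 1 zero_le_one (c * Real.log n / n)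

/-- The agreement `max_π (1/n) #{i | x i = π (y i)}` of two community vectors, the maximum being
over all relabellings `π` of the communities. -/
def agreement {n k : ℕ} (x y : Fin n → Fin k) : ℝ :=
  Finset.univ.sup' Finset.univ_nonempty fun π : Equiv.Perm (Fin k) =>
    (1 / (n : ℝ)) * ∑ i, if x i = π (y i) then 1 else 0

/-- The probability that the (possibly randomized) estimator `Xhat`, applied to the graph `G`, has
agreement one with `X`, where `(X, G)` has law `P` and the internal randomness of the estimator is
independent of `(X, G)`. -/
def successProb {n k : ℕ} (P : PMF ((Fin n → Fin k) × SimpleGraph (Fin n)))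
    (Xhat : SimpleGraph (Fin n) → PMF (Fin n → Fin k)) : ENNReal :=
  (P.bind fun XG => (Xhat XG.2).map fun y => (XG.1, y)).toOuterMeasure
    {xy | agreement xy.1 xy.2 = 1}

/-- Exact recovery is solvable (information-theoretically) in the sequence of models `P`: some
sequence of estimators, of any complexity and possibly randomized, has agreement one with the
labels with probability `1 - o(1)`. -/
def ExactRecoverySolvable {k : ℕ}
    (P : ∀ n : ℕ, PMF ((Fin n → Fin k) × SimpleGraph (Fin n))) : Prop :=
  ∃ Xhat : ∀ n : ℕ, SimpleGraph (Fin n) → PMF (Fin n → Fin k),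
    Tendsto (fun n => successProb (P n) (Xhat n)) atTop (𝓝 1)

end

/-! ### Random access machine programs and their running time -/

/-- The memory of the machine: natural number variables and arrays of natural numbers. A given
program mentions only finitely many variables and arrays. -/
structure Memory where
  var : ℕ → ℕ
  arr : ℕ → ℕ → ℕ

/-- Assignment to a variable. -/
def Memory.setVar (s : Memory) (i c : ℕ) : Memory :=
  { s with var := Function.update s.var i c }

/-- Assignment to an array cell. -/
def Memory.setArr (s : Memory) (a j c : ℕ) : Memory :=
  { s with arr := Function.update s.arr a (Function.update (s.arr a) j c) }

/-- Programs of a random access machine with structured control. The only arithmetic operations are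
addition and truncated subtraction, so that the bit length of the numbers grows by at most one per
step, and counting every operation as one step agrees with Turing machine time up to a
polynomial. -/
inductive Program
  /-- `x_i := c` -/
  | const (i c : ℕ)
  /-- `x_i := x_j + x_l` -/
  | add (i j l : ℕ)
  /-- `x_i := x_j - x_l`, truncated at zero -/
  | sub (i j l : ℕ)
  /-- `x_i := a[x_j]` -/
  | load (i a j : ℕ)
  /-- `a[x_j] := x_i` -/
  | store (a j i : ℕ)
  /-- run the first program, then the second -/
  | seq (p q : Program)
  /-- `if x_i ≠ 0 then p else q` -/
  | cond (i : ℕ) (p q : Program)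
  /-- `while x_i ≠ 0 do p` -/
  | loop (i : ℕ) (p : Program)

/-- `Runs p s t s'`: started in memory `s`, the program `p` halts after exactly `t` steps in
memory `s'`. Every assignment and every test costs one step. -/
inductive Runs : Program → Memory → ℕ → Memory → Prop
  | const (i c : ℕ) (s : Memory) : Runs (.const i c) s 1 (s.setVar i c)
  | add (i j l : ℕ) (s : Memory) : Runs (.add i j l) s 1 (s.setVar i (s.var j + s.var l))
  | sub (i j l : ℕ) (s : Memory) : Runs (.sub i j l) s 1 (s.setVar i (s.var j - s.var l))
  | load (i a j : ℕ) (s : Memory) : Runs (.load i a j) s 1 (s.setVar i (s.arr a (s.var j)))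
  | store (a j i : ℕ) (s : Memory) : Runs (.store a j i) s 1 (s.setArr a (s.var j) (s.var i))
  | seq {p q : Program} {s s' s'' : Memory} {t t' : ℕ} :
      Runs p s t s' → Runs q s' t' s'' → Runs (.seq p q) s (t + t') s''
  | condTrue {i : ℕ} {p q : Program} {s s' : Memory} {t : ℕ} :
      s.var i ≠ 0 → Runs p s t s' → Runs (.cond i p q) s (t + 1) s'
  | condFalse {i : ℕ} {p q : Program} {s s' : Memory} {t : ℕ} :
      s.var i = 0 → Runs q s t s' → Runs (.cond i p q) s (t + 1) s'
  | loopDone {i : ℕ} {p : Program} {s : Memory} :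
      s.var i = 0 → Runs (.loop i p) s 1 s
  | loopStep {i : ℕ} {p : Program} {s s' s'' : Memory} {t t' : ℕ} :
      s.var i ≠ 0 → Runs p s t s' → Runs (.loop i p) s' t' s'' →
        Runs (.loop i p) s (t + t' + 1) s''

noncomputable section

open scoped Classical in
/-- The initial memory on input a graph `G` on `n` vertices: variable `0` holds `n`, array `0` holds
the adjacency matrix of `G` row by row, and everything else is zero. -/
def inputMemory {n : ℕ} (G : SimpleGraph (Fin n)) : Memory where
  var i := if i = 0 then n else 0
  arr a j := if a = 0 ∧ ∃ u v : Fin n, j = n * u + v ∧ G.Adj u v then 1 else 0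

/-- The program `c` computes the estimator `f` in polynomial time: there is a polynomial `T` such
that, for every `n` and every graph `G` on `n` vertices, `c` halts on input `G` after at most `T(n)`
steps and leaves the label of each vertex `u` in cell `u` of array `1`. -/
def ComputesInPolyTime {k : ℕ} (c : Program)
    (f : ∀ n : ℕ, SimpleGraph (Fin n) → (Fin n → Fin k)) : Prop :=
  ∃ T : Polynomial ℕ, ∀ (n : ℕ) (G : SimpleGraph (Fin n)),
    ∃ (t : ℕ) (s : Memory), Runs c (inputMemory G) t s ∧ t ≤ T.eval n ∧
      ∀ u : Fin n, s.arr 1 u = (f n G u : ℕ)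

/-- Exact recovery is efficiently solvable in the sequence of models `P`: a single deterministic
polynomial time program, working for all `n`, computes estimators that have agreement one with the
labels with probability `1 - o(1)`. -/
def ExactRecoveryEfficientlySolvable {k : ℕ}
    (P : ∀ n : ℕ, PMF ((Fin n → Fin k) × SimpleGraph (Fin n))) : Prop :=
  ∃ (c : Program) (f : ∀ n : ℕ, SimpleGraph (Fin n) → (Fin n → Fin k)),
    ComputesInPolyTime c f ∧
      Tendsto (fun n => successProb (P n) fun G => PMF.pure (f n G)) atTop (𝓝 1)

end

end BlockModel

namespace BlockModel

/-! ### A program logic with time bounds -/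

/-! Let s be the ±1 vector of the labels x. Given x, the adjacency matrix is, up to its diagonal,
the sum of a constant matrix, the rank one signal (pa - pb)/2 · s sᵀ and a centred noise W. Degrees,
signal and the margins by which neighbourhoods reveal labels all live on the scale log n.

Above the threshold, Chernoff bounds and a union bound over pairs of sets give |W(S,T)| ≤ ε log n ·
√(|S||T|) for all S and T, with ε as small as desired (`eventually_discrepancy`,
`discrepancy_of_comparable`). As the absolute row sums are O(log n), a dyadic decomposition of
vectors turns this into an operator norm bound by a small multiple of log n (`abs_form_le`,
`sum_sq_mulVec_le`). Projecting away the constant vectors leaves the signal dominant, so a suitable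
column of a high power of the projected matrix points along it (`exists_column_close`), and the
signs of that column are correct, up to a global sign, outside a small fraction of the vertices
(`card_error_le_of_isBestLabel`). All coordinate vectors are tried as starts, and the one with the
largest diagonal entry is kept, so no randomness is needed.

The remaining errors are removed by repeated voting: every vertex joins the majority of its
neighbours, or the minority if a < b. A Chernoff bound with optimal exponent (√a - √b)²/2 > 1 shows
that a fixed vertex has margin below δ log n under the true labels with probability at most
n^(-1-c), so with high probability all margins are large (`exists_exponent`, `graphProb_vote_le`).
Small discrepancy then forces every round to have fewer errors than the one before
(`card_wrong_vote_lt`). The deterministic guarantee is collected in `machineSpin_iterate_vote_eq`,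
and the calculus of `Halts` shows that a concrete program carries it out in polynomial time
(`halts_recoveryProgram`).

Below the threshold, the prior being uniform, the posterior weight of x is proportional to the
probability of the graph under x. A vertex with equally many neighbours in both communities can
change sides at the cost of at most a factor 2 (`graphWeight_le_two_mul_flip`), but no estimate is
correct for both labellings. So every estimator fails with probability at least a fifth of the
probability that such a cheap flip exists (`sum_graphProb_flip_le`). The expected number of vertices
with about √(ab)/2 · log n neighbours on each side tends to infinity. Only vertices of a reserve H
with neighbourhoods avoiding H are counted; their events are nearly independent, and the second
moment method yields a cheap flip with probability at least 3/4 for balanced labels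
(`graphProb_forall_not_exists_star_le`, `eventually_exists_flip`). -/

@[simp] theorem Memory.setVar_var (s : Memory) (i c j : ℕ) :
    (s.setVar i c).var j = if j = i then c else s.var j := by
  simp [Memory.setVar, Function.update_apply]

@[simp] theorem Memory.setVar_arr (s : Memory) (i c : ℕ) : (s.setVar i c).arr = s.arr := rfl

@[simp] theorem Memory.setArr_var (s : Memory) (a j c : ℕ) : (s.setArr a j c).var = s.var := rfl

@[simp] theorem Memory.setArr_arr (s : Memory) (a j c a' : ℕ) :
    (s.setArr a j c).arr a' = if a' = a then Function.update (s.arr a) j c else s.arr a' := by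
  simp only [Memory.setArr, Function.update_apply]

/-- Started in `s`, the program `p` halts after at most `T` steps in a memory satisfying `Q`. -/
def Halts (p : Program) (s : Memory) (T : ℕ) (Q : Memory → Prop) : Prop :=
  ∃ t s', Runs p s t s' ∧ t ≤ T ∧ Q s'

theorem Halts.mono {p : Program} {s : Memory} {T T' : ℕ} {Q Q' : Memory → Prop}
    (h : Halts p s T Q) (hT : T ≤ T') (hQ : ∀ s', Q s' → Q' s') : Halts p s T' Q' := by
  obtain ⟨t, s', h1, h2, h3⟩ := h
  exact ⟨t, s', h1, h2.trans hT, hQ _ h3⟩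

theorem Halts.const {i c : ℕ} {s : Memory} {Q : Memory → Prop} (h : Q (s.setVar i c)) :
    Halts (.const i c) s 1 Q := ⟨_, _, Runs.const i c s, le_rfl, h⟩

theorem Halts.add {i j l : ℕ} {s : Memory} {Q : Memory → Prop}
    (h : Q (s.setVar i (s.var j + s.var l))) :
    Halts (.add i j l) s 1 Q := ⟨_, _, Runs.add i j l s, le_rfl, h⟩

theorem Halts.sub {i j l : ℕ} {s : Memory} {Q : Memory → Prop}
    (h : Q (s.setVar i (s.var j - s.var l))) :
    Halts (.sub i j l) s 1 Q := ⟨_, _, Runs.sub i j l s, le_rfl, h⟩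

theorem Halts.load {i a j : ℕ} {s : Memory} {Q : Memory → Prop}
    (h : Q (s.setVar i (s.arr a (s.var j)))) :
    Halts (.load i a j) s 1 Q := ⟨_, _, Runs.load i a j s, le_rfl, h⟩

theorem Halts.store {a j i : ℕ} {s : Memory} {Q : Memory → Prop}
    (h : Q (s.setArr a (s.var j) (s.var i))) :
    Halts (.store a j i) s 1 Q := ⟨_, _, Runs.store a j i s, le_rfl, h⟩

theorem Halts.seq {p q : Program} {s : Memory} {T T' : ℕ} {Q : Memory → Prop}
    (h : Halts p s T fun s' => Halts q s' T' Q) : Halts (.seq p q) s (T + T') Q := by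
  obtain ⟨t, s', h1, h2, t', s'', h3, h4, h5⟩ := h
  exact ⟨_, _, Runs.seq h1 h3, by omega, h5⟩

theorem Halts.cond {i : ℕ} {p q : Program} {s : Memory} {T : ℕ} {Q : Memory → Prop}
    (h1 : s.var i ≠ 0 → Halts p s T Q) (h0 : s.var i = 0 → Halts q s T Q) :
    Halts (.cond i p q) s (T + 1) Q := by
  by_cases h : s.var i = 0
  · obtain ⟨t, s', h2, h3, h4⟩ := h0 h
    exact ⟨_, _, Runs.condFalse h h2, by omega, h4⟩
  · obtain ⟨t, s', h2, h3, h4⟩ := h1 h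
    exact ⟨_, _, Runs.condTrue h h2, by omega, h4⟩

/-- Run `p` with variable `i` going from `n - 1` down to `0`, where `n` is the content of
variable `0`. Variables `1` and `2` have to contain one and zero. -/
def forDown (i : ℕ) (p : Program) : Program :=
  .seq (.add i 0 2) (.loop i (.seq (.sub i i 1) p))

/-- The index of the invariant is the number of turns still to be made. Each turn costs a test, a
decrement and the body, hence `T + 2`; the final 2 pays for the initial assignment and the last
test. -/
theorem Halts.forDown {i n T : ℕ} {p : Program} {s : Memory} (Inv : ℕ → Memory → Prop)
    (hn : s.var 0 = n) (h2 : s.var 2 = 0) (hone : ∀ k s, Inv k s → s.var 1 = 1)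
    (h0 : Inv n (s.setVar i n))
    (hstep : ∀ k < n, ∀ s, Inv (k + 1) s → s.var i = k + 1 →
      Halts p (s.setVar i k) T fun s' => s'.var i = k ∧ Inv k s') :
    Halts (BlockModel.forDown i p) s (n * (T + 2) + 2) (Inv 0) := by
  have key : ∀ k ≤ n, ∀ s, Inv k s → s.var i = k →
      Halts (.loop i (.seq (.sub i i 1) p)) s (k * (T + 2) + 1) (Inv 0) := by
    intro k
    induction k with
    | zero => exact fun _ s hI hi => ⟨1, s, Runs.loopDone hi, by omega, hI⟩
    | succ k ih =>
      intro hk s hI hi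
      obtain ⟨t, s', hr, ht, hi', hI'⟩ := hstep k (by omega) s hI hi
      obtain ⟨t', s'', hr', ht', hI''⟩ := ih (by omega) s' hI' hi'
      have hs := Runs.sub i i 1 s
      rw [hi, hone _ _ hI, Nat.add_sub_cancel] at hs
      refine ⟨_, _, Runs.loopStep (by omega) (Runs.seq hs hr) hr', ?_, hI''⟩
      rw [Nat.succ_mul]
      omega
  refine Halts.mono (Halts.seq (T := 1) (T' := n * (T + 2) + 1) (Halts.add ?_)) (by omega)
    fun _ h => h
  rw [hn, h2, Nat.add_zero]
  exact key n le_rfl _ h0 (by simp)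

/-- The memories agree outside the variables in `V` and the arrays in `A`. -/
def Frame (V A : List ℕ) (s s' : Memory) : Prop :=
  (∀ i, i ∉ V → s'.var i = s.var i) ∧ ∀ a, a ∉ A → s'.arr a = s.arr a

theorem Frame.refl (V A : List ℕ) (s : Memory) : Frame V A s s :=
  ⟨fun _ _ => rfl, fun _ _ => rfl⟩

theorem Frame.trans {V A V' A' : List ℕ} {s s' s'' : Memory} (h : Frame V A s s')
    (h' : Frame V' A' s' s'') (hV : V' ⊆ V) (hA : A' ⊆ A) : Frame V A s s'' :=
  ⟨fun i hi => (h'.1 i fun h => hi (hV h)).trans (h.1 i hi),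
    fun i hi => (h'.2 i fun h => hi (hA h)).trans (h.2 i hi)⟩

theorem Frame.setVar {V A : List ℕ} {s s' : Memory} (h : Frame V A s s') {i : ℕ} (hi : i ∈ V)
    (c : ℕ) : Frame V A s (s'.setVar i c) := by
  refine ⟨fun j hj => ?_, h.2⟩
  have : j ≠ i := by rintro rfl; exact hj hi
  simp [this, h.1 j hj]

theorem Frame.setArr {V A : List ℕ} {s s' : Memory} (h : Frame V A s s') {a : ℕ} (ha : a ∈ A)
    (j c : ℕ) : Frame V A s (s'.setArr a j c) := by
  refine ⟨h.1, fun b hb => ?_⟩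
  have : b ≠ a := by rintro rfl; exact hb ha
  simp [this, h.2 b hb]

/-- The variables `0`, `1`, `2` hold the number of vertices, one and zero. -/
def Consts (n : ℕ) (s : Memory) : Prop := s.var 0 = n ∧ s.var 1 = 1 ∧ s.var 2 = 0

theorem Consts.frame {n : ℕ} {V B : List ℕ} {s s' : Memory} (h : Consts n s)
    (hf : Frame V B s s') (hV : ∀ i ∈ V, 3 ≤ i) : Consts n s' :=
  ⟨(hf.1 0 fun h => by have := hV _ h; omega).trans h.1,
    (hf.1 1 fun h => by have := hV _ h; omega).trans h.2.1,
    (hf.1 2 fun h => by have := hV _ h; omega).trans h.2.2⟩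

/-- A loop whose body adds `F k` to variable `6` and `G k` to variable `7`. -/
theorem Halts.accumulate {n i T : ℕ} {V : List ℕ} {p : Program} {s : Memory} (F G : ℕ → ℕ)
    (hs : Consts n s) (hV : ∀ j ∈ i :: V, 3 ≤ j) (hiV : i ∉ V) (hi6 : i ≠ 6) (hi7 : i ≠ 7)
    (hbody : ∀ k < n, ∀ s', Frame (i :: V) [] s s' → s'.var i = k →
      Halts p s' T fun s'' => Frame V [] s' s'' ∧ s''.var 6 = s'.var 6 + F k ∧
        s''.var 7 = s'.var 7 + G k) :
    Halts (BlockModel.forDown i p) s (n * (T + 2) + 2) fun s' => Frame (i :: V) [] s s' ∧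
      s'.var 6 = s.var 6 + ∑ k ∈ Finset.range n, F k ∧
      s'.var 7 = s.var 7 + ∑ k ∈ Finset.range n, G k := by
  -- The counter runs downwards, so at value `k` exactly the terms with index in `[k, n)` have been
  -- added.
  refine Halts.mono (Halts.forDown (T := T) (fun k s' => Frame (i :: V) [] s s' ∧
      s'.var 6 = s.var 6 + ∑ k ∈ Finset.Ico k n, F k ∧
      s'.var 7 = s.var 7 + ∑ k ∈ Finset.Ico k n, G k) hs.1 hs.2.2
      (fun k s' h => (hs.frame h.1 hV).2.1) ?_ ?_) le_rfl ?_
  · exact ⟨(Frame.refl _ _ _).setVar (by simp) _, by simp [hi6.symm], by simp [hi7.symm]⟩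
  · rintro k hk s' ⟨h1, h2, h3⟩ -
    refine (hbody k hk _ (h1.setVar (by simp) _) (by simp)).mono le_rfl ?_
    rintro s'' ⟨g1, g2, g3⟩
    refine ⟨by rw [g1.1 i hiV]; simp,
      (h1.setVar (i := i) (by simp) k).trans g1 (by simp) (by simp), ?_, ?_⟩
    · rw [g2, Finset.sum_eq_sum_Ico_succ_bot hk]
      simp [hi6.symm, h2]; ring
    · rw [g3, Finset.sum_eq_sum_Ico_succ_bot hk]
      simp [hi7.symm, h3]; ring
  · intro s' h
    simpa only [Finset.range_eq_Ico] using h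

/-- A loop whose body writes `F a k` into cell `k` of each array `a` in the list `A`. -/
theorem Halts.fill {n i T : ℕ} {V A : List ℕ} {p : Program} {s : Memory} (F : ℕ → ℕ → ℕ)
    (hs : Consts n s) (hV : ∀ j ∈ i :: V, 3 ≤ j) (hiV : i ∉ V)
    (hbody : ∀ k < n, ∀ s', Frame (i :: V) A s s' → s'.var i = k →
      Halts p s' T fun s'' => Frame V A s' s'' ∧
        ∀ a ∈ A, s''.arr a = Function.update (s'.arr a) k (F a k)) :
    Halts (BlockModel.forDown i p) s (n * (T + 2) + 2) fun s' => Frame (i :: V) A s s' ∧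
      ∀ a ∈ A, ∀ k < n, s'.arr a k = F a k := by
  refine Halts.mono (Halts.forDown (T := T) (fun k s' => Frame (i :: V) A s s' ∧
      ∀ a ∈ A, ∀ j < n, k ≤ j → s'.arr a j = F a j) hs.1 hs.2.2
      (fun k s' h => (hs.frame h.1 hV).2.1) ?_ ?_) le_rfl ?_
  · exact ⟨(Frame.refl _ _ _).setVar (by simp) _, fun a _ j hj hj' => by omega⟩
  · rintro k hk s' ⟨h1, h2⟩ -
    refine (hbody k hk _ (h1.setVar (by simp) _) (by simp)).mono le_rfl ?_
    rintro s'' ⟨g1, g2⟩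
    refine ⟨by rw [g1.1 i hiV]; simp,
      (h1.setVar (i := i) (by simp) k).trans g1 (by simp) (by simp), ?_⟩
    intro a ha j hj hkj
    rw [g2 a ha, Function.update_apply]
    split_ifs with h
    · rw [h]
    · exact h2 a ha j hj (by omega)
  · exact fun s' h => ⟨h.1, fun a ha k hk => h.2 a ha k hk (Nat.zero_le _)⟩

/-- Repeating `n` times a program that advances a property by one step. -/
theorem Halts.repeat {n i T : ℕ} {V A : List ℕ} {p : Program} {s : Memory}
    (Φ : ℕ → Memory → Prop) (hs : Consts n s) (hV : ∀ j ∈ i :: V, 3 ≤ j) (hiV : i ∉ V)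
    (hΦ : ∀ k s c, Φ k s → Φ k (s.setVar i c)) (h0 : Φ 0 s)
    (hbody : ∀ k < n, ∀ s', Frame (i :: V) A s s' → Φ k s' →
      Halts p s' T fun s'' => Frame V A s' s'' ∧ Φ (k + 1) s'') :
    Halts (BlockModel.forDown i p) s (n * (T + 2) + 2) fun s' => Frame (i :: V) A s s' ∧
      Φ n s' := by
  refine Halts.mono (Halts.forDown (T := T) (fun k s' => Frame (i :: V) A s s' ∧
      Φ (n - k) s') hs.1 hs.2.2 (fun k s' h => (hs.frame h.1 hV).2.1) ?_ ?_) le_rfl ?_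
  · exact ⟨(Frame.refl _ _ _).setVar (by simp) _, by rw [Nat.sub_self]; exact hΦ _ _ _ h0⟩
  · rintro k hk s' ⟨h1, h2⟩ -
    refine (hbody (n - (k + 1)) (by omega) _ (h1.setVar (by simp) _) (hΦ _ _ _ h2)).mono le_rfl ?_
    rintro s'' ⟨g1, g2⟩
    refine ⟨by rw [g1.1 i hiV]; simp,
      (h1.setVar (i := i) (by simp) k).trans g1 (by simp) (by simp), ?_⟩
    rwa [show n - k = n - (k + 1) + 1 by omega]
  · exact fun s' h => h

/-! ### The subroutines -/

/-- `x_6 += a[x_4]` and `x_7 += b[x_4]` if the vertices `x_i` and `x_4` are adjacent. Array `6`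
contains the multiples of `n`. -/
def addNeighbour (i a b : ℕ) : Program :=
  .seq (.load 8 6 i) <| .seq (.add 8 8 4) <| .seq (.load 9 0 8) <|
    .cond 9 (.seq (.load 10 a 4) <| .seq (.add 6 6 10) <| .seq (.load 10 b 4) (.add 7 7 10))
      (.const 9 0)

/-- The entries of the adjacency matrix stored in array `0`, as truth values. -/
def edge (n : ℕ) (A : ℕ → ℕ) (u v : ℕ) : ℕ := if A (n * u + v) ≠ 0 then 1 else 0

/-- The memory holds the constants used by the subroutines. -/
def Ready (n : ℕ) (A : ℕ → ℕ) (s : Memory) : Prop :=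
  Consts n s ∧ s.arr 0 = A ∧ ∀ u < n, s.arr 6 u = n * u

theorem Ready.frame {n : ℕ} {A : ℕ → ℕ} {V B : List ℕ} {s s' : Memory} (h : Ready n A s)
    (hf : Frame V B s s') (hV : ∀ i ∈ V, 3 ≤ i := by simp) (hb : 0 ∉ B := by simp)
    (hb' : 6 ∉ B := by simp) : Ready n A s' :=
  ⟨h.1.frame hf hV, (hf.2 0 hb).trans h.2.1, by rw [hf.2 6 hb']; exact h.2.2⟩

theorem halts_addNeighbour {n : ℕ} {A : ℕ → ℕ} {s : Memory} (hs : Ready n A s) {i a b u v : ℕ}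
    (hu : s.var i = u) (hv : s.var 4 = v) (hun : u < n) :
    Halts (addNeighbour i a b) s 8 fun s' => Frame [6, 7, 8, 9, 10] [] s s' ∧
      s'.var 6 = s.var 6 + edge n A u v * s.arr a v ∧
      s'.var 7 = s.var 7 + edge n A u v * s.arr b v := by
  obtain ⟨-, a4, a5⟩ := hs
  have hF : Frame [6, 7, 8, 9, 10] [] s s := Frame.refl _ _ _
  refine Halts.mono (T := 1 + (1 + (1 + ((1 + (1 + (1 + 1))) + 1)))) ?_ (by omega) fun _ h => h
  refine Halts.seq (Halts.load <| Halts.seq <| Halts.add <| Halts.seq <| Halts.load <|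
    Halts.cond (fun h => ?_) fun h => ?_)
  · refine Halts.seq (Halts.load <| Halts.seq <| Halts.add <| Halts.seq <| Halts.load <|
      Halts.add ?_)
    refine ⟨by iterate 7 refine Frame.setVar ?_ (by simp) _
               exact hF, ?_⟩
    simp [hu, hv, a4, a5 u hun] at h
    simp [hv, edge, h]
  · refine (Halts.const ?_).mono (by omega) fun _ h => h
    refine ⟨by iterate 4 refine Frame.setVar ?_ (by simp) _
               exact hF, ?_⟩
    simp [hu, hv, a4, a5 u hun] at h
    simp [edge, h]

/-- One step of the power iteration on the signed vector `P - N`: multiplication by the adjacency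
matrix followed by multiplication by `n I - J`. -/
def powerStep (n : ℕ) (e : ℕ → ℕ → ℕ) (z : (ℕ → ℕ) × (ℕ → ℕ)) : (ℕ → ℕ) × (ℕ → ℕ) :=
  (fun u => ∑ v ∈ Finset.range n, ∑ w ∈ Finset.range n, (e u v * z.1 v + e w v * z.2 v),
    fun u => ∑ v ∈ Finset.range n, ∑ w ∈ Finset.range n, (e u v * z.2 v + e w v * z.1 v))

/-- The program for `powerStep`, from the arrays `a`, `b` to the arrays `a'`, `b'`. -/
def powerStepProgram (a b a' b' : ℕ) : Program :=
  forDown 3 <| .seq (.const 6 0) <| .seq (.const 7 0) <|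
    .seq (forDown 4 (forDown 5 (.seq (addNeighbour 3 a b) (addNeighbour 5 b a)))) <|
    .seq (.store a' 3 6) (.store b' 3 7)

theorem halts_powerStepProgram {n : ℕ} {A : ℕ → ℕ} {s : Memory} (hs : Ready n A s)
    {a b a' b' : ℕ} (h0 : 0 ∉ [a', b']) (h6 : 6 ∉ [a', b']) (ha : a ∉ [a', b'])
    (hb : b ∉ [a', b']) (hab : a' ≠ b') :
    Halts (powerStepProgram a b a' b') s (n * (n * (n * 18 + 4) + 8) + 2) fun s' =>
      Frame [3, 4, 5, 6, 7, 8, 9, 10] [a', b'] s s' ∧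
      (∀ u < n, s'.arr a' u = (powerStep n (edge n A) (s.arr a, s.arr b)).1 u) ∧
      ∀ u < n, s'.arr b' u = (powerStep n (edge n A) (s.arr a, s.arr b)).2 u := by
  set z := powerStep n (edge n A) (s.arr a, s.arr b) with hz
  refine Halts.mono (Halts.fill (T := 1 + (1 + ((n * ((n * (16 + 2) + 2) + 2) + 2) + (1 + 1))))
    (V := [4, 5, 6, 7, 8, 9, 10]) (A := [a', b']) (fun c => if c = a' then z.1 else z.2)
    hs.1 (by simp) (by simp) ?_) (by
      apply le_of_eq; ring) ?_
  · intro u hu s₁ hf₁ hu₁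
    refine Halts.seq (Halts.const <| Halts.seq <| Halts.const <| Halts.seq ?_)
    have hf₂ : Frame [3, 4, 5, 6, 7, 8, 9, 10] [a', b'] s ((s₁.setVar 6 0).setVar 7 0) :=
      (hf₁.setVar (by simp) _).setVar (by simp) _
    set s₂ := (s₁.setVar 6 0).setVar 7 0 with hs₂
    have hA : s₂.arr a = s.arr a := hf₂.2 a ha
    have hB : s₂.arr b = s.arr b := hf₂.2 b hb
    have hr₂ := hs.frame hf₂ (by simp) h0 h6
    refine (Halts.accumulate (n := n) (i := 4) (V := [5, 6, 7, 8, 9, 10])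
      (fun v => ∑ w ∈ Finset.range n, (edge n A u v * s.arr a v + edge n A w v * s.arr b v))
      (fun v => ∑ w ∈ Finset.range n, (edge n A u v * s.arr b v + edge n A w v * s.arr a v))
      hr₂.1 (by simp) (by simp) (by simp) (by simp) ?_).mono le_rfl ?_
    · intro v hv s₃ hf₃ hv₃
      have hr₃ := hr₂.frame hf₃
      refine (Halts.accumulate (n := n) (i := 5) (V := [6, 7, 8, 9, 10])
        (fun w => edge n A u v * s.arr a v + edge n A w v * s.arr b v)
        (fun w => edge n A u v * s.arr b v + edge n A w v * s.arr a v)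
        hr₃.1 (by simp) (by simp) (by simp) (by simp) ?_).mono le_rfl fun s' h => h
      intro w hw s₄ hf₄ hw₄
      have hr₄ := hr₃.frame hf₄
      have hu₄ : s₄.var 3 = u := by
        rw [hf₄.1 3 (by simp), hf₃.1 3 (by simp), hs₂]; simp [hu₁]
      have hv₄ : s₄.var 4 = v := by rw [hf₄.1 4 (by simp), hv₃]
      have hA₄ : s₄.arr a = s.arr a := by rw [hf₄.2 _ (by simp), hf₃.2 _ (by simp), hA]
      have hB₄ : s₄.arr b = s.arr b := by rw [hf₄.2 _ (by simp), hf₃.2 _ (by simp), hB]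
      refine Halts.seq (T := 8) (T' := 8) ((halts_addNeighbour hr₄ hu₄ hv₄ hu).mono le_rfl ?_)
      rintro s₅ ⟨hf₅, h56, h57⟩
      refine (halts_addNeighbour (hr₄.frame hf₅) (u := w) (v := v)
        (by rw [hf₅.1 5 (by simp), hw₄]) (by rw [hf₅.1 4 (by simp), hv₄]) hw).mono le_rfl ?_
      rintro s₆ ⟨hf₆, h66, h67⟩
      refine ⟨hf₅.trans hf₆ (by simp) (by simp), ?_, ?_⟩
      · rw [h66, h56, hf₅.2 b (by simp), hA₄, hB₄]; ring
      · rw [h67, h57, hf₅.2 a (by simp), hA₄, hB₄]; ring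
    · rintro s₃ ⟨hf₃, h36, h37⟩
      have h33 : s₃.var 3 = u := by rw [hf₃.1 3 (by simp), hs₂]; simp [hu₁]
      have h26 : s₂.var 6 = 0 := by simp [hs₂]
      have h27 : s₂.var 7 = 0 := by simp [hs₂]
      refine Halts.seq (Halts.store (Halts.store ⟨?_, ?_⟩))
      · refine Frame.setArr (Frame.setArr ?_ (by simp) _ _) (by simp) _ _
        refine ⟨fun i hi => ?_, fun c _ => ?_⟩
        · rw [hf₃.1 i (by simp at hi ⊢; tauto), hs₂]
          simp at hi
          simp [hi]
        · rw [hf₃.2 c (by simp), hs₂]; rfl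
      · intro c hc
        have hc' : c = a' ∨ c = b' := by simpa using hc
        have h3 : s₃.arr c = s₁.arr c := by rw [hf₃.2 c (by simp), hs₂]; rfl
        rcases hc' with rfl | rfl
        · simp [hab, h33, h36, h26, hz, powerStep, h3]
        · simp [hab.symm, h33, h37, h27, hz, powerStep, h3]
  · rintro s' ⟨h1, h2⟩
    refine ⟨h1, fun u hu => ?_, fun u hu => ?_⟩
    · rw [h2 a' (by simp) u hu, if_pos rfl]
    · rw [h2 b' (by simp) u hu, if_neg hab.symm]

/-- The programs control only the cells below `n` of an array, so iterates can be compared only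
there; this congruence lets the specification be iterated all the same. -/
theorem powerStep_congr {n : ℕ} {e : ℕ → ℕ → ℕ} {z z' : (ℕ → ℕ) × (ℕ → ℕ)}
    (h1 : ∀ v < n, z.1 v = z'.1 v) (h2 : ∀ v < n, z.2 v = z'.2 v) :
    powerStep n e z = powerStep n e z' := by
  refine Prod.ext (funext fun u => ?_) (funext fun u => ?_)
  all_goals
    simp only [powerStep]
    refine Finset.sum_congr rfl fun v hv => Finset.sum_congr rfl fun w _ => ?_
    rw [h1 v (Finset.mem_range.1 hv), h2 v (Finset.mem_range.1 hv)]

/-- The vote of the neighbours of each vertex: the new label of `u` is `1` if the neighbours with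
nonzero label outnumber those with label zero (or conversely, if `r` is true). -/
def vote (n : ℕ) (e : ℕ → ℕ → ℕ) (r : Bool) (L : ℕ → ℕ) (u : ℕ) : ℕ :=
  let x := ∑ v ∈ Finset.range n, if L v ≠ 0 then e u v else 0
  let y := ∑ v ∈ Finset.range n, if L v ≠ 0 then 0 else e u v
  if (if r then x < y else y < x) then 1 else 0

theorem vote_congr {n : ℕ} {e : ℕ → ℕ → ℕ} {r : Bool} {L L' : ℕ → ℕ}
    (h : ∀ v < n, L v = L' v) : vote n e r L = vote n e r L' := by
  unfold vote
  ext u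
  have h1 : ∀ f : ℕ → ℕ → ℕ, ∑ v ∈ Finset.range n, f (L v) v = ∑ v ∈ Finset.range n, f (L' v) v :=
    fun f => Finset.sum_congr rfl fun v hv => by rw [h v (Finset.mem_range.1 hv)]
  simp only [h1 fun l v => if l ≠ 0 then e u v else 0, h1 fun l v => if l ≠ 0 then 0 else e u v]

/-- The program for `vote`, from array `a` to array `a'`. -/
def voteProgram (r : Bool) (a a' : ℕ) : Program :=
  forDown 3 <| .seq (.const 6 0) <| .seq (.const 7 0) <|
    .seq (forDown 4 (.seq (.load 8 6 3) <| .seq (.add 8 8 4) <| .seq (.load 9 0 8) <|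
      .cond 9 (.seq (.load 10 a 4) (.cond 10 (.add 6 6 1) (.add 7 7 1))) (.const 9 0))) <|
    .seq (if r then .sub 8 7 6 else .sub 8 6 7) <|
    .seq (.cond 8 (.const 9 1) (.const 9 0)) (.store a' 3 9)

theorem halts_voteProgram {n : ℕ} {A : ℕ → ℕ} {s : Memory} (hs : Ready n A s) (r : Bool)
    {a a' : ℕ} (h0 : 0 ≠ a') (h6 : 6 ≠ a') (ha : a ≠ a') :
    Halts (voteProgram r a a') s (n * (n * 9 + 10) + 2) fun s' =>
      Frame [3, 4, 6, 7, 8, 9, 10] [a'] s s' ∧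
      ∀ u < n, s'.arr a' u = vote n (edge n A) r (s.arr a) u := by
  refine Halts.mono (Halts.fill (T := 1 + (1 + ((n * (7 + 2) + 2) + (1 + (2 + 1)))))
    (V := [4, 6, 7, 8, 9, 10]) (A := [a']) (fun _ => vote n (edge n A) r (s.arr a))
    hs.1 (by simp) (by simp) ?_) (by apply le_of_eq; ring) ?_
  · intro u hu s₁ hf₁ hu₁
    refine Halts.seq (Halts.const <| Halts.seq <| Halts.const <| Halts.seq ?_)
    have hf₂ : Frame [3, 4, 6, 7, 8, 9, 10] [a'] s ((s₁.setVar 6 0).setVar 7 0) :=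
      (hf₁.setVar (by simp) _).setVar (by simp) _
    set s₂ := (s₁.setVar 6 0).setVar 7 0 with hs₂
    have hA : s₂.arr a = s.arr a := hf₂.2 a (by simpa using ha)
    have hr₂ := hs.frame hf₂ (by simp) (by simpa using h0) (by simpa using h6)
    refine (Halts.accumulate (n := n) (i := 4) (V := [6, 7, 8, 9, 10])
      (fun v => if s.arr a v ≠ 0 then edge n A u v else 0)
      (fun v => if s.arr a v ≠ 0 then 0 else edge n A u v)
      hr₂.1 (by simp) (by simp) (by simp) (by simp) ?_).mono le_rfl ?_
    · intro v hv s₃ hf₃ hv₃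
      obtain ⟨⟨-, hone, -⟩, a4, a5⟩ := hr₂.frame hf₃
      have hu₃ : s₃.var 3 = u := by rw [hf₃.1 3 (by simp), hs₂]; simp [hu₁]
      have hA₃ : s₃.arr a = s.arr a := by rw [hf₃.2 _ (by simp), hA]
      have hF : Frame [6, 7, 8, 9, 10] [] s₃ s₃ := Frame.refl _ _ _
      refine Halts.mono (T := 1 + (1 + (1 + (1 + (1 + 1) + 1)))) ?_ (by omega) fun _ h => h
      refine Halts.seq (Halts.load <| Halts.seq <| Halts.add <| Halts.seq <| Halts.load <|
        Halts.cond (fun h => Halts.seq (Halts.load <| Halts.cond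
        (fun h' => Halts.add ⟨?_, ?_⟩) (fun h' => Halts.add ⟨?_, ?_⟩)))
        fun h => (Halts.const ⟨?_, ?_⟩).mono (by omega) fun _ h => h)
      · iterate 5 refine Frame.setVar ?_ (by simp) _
        exact hF
      · simp [hu₃, hv₃, a4, a5 u hu] at h
        simp [hv₃, hA₃] at h'
        simp [edge, h, h', hone]
      · iterate 5 refine Frame.setVar ?_ (by simp) _
        exact hF
      · simp [hu₃, hv₃, a4, a5 u hu] at h
        simp [hv₃, hA₃] at h'
        simp [edge, h, h', hone]
      · iterate 4 refine Frame.setVar ?_ (by simp) _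
        exact hF
      · simp [hu₃, hv₃, a4, a5 u hu] at h
        simp [edge, h]
    · rintro s₃ ⟨hf₃, h36, h37⟩
      have h33 : s₃.var 3 = u := by rw [hf₃.1 3 (by simp), hs₂]; simp [hu₁]
      have h26 : s₂.var 6 = 0 := by simp [hs₂]
      have h27 : s₂.var 7 = 0 := by simp [hs₂]
      rw [h26, zero_add] at h36
      rw [h27, zero_add] at h37
      have hF : Frame [4, 6, 7, 8, 9, 10] [a'] s₁ s₃ := by
        refine ⟨fun i hi => ?_, fun c _ => ?_⟩
        · rw [hf₃.1 i (by simp at hi ⊢; tauto), hs₂]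
          simp at hi
          simp [hi]
        · rw [hf₃.2 c (by simp), hs₂]; rfl
      have h3 : s₃.arr a' = s₁.arr a' := by rw [hf₃.2 _ (by simp), hs₂]; rfl
      refine Halts.seq ?_
      -- Truncated subtraction is nonzero exactly for a strict inequality, so it serves as the
      -- comparison; ties yield label zero.
      have hsub : Halts (if r then .sub 8 7 6 else .sub 8 6 7) s₃ 1 fun s' =>
          ∃ c, s' = s₃.setVar 8 c ∧ (c ≠ 0 ↔ vote n (edge n A) r (s.arr a) u = 1) := by
        cases r
        · refine Halts.sub ⟨_, rfl, ?_⟩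
          rw [h36, h37]
          simp [vote, Nat.sub_eq_zero_iff_le]
        · refine Halts.sub ⟨_, rfl, ?_⟩
          rw [h36, h37]
          simp [vote, Nat.sub_eq_zero_iff_le]
      refine hsub.mono le_rfl ?_
      rintro s₄ ⟨c, rfl, hc⟩
      have hcv : vote n (edge n A) r (s.arr a) u = if c ≠ 0 then 1 else 0 := by
        split_ifs with h
        · exact hc.1 h
        · have := mt hc.2 h
          simp only [vote] at this ⊢
          split_ifs at this ⊢ <;> simp_all
      refine Halts.seq (Halts.cond (fun h => Halts.const <| Halts.store ⟨?_, ?_⟩)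
        (fun h => Halts.const <| Halts.store ⟨?_, ?_⟩))
      · exact ((hF.setVar (by simp) _).setVar (by simp) _).setArr (by simp) _ _
      · simp at h
        simp [hcv, h, h33, h3]
      · exact ((hF.setVar (by simp) _).setVar (by simp) _).setArr (by simp) _ _
      · simp at h
        simp [hcv, h, h33, h3]
  · exact fun s' h => ⟨h.1, h.2 a' (by simp)⟩

/-- The starting vector `n e_i - 1` of the power iteration. -/
def startVector (n i : ℕ) : (ℕ → ℕ) × (ℕ → ℕ) := (fun v => if v = i then n else 0, fun _ => 1)

/-- Writes `startVector` into the arrays `2` and `3`; the start is the content of variable `11`. -/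
def startProgram : Program :=
  forDown 4 <| .seq (.sub 8 4 11) <| .seq (.sub 9 11 4) <| .seq (.add 8 8 9) <|
    .seq (.cond 8 (.const 9 0) (.add 9 0 2)) <| .seq (.store 2 4 9) (.store 3 4 1)

theorem halts_startProgram {n i : ℕ} {s : Memory} (hs : Consts n s) (hi : s.var 11 = i) :
    Halts startProgram s (n * 9 + 2) fun s' => Frame [4, 8, 9] [2, 3] s s' ∧
      (∀ v < n, s'.arr 2 v = (startVector n i).1 v) ∧
      ∀ v < n, s'.arr 3 v = (startVector n i).2 v := by
  refine Halts.mono (Halts.fill (T := 1 + (1 + (1 + ((1 + 1) + (1 + 1))))) (V := [8, 9])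
    (A := [2, 3]) (fun c => if c = 2 then (startVector n i).1 else (startVector n i).2)
    hs (by simp) (by simp) ?_) le_rfl ?_
  · intro v hv s' hf hv'
    obtain ⟨c0, c1, c2⟩ := hs.frame hf (by simp)
    have hi' : s'.var 11 = i := by rw [hf.1 _ (by simp), hi]
    have hF : Frame [8, 9] [2, 3] s' s' := Frame.refl _ _ _
    -- The sum of the two truncated differences is |v - i|, which vanishes exactly at `v = i`.
    refine Halts.seq <| Halts.sub <| Halts.seq <| Halts.sub <| Halts.seq <| Halts.add <|
      Halts.seq <| Halts.cond (fun h => Halts.const <| Halts.seq <| Halts.store <| Halts.store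
      ⟨?_, ?_⟩) (fun h => Halts.add <| Halts.seq <| Halts.store <| Halts.store ⟨?_, ?_⟩)
    · refine Frame.setArr (Frame.setArr ?_ (by simp) _ _) (by simp) _ _
      iterate 4 refine Frame.setVar ?_ (by simp) _
      exact hF
    · simp [hi', hv'] at h
      have : v ≠ i := by rintro rfl; simp at h
      simp [startVector, hv', c1, this]
    · refine Frame.setArr (Frame.setArr ?_ (by simp) _ _) (by simp) _ _
      iterate 4 refine Frame.setVar ?_ (by simp) _
      exact hF
    · simp [hi', hv'] at h
      have : v = i := by omega
      simp [startVector, hv', c0, c1, c2, this]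
  · rintro s' ⟨h1, h2⟩
    exact ⟨h1, by simpa using h2 2 (by simp), by simpa using h2 3 (by simp)⟩

/-- The signs of the vector `z.1 - z.2`, as labels. -/
def signLabel (z : (ℕ → ℕ) × (ℕ → ℕ)) (v : ℕ) : ℕ := if z.2 v < z.1 v then 1 else 0

/-- Writes the signs of the vector in the arrays `2` and `3` into array `1`. -/
def labelProgram : Program :=
  forDown 4 <| .seq (.load 8 2 4) <| .seq (.load 9 3 4) <| .seq (.sub 8 8 9) <|
    .seq (.cond 8 (.const 9 1) (.const 9 0)) (.store 1 4 9)

theorem halts_labelProgram {n : ℕ} {s : Memory} (hs : Consts n s) :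
    Halts labelProgram s (n * 8 + 2) fun s' => Frame [4, 8, 9] [1] s s' ∧
      ∀ v < n, s'.arr 1 v = signLabel (s.arr 2, s.arr 3) v := by
  refine Halts.mono (Halts.fill (T := 1 + (1 + (1 + ((1 + 1) + 1)))) (V := [8, 9])
    (A := [1]) (fun _ => signLabel (s.arr 2, s.arr 3))
    hs (by simp) (by simp) ?_) le_rfl ?_
  · intro v hv s' hf hv'
    have h2 : s'.arr 2 = s.arr 2 := hf.2 _ (by simp)
    have h3 : s'.arr 3 = s.arr 3 := hf.2 _ (by simp)
    have hF : Frame [8, 9] [1] s' s' := Frame.refl _ _ _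
    refine Halts.seq <| Halts.load <| Halts.seq <| Halts.load <| Halts.seq <| Halts.sub <|
      Halts.seq <| Halts.cond (fun h => Halts.const <| Halts.store ⟨?_, ?_⟩)
      (fun h => Halts.const <| Halts.store ⟨?_, ?_⟩)
    · refine Frame.setArr ?_ (by simp) _ _
      iterate 4 refine Frame.setVar ?_ (by simp) _
      exact hF
    · simp [hv', h2, h3, Nat.sub_eq_zero_iff_le] at h
      simp [signLabel, hv', h]
    · refine Frame.setArr ?_ (by simp) _ _
      iterate 4 refine Frame.setVar ?_ (by simp) _
      exact hF
    · simp [hv', h2, h3, Nat.sub_eq_zero_iff_le] at h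
      simp [signLabel, hv', h.not_gt]
  · exact fun s' h => ⟨h.1, h.2 1 (by simp)⟩

/-- The result of the power iteration started at `i`. -/
def powerVector (n : ℕ) (e : ℕ → ℕ → ℕ) (i : ℕ) : (ℕ → ℕ) × (ℕ → ℕ) :=
  (powerStep n e)^[2 * n] (startVector n i)

/-- Computes `powerVector` in the arrays `2` and `3`; the start is the content of
variable `11`. -/
def powerProgram : Program :=
  .seq startProgram (forDown 12 (.seq (powerStepProgram 2 3 4 5) (powerStepProgram 4 5 2 3)))

/-- Two power steps per turn return the vector to the arrays `2` and `3`, so `n` turns give the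
exponent `2 * n`. The evenness and the size of this exponent are both used in `exists_column_close`.
-/
theorem halts_powerProgram {n i : ℕ} {A : ℕ → ℕ} {s : Memory} (hs : Ready n A s)
    (hi : s.var 11 = i) :
    Halts powerProgram s
      ((n * 9 + 2) + (n * (((n * (n * (n * 18 + 4) + 8) + 2) +
        (n * (n * (n * 18 + 4) + 8) + 2)) + 2) + 2)) fun s' =>
      Frame [3, 4, 5, 6, 7, 8, 9, 10, 12] [2, 3, 4, 5] s s' ∧
      (∀ v < n, s'.arr 2 v = (powerVector n (edge n A) i).1 v) ∧
      ∀ v < n, s'.arr 3 v = (powerVector n (edge n A) i).2 v := by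
  refine Halts.seq ((halts_startProgram hs.1 hi).mono le_rfl ?_)
  rintro s₁ ⟨hf₁, h2, h3⟩
  have hr₁ := hs.frame hf₁
  let w : ℕ → (ℕ → ℕ) × (ℕ → ℕ) := fun k => (powerStep n (edge n A))^[2 * k] (startVector n i)
  refine (Halts.repeat (i := 12) (V := [3, 4, 5, 6, 7, 8, 9, 10]) (A := [2, 3, 4, 5])
    (fun k s => (∀ v < n, s.arr 2 v = (w k).1 v) ∧ ∀ v < n, s.arr 3 v = (w k).2 v)
    hr₁.1 (by simp) (by simp) (fun k s c h => h) ⟨h2, h3⟩ ?_).mono le_rfl ?_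
  · rintro k - s₂ hf₂ ⟨h2', h3'⟩
    have hr₂ := hr₁.frame hf₂
    refine Halts.seq ((halts_powerStepProgram hr₂ (a' := 4) (b' := 5) (by simp) (by simp)
      (by simp) (by simp) (by simp)).mono le_rfl ?_)
    rintro s₃ ⟨hf₃, h4, h5⟩
    refine (halts_powerStepProgram (hr₂.frame hf₃) (a' := 2) (b' := 3) (by simp) (by simp)
      (by simp) (by simp) (by simp)).mono le_rfl ?_
    rintro s₄ ⟨hf₄, h2'', h3''⟩
    have e1 : powerStep n (edge n A) (s₂.arr 2, s₂.arr 3) = powerStep n (edge n A) (w k) :=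
      powerStep_congr h2' h3'
    have e2 : powerStep n (edge n A) (s₃.arr 4, s₃.arr 5) = w (k + 1) := by
      rw [e1] at h4 h5
      rw [powerStep_congr (z' := powerStep n (edge n A) (w k)) h4 h5,
        ← Function.iterate_succ_apply' (powerStep n (edge n A)),
        ← Function.iterate_succ_apply' (powerStep n (edge n A))]
      rfl
    rw [e2] at h2'' h3''
    have hf₃' : Frame [3, 4, 5, 6, 7, 8, 9, 10] [2, 3, 4, 5] s₂ s₃ :=
      (Frame.refl _ _ _).trans hf₃ (by simp) (by simp)
    exact ⟨hf₃'.trans hf₄ (by simp) (by simp), h2'', h3''⟩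
  · rintro s₂ ⟨hf₂, h⟩
    have hf₁' : Frame [3, 4, 5, 6, 7, 8, 9, 10, 12] [2, 3, 4, 5] s s₁ :=
      (Frame.refl _ _ _).trans hf₁ (by simp) (by simp)
    exact ⟨hf₁'.trans hf₂ (by simp) (by simp), h⟩

/-- If the diagonal entry of the vector in the arrays `2`, `3` at the start `x_11` exceeds the best
value `x_13 - x_14` found so far, update the best value and the labels in array `1`. -/
def compareProgram : Program :=
  .seq (.load 8 2 11) <| .seq (.load 9 3 11) <| .seq (.add 10 8 14) <| .seq (.add 15 9 13) <|
    .seq (.sub 10 10 15) <|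
    .cond 10 (.seq (.add 13 8 2) <| .seq (.add 14 9 2) labelProgram) (.const 10 0)

/-- `L` is the sign labelling obtained from a start with largest diagonal entry. -/
def IsBestLabel (n : ℕ) (e : ℕ → ℕ → ℕ) (L : ℕ → ℕ) : Prop :=
  (∀ i < n, (powerVector n e i).1 i ≤ (powerVector n e i).2 i) ∨
    ∃ j < n, (∀ i < n, (powerVector n e i).1 i + (powerVector n e j).2 j ≤
      (powerVector n e j).1 j + (powerVector n e i).2 i) ∧
      ∀ v < n, L v = signLabel (powerVector n e j) v

/-- The best value and labels among the starts `i` with `k ≤ i`. -/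
def BestFrom (n : ℕ) (e : ℕ → ℕ → ℕ) (k : ℕ) (s : Memory) : Prop :=
  (s.var 13 = 0 ∧ s.var 14 = 0 ∧
    ∀ i < n, k ≤ i → (powerVector n e i).1 i ≤ (powerVector n e i).2 i) ∨
  ∃ j < n, s.var 13 = (powerVector n e j).1 j ∧ s.var 14 = (powerVector n e j).2 j ∧
    (∀ i < n, k ≤ i → (powerVector n e i).1 i + (powerVector n e j).2 j ≤
      (powerVector n e j).1 j + (powerVector n e i).2 i) ∧
    (powerVector n e j).2 j < (powerVector n e j).1 j ∧
    ∀ v < n, s.arr 1 v = signLabel (powerVector n e j) v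

/-- Diagonal values are differences of naturals, so P - N > P' - N' is tested as P + N' > N + P'.
The record starts at 0 - 0, hence only a positive diagonal entry is ever recorded. -/
theorem halts_compareProgram {n k : ℕ} {e : ℕ → ℕ → ℕ} {s : Memory} (hs : Consts n s)
    (hkn : k < n) (hk : s.var 11 = k) (hB : BestFrom n e (k + 1) s)
    (h2 : ∀ v < n, s.arr 2 v = (powerVector n e k).1 v)
    (h3 : ∀ v < n, s.arr 3 v = (powerVector n e k).2 v) :
    Halts compareProgram s (n * 8 + 10) fun s' =>
      Frame [4, 8, 9, 10, 13, 14, 15] [1] s s' ∧ BestFrom n e k s' := by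
  obtain ⟨c0, c1, c2⟩ := hs
  have hF : Frame [4, 8, 9, 10, 13, 14, 15] [1] s s := Frame.refl _ _ _
  refine Halts.mono (T := 1 + (1 + (1 + (1 + (1 + ((1 + (1 + (n * 8 + 2))) + 1)))))) ?_
    (by omega) fun _ h => h
  refine Halts.seq <| Halts.load <| Halts.seq <| Halts.load <| Halts.seq <| Halts.add <|
      Halts.seq <| Halts.add <| Halts.seq <| Halts.sub <| Halts.cond
      (fun h => Halts.seq <| Halts.add <| Halts.seq <| Halts.add ?_)
      (fun h => (Halts.const ⟨?_, ?_⟩).mono (by omega) fun _ h => h)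
  · simp [hk, h2 k hkn, h3 k hkn, Nat.sub_eq_zero_iff_le] at h
    refine (halts_labelProgram ⟨by simpa using c0, by simpa using c1, by simpa using c2⟩).mono
      le_rfl ?_
    rintro s' ⟨hf, hL⟩
    refine ⟨Frame.trans ?_ hf (by simp) (by simp), Or.inr ⟨k, hkn, ?_, ?_, ?_, ?_, ?_⟩⟩
    · iterate 7 refine Frame.setVar ?_ (by simp) _
      exact hF
    · rw [hf.1 _ (by simp)]; simp [hk, c2, h2 k hkn]
    · rw [hf.1 _ (by simp)]; simp [hk, c2, h3 k hkn]
    · intro i hi hki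
      rcases Nat.eq_or_lt_of_le hki with rfl | hki
      · exact le_of_eq (add_comm _ _ |>.trans (add_comm _ _ |>.trans (by rfl)))
      · rcases hB with ⟨b1, b2, b3⟩ | ⟨j, hj, b1, b2, b3, -, -⟩
        · have := b3 i hi hki
          rw [b1, b2] at h
          omega
        · have := b3 i hi hki
          rw [b1, b2] at h
          omega
    · rcases hB with ⟨b1, b2, b3⟩ | ⟨j, hj, b1, b2, b3, b4, -⟩
      · rw [b1, b2] at h
        omega
      · rw [b1, b2] at h
        omega
    · intro v hv
      rw [hL v hv]
      simp [signLabel, h2 v hv, h3 v hv]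
  · iterate 6 refine Frame.setVar ?_ (by simp) _
    exact hF
  · simp [hk, h2 k hkn, h3 k hkn, Nat.sub_eq_zero_iff_le] at h
    rcases hB with ⟨b1, b2, b3⟩ | ⟨j, hj, b1, b2, b3, b4, b5⟩
    · refine Or.inl ⟨by simpa using b1, by simpa using b2, fun i hi hki => ?_⟩
      rcases Nat.eq_or_lt_of_le hki with rfl | hki
      · omega
      · exact b3 i hi hki
    · refine Or.inr ⟨j, hj, by simpa using b1, by simpa using b2, fun i hi hki => ?_, b4,
        by simpa using b5⟩
      rcases Nat.eq_or_lt_of_le hki with rfl | hki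
      · omega
      · exact b3 i hi hki

/-- Writes the multiples of `n` into array `6`. -/
def multiplesProgram : Program :=
  forDown 3 <| .seq (.const 6 0) <| .seq (forDown 4 (.add 6 6 3)) (.store 6 3 6)

/-- The machine cannot multiply: `n * u` is obtained by adding `u` repeatedly, and the table makes
every access to the adjacency matrix a constant number of steps. -/
theorem halts_multiplesProgram {n : ℕ} {s : Memory} (hs : Consts n s) :
    Halts multiplesProgram s (n * (n * 3 + 6) + 2) fun s' => Frame [3, 4, 6] [6] s s' ∧
      ∀ u < n, s'.arr 6 u = n * u := by
  refine Halts.mono (Halts.fill (T := 1 + ((n * (1 + 2) + 2) + 1)) (V := [4, 6])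
    (A := [6]) (fun _ u => n * u) hs (by simp) (by simp) ?_) (by apply le_of_eq; ring)
    fun s' h => ⟨h.1, h.2 6 (by simp)⟩
  intro u hu s₁ hf hu₁
  refine Halts.seq (Halts.const (Halts.seq ?_))
  have hc : Consts n (s₁.setVar 6 0) := hs.frame (hf.setVar (i := 6) (by simp) 0) (by simp)
  refine (Halts.accumulate (n := n) (i := 4) (V := [6]) (fun _ => u) (fun _ => 0) hc (by simp)
    (by simp) (by simp) (by simp) ?_).mono le_rfl ?_
  · intro k hk s₂ hf₂ hk₂
    refine Halts.add ⟨(Frame.refl _ _ _).setVar (by simp) _, ?_, ?_⟩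
    · rw [hf₂.1 3 (by simp)]; simp [hu₁]
    · simp
  · rintro s₂ ⟨hf₂, h6, -⟩
    have h3 : s₂.var 3 = u := by rw [hf₂.1 3 (by simp)]; simp [hu₁]
    refine Halts.store ⟨?_, ?_⟩
    · refine Frame.setArr (Frame.trans ((Frame.refl _ _ _).setVar (i := 6) (by simp) _) hf₂
        (by simp) (by simp)) (by simp) _ _
    · simp [h3, h6, hf₂.2 6 (by simp)]

/-- Spectral clustering followed by rounds of voting. -/
def recoveryProgram (r : Bool) : Program :=
  .seq (.const 1 1) <| .seq multiplesProgram <| .seq (forDown 11 (.seq powerProgram compareProgram))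
    (forDown 12 (.seq (voteProgram r 1 7) (voteProgram r 7 1)))

/-- A bound for the running time of `recoveryProgram`. -/
noncomputable def recoveryTime : Polynomial ℕ :=
  let n : Polynomial ℕ := Polynomial.X
  1 + (((n * (n * 3 + 6)) + 2) +
    ((n * ((((n * 9 + 2) + (n * (((n * (n * (n * 18 + 4) + 8) + 2) +
        (n * (n * (n * 18 + 4) + 8) + 2)) + 2) + 2)) + (n * 8 + 10)) + 2) + 2) +
    (n * (((n * (n * 9 + 10) + 2) + (n * (n * 9 + 10) + 2)) + 2) + 2)))

theorem halts_recoveryProgram (r : Bool) {n : ℕ} {A : ℕ → ℕ} {s : Memory} (h0 : s.var 0 = n)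
    (h2 : s.var 2 = 0) (h13 : s.var 13 = 0) (h14 : s.var 14 = 0) (hA : s.arr 0 = A) :
    Halts (recoveryProgram r) s (recoveryTime.eval n) fun s' => ∃ L : ℕ → ℕ,
      IsBestLabel n (edge n A) L ∧
      ∀ v < n, s'.arr 1 v = (vote n (edge n A) r)^[2 * n] L v := by
  have hT : recoveryTime.eval n = 1 + (((n * (n * 3 + 6)) + 2) +
    ((n * ((((n * 9 + 2) + (n * (((n * (n * (n * 18 + 4) + 8) + 2) +
        (n * (n * (n * 18 + 4) + 8) + 2)) + 2) + 2)) + (n * 8 + 10)) + 2) + 2) +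
    (n * (((n * (n * 9 + 10) + 2) + (n * (n * 9 + 10) + 2)) + 2) + 2))) := by
    simp [recoveryTime]
  rw [hT]
  refine Halts.seq (Halts.const <| Halts.seq ?_)
  have hc : Consts n (s.setVar 1 1) := ⟨by simpa using h0, by simp, by simpa using h2⟩
  refine (halts_multiplesProgram hc).mono le_rfl ?_
  rintro s₁ ⟨hf₁, h6⟩
  have hr₁ : Ready n A s₁ :=
    ⟨hc.frame hf₁ (by simp), by rw [hf₁.2 _ (by simp)]; exact hA, h6⟩
  refine Halts.seq ?_
  let V := [11, 3, 4, 5, 6, 7, 8, 9, 10, 12, 13, 14, 15]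
  have hV : ∀ i ∈ V, 3 ≤ i := by simp [V]
  refine (Halts.forDown (n := n) (i := 11)
    (T := ((n * 9 + 2) + (n * (((n * (n * (n * 18 + 4) + 8) + 2) +
        (n * (n * (n * 18 + 4) + 8) + 2)) + 2) + 2)) + (n * 8 + 10))
    (fun k s' => Frame V [1, 2, 3, 4, 5] s₁ s' ∧ BestFrom n (edge n A) k s') hr₁.1.1 hr₁.1.2.2
    (fun k s' h => (hr₁.frame h.1 hV).1.2.1) ⟨(Frame.refl _ _ _).setVar (by simp [V]) _, ?_⟩
    ?_).mono le_rfl ?_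
  · refine Or.inl ⟨?_, ?_, fun i hi hi' => by omega⟩
    · simp [hf₁.1 13, h13]
    · simp [hf₁.1 14, h14]
  · rintro k hk s₂ ⟨hf₂, hB⟩ -
    have hf₃ : Frame V [1, 2, 3, 4, 5] s₁ (s₂.setVar 11 k) := hf₂.setVar (by simp [V]) _
    refine Halts.seq ((halts_powerProgram (hr₁.frame hf₃ hV) (i := k) (by simp)).mono le_rfl ?_)
    rintro s₄ ⟨hf₄, h42, h43⟩
    have hf₅ : Frame V [1, 2, 3, 4, 5] s₁ s₄ := hf₃.trans hf₄ (by simp [V]) (by simp)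
    have hB' : BestFrom n (edge n A) (k + 1) s₄ := by
      have e13 : s₄.var 13 = s₂.var 13 := by rw [hf₄.1 _ (by simp)]; simp
      have e14 : s₄.var 14 = s₂.var 14 := by rw [hf₄.1 _ (by simp)]; simp
      have e1 : s₄.arr 1 = s₂.arr 1 := by rw [hf₄.2 _ (by simp)]; simp
      unfold BestFrom
      rw [e13, e14, e1]
      exact hB
    refine (halts_compareProgram (hr₁.frame hf₅ hV).1 hk (by rw [hf₄.1 _ (by simp)]; simp) hB'
      h42 h43).mono le_rfl ?_
    rintro s₆ ⟨hf₆, hB₆⟩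
    refine ⟨?_, hf₅.trans hf₆ (by simp [V]) (by simp), hB₆⟩
    rw [hf₆.1 11 (by simp), hf₄.1 11 (by simp)]; simp
  · rintro s₂ ⟨hf₂, hB⟩
    have hr₂ := hr₁.frame hf₂ hV
    have hL : IsBestLabel n (edge n A) (s₂.arr 1) := by
      rcases hB with ⟨-, -, b3⟩ | ⟨j, hj, -, -, b3, -, b5⟩
      · exact Or.inl fun i hi => b3 i hi (Nat.zero_le _)
      · exact Or.inr ⟨j, hj, fun i hi => b3 i hi (Nat.zero_le _), b5⟩
    refine (Halts.repeat (i := 12) (V := [3, 4, 6, 7, 8, 9, 10]) (A := [1, 7])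
      (fun k s => ∀ v < n, s.arr 1 v = (vote n (edge n A) r)^[2 * k] (s₂.arr 1) v)
      hr₂.1 (by simp) (by simp) (fun k s c h => h) (fun v _ => rfl) ?_).mono le_rfl
      fun s' h => ⟨_, hL, h.2⟩
    intro k _ s₃ hf₃ h₃
    have hr₃ := hr₂.frame hf₃
    refine Halts.seq ((halts_voteProgram hr₃ r (a := 1) (a' := 7) (by simp) (by simp)
      (by simp)).mono le_rfl ?_)
    rintro s₄ ⟨hf₄, h₄⟩
    refine (halts_voteProgram (hr₃.frame hf₄) r (a := 7) (a' := 1) (by simp) (by simp)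
      (by simp)).mono le_rfl ?_
    rintro s₅ ⟨hf₅, h₅⟩
    have hf₄' : Frame [3, 4, 6, 7, 8, 9, 10] [1, 7] s₃ s₄ :=
      (Frame.refl _ _ _).trans hf₄ (by simp) (by simp)
    refine ⟨hf₄'.trans hf₅ (by simp) (by simp), fun v hv => ?_⟩
    rw [h₅ v hv, vote_congr h₄, vote_congr h₃,
      ← Function.iterate_succ_apply' (vote n (edge n A) r),
      ← Function.iterate_succ_apply' (vote n (edge n A) r)]
    rfl

/-! ### From discrepancy to spectral norm -/

/-- The `k`-th binary digit. -/
def bit (x k : ℕ) : ℕ := x / 2 ^ k % 2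

theorem sum_bit (x K : ℕ) : ∑ k ∈ Finset.range K, 2 ^ k * bit x k = x % 2 ^ K := by
  induction K with
  | zero => simp [Nat.mod_one]
  | succ K ih => rw [Finset.sum_range_succ, ih, Nat.mod_pow_succ, bit]

theorem bit_eq (x k : ℕ) : (bit x k : ℝ) = if bit x k = 1 then 1 else 0 := by
  rcases Nat.mod_two_eq_zero_or_one (x / 2 ^ k) with h | h <;> simp [bit, h]

/-- The terms of the binary expansion are nonnegative, so their squares add up to at most the square
of their sum. Summed over vertices, this bounds the dyadic level sets by the Euclidean norm. -/
theorem sum_sq_bit_le (x K : ℕ) :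
    ∑ k ∈ Finset.range K, (4 : ℝ) ^ k * bit x k ≤ (x : ℝ) ^ 2 := by
  have h1 : ∑ k ∈ Finset.range K, ((2 : ℝ) ^ k * bit x k) ^ 2 ≤
      (∑ k ∈ Finset.range K, (2 : ℝ) ^ k * bit x k) ^ 2 :=
    Finset.sum_sq_le_sq_sum_of_nonneg fun i _ => by positivity
  have h2 : (∑ k ∈ Finset.range K, (2 : ℝ) ^ k * bit x k) ≤ x := by
    exact_mod_cast (sum_bit x K).le.trans (Nat.mod_le _ _)
  refine le_trans (le_of_eq (Finset.sum_congr rfl fun k _ => ?_)) (h1.trans ?_)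
  · rw [mul_pow, ← pow_mul, mul_comm k 2, pow_mul, bit_eq]
    norm_num
  · exact pow_le_pow_left₀ (Finset.sum_nonneg fun _ _ => by positivity) h2 2

theorem sum_pow_far_le (K k g : ℕ) :
    ∑ l ∈ Finset.range K, (if l + g < k then (2 : ℝ) ^ l else 0) ≤ 2 ^ k * (1 / 2) ^ g := by
  by_cases hk : g ≤ k
  · rw [← Finset.sum_filter]
    have hsub : (Finset.range K).filter (fun l => l + g < k) ⊆ Finset.range (k - g) := by
      intro l hl
      simp only [Finset.mem_filter, Finset.mem_range] at hl ⊢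
      omega
    refine (Finset.sum_le_sum_of_subset_of_nonneg hsub fun _ _ _ => by positivity).trans ?_
    have h := geom_sum_eq (x := (2 : ℝ)) (by norm_num) (k - g)
    rw [h]
    have h3 : (2 : ℝ) ^ k = 2 ^ (k - g) * 2 ^ g := by rw [← pow_add]; congr 1; omega
    rw [h3, mul_assoc, ← mul_pow]
    norm_num
  · rw [Finset.sum_eq_zero]
    · positivity
    · intro l _
      rw [if_neg (by omega)]

section Discrepancy

variable {ι : Type*} [Fintype ι]

theorem card_near_le (K k g : ℕ) :
    ∑ l ∈ Finset.range K, (if l ≤ k + g ∧ k ≤ l + g then (1 : ℝ) else 0) ≤ 2 * g + 1 := by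
  rw [← Finset.sum_filter, Finset.sum_const, nsmul_eq_mul, mul_one]
  have hsub : (Finset.range K).filter (fun l => l ≤ k + g ∧ k ≤ l + g) ⊆
      Finset.Ico (k - g) (k - g + (2 * g + 1)) := by
    intro l hl
    simp only [Finset.mem_filter, Finset.mem_Ico, Finset.mem_range] at hl ⊢
    omega
  have := Finset.card_le_card hsub
  rw [Nat.card_Ico, Nat.add_sub_cancel_left] at this
  exact_mod_cast this

/-- The bilinear form of `W` on a pair of sets, in terms of the sizes of the sets. -/
theorem abs_sum_sum_le_row {W : ι → ι → ℝ} {Δ : ℝ} (hrow : ∀ u, ∑ v, |W u v| ≤ Δ)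
    (S T : Finset ι) : |∑ u ∈ S, ∑ v ∈ T, W u v| ≤ Δ * S.card := by
  calc |∑ u ∈ S, ∑ v ∈ T, W u v| ≤ ∑ u ∈ S, ∑ v ∈ T, |W u v| :=
        (Finset.abs_sum_le_sum_abs _ _).trans
          (Finset.sum_le_sum fun u _ => Finset.abs_sum_le_sum_abs _ _)
    _ ≤ ∑ u ∈ S, Δ := Finset.sum_le_sum fun u _ =>
        (Finset.sum_le_univ_sum_of_nonneg fun _ => abs_nonneg _).trans (hrow u)
    _ = Δ * S.card := by rw [Finset.sum_const, nsmul_eq_mul, mul_comm]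

/-- Binary digits write the form as a sum over pairs of level sets `S k`, `T l` with weights 2^k ·
2^l. For |k - l| ≤ g the discrepancy applies and each level meets at most 2g + 1 others. For levels
further apart the row sum bound is enough, since the weights of the distant smaller levels sum to at
most 2^(-g) times the larger weight. -/
theorem abs_form_nat_le {W : ι → ι → ℝ} {α Δ : ℝ} (hα : 0 ≤ α)
    (hdisc : ∀ S T : Finset ι, |∑ u ∈ S, ∑ v ∈ T, W u v| ≤ α * √(S.card * T.card))
    (hsymm : ∀ u v, W u v = W v u) (hrow : ∀ u, ∑ v, |W u v| ≤ Δ) (g : ℕ) (x y : ι → ℕ) :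
    |∑ u, ∑ v, W u v * x u * y v| ≤
      (α * (2 * g + 1) / 2 + Δ * (1 / 2) ^ g) * (∑ u, (x u : ℝ) ^ 2 + ∑ u, (y u : ℝ) ^ 2) := by
  classical
  rcases isEmpty_or_nonempty ι with hι | ⟨⟨u0⟩⟩
  · simp
  have hΔ : 0 ≤ Δ := (Finset.sum_nonneg fun _ _ => abs_nonneg _).trans (hrow u0)
  obtain ⟨K, hK⟩ : ∃ K, ∀ u, x u < 2 ^ K ∧ y u < 2 ^ K := by
    refine ⟨∑ u, (x u + y u), fun u => ?_⟩
    have h1 : x u + y u ≤ ∑ u, (x u + y u) :=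
      Finset.single_le_sum (f := fun u => x u + y u) (fun _ _ => Nat.zero_le _) (Finset.mem_univ u)
    have h2 := Nat.lt_two_pow_self (n := ∑ u, (x u + y u))
    omega
  let S : ℕ → Finset ι := fun k => Finset.univ.filter fun u => bit (x u) k = 1
  let T : ℕ → Finset ι := fun k => Finset.univ.filter fun u => bit (y u) k = 1
  have hx : ∀ u, (x u : ℝ) = ∑ k ∈ Finset.range K, 2 ^ k * if bit (x u) k = 1 then 1 else 0 := by
    intro u
    have := sum_bit (x u) K
    rw [Nat.mod_eq_of_lt (hK u).1] at this
    conv_lhs => rw [← this]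
    push_cast
    exact Finset.sum_congr rfl fun k _ => by rw [bit_eq]
  have hy : ∀ u, (y u : ℝ) = ∑ k ∈ Finset.range K, 2 ^ k * if bit (y u) k = 1 then 1 else 0 := by
    intro u
    have := sum_bit (y u) K
    rw [Nat.mod_eq_of_lt (hK u).2] at this
    conv_lhs => rw [← this]
    push_cast
    exact Finset.sum_congr rfl fun k _ => by rw [bit_eq]
  have hnorm : ∀ z : ι → ℕ, ∑ k ∈ Finset.range K, (4 : ℝ) ^ k *
      ((Finset.univ.filter fun u => bit (z u) k = 1).card : ℝ) ≤ ∑ u, (z u : ℝ) ^ 2 := by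
    intro z
    calc _ = ∑ k ∈ Finset.range K, ∑ u, (4 : ℝ) ^ k * bit (z u) k := by
          refine Finset.sum_congr rfl fun k _ => ?_
          rw [← Finset.mul_sum, Finset.card_filter]
          push_cast
          congr 1
          exact Finset.sum_congr rfl fun u _ => (bit_eq _ _).symm
      _ = ∑ u, ∑ k ∈ Finset.range K, (4 : ℝ) ^ k * bit (z u) k := Finset.sum_comm
      _ ≤ _ := Finset.sum_le_sum fun u _ => sum_sq_bit_le _ _
  have hform : ∑ u, ∑ v, W u v * x u * y v = ∑ k ∈ Finset.range K, ∑ l ∈ Finset.range K,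
      2 ^ k * 2 ^ l * ∑ u ∈ S k, ∑ v ∈ T l, W u v := by
    simp only [S, T, Finset.sum_filter]
    calc _ = ∑ u, ∑ v, ∑ k ∈ Finset.range K, ∑ l ∈ Finset.range K,
          W u v * (2 ^ k * if bit (x u) k = 1 then 1 else 0) *
            (2 ^ l * if bit (y v) l = 1 then 1 else 0) := by
          refine Finset.sum_congr rfl fun u _ => Finset.sum_congr rfl fun v _ => ?_
          rw [hx u, hy v, mul_assoc, Finset.sum_mul_sum, Finset.mul_sum]
          refine Finset.sum_congr rfl fun k _ => ?_
          rw [Finset.mul_sum]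
          exact Finset.sum_congr rfl fun l _ => by ring
      _ = ∑ k ∈ Finset.range K, ∑ u, ∑ v, ∑ l ∈ Finset.range K,
          W u v * (2 ^ k * if bit (x u) k = 1 then 1 else 0) *
            (2 ^ l * if bit (y v) l = 1 then 1 else 0) := by
          rw [Finset.sum_comm]
          rw [Finset.sum_congr rfl fun u _ => Finset.sum_comm, Finset.sum_comm]
          refine Finset.sum_congr rfl fun v _ => ?_
          rw [Finset.sum_comm]
      _ = _ := by
          refine Finset.sum_congr rfl fun k _ => ?_
          rw [Finset.sum_congr rfl fun u _ => Finset.sum_comm, Finset.sum_comm]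
          refine Finset.sum_congr rfl fun l _ => ?_
          rw [Finset.mul_sum]
          refine Finset.sum_congr rfl fun u _ => ?_
          split_ifs with h
          · rw [Finset.mul_sum]
            refine Finset.sum_congr rfl fun v _ => ?_
            split_ifs <;> ring
          · simp
  set X := ∑ u, (x u : ℝ) ^ 2
  set Y := ∑ u, (y u : ℝ) ^ 2
  let P : ℕ → ℝ := fun k => 4 ^ k * ((S k).card : ℝ)
  let Q : ℕ → ℝ := fun k => 4 ^ k * ((T k).card : ℝ)
  have hP : ∑ k ∈ Finset.range K, P k ≤ X := hnorm x
  have hQ : ∑ k ∈ Finset.range K, Q k ≤ Y := hnorm y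
  have hP0 : ∀ k, 0 ≤ P k := fun k => by positivity
  have hQ0 : ∀ k, 0 ≤ Q k := fun k => by positivity
  have hfour : ∀ k, (4 : ℝ) ^ k = 2 ^ k * 2 ^ k := fun k => by rw [← mul_pow]; norm_num
  have hterm : ∀ k l, |2 ^ k * 2 ^ l * ∑ u ∈ S k, ∑ v ∈ T l, W u v| ≤
      (α / 2) * ((if l ≤ k + g ∧ k ≤ l + g then 1 else 0) * (P k)) +
      (α / 2) * ((if k ≤ l + g ∧ l ≤ k + g then 1 else 0) * (Q l)) +
      Δ * ((if l + g < k then 2 ^ l else 0) * (2 ^ k * (S k).card)) +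
      Δ * ((if k + g < l then 2 ^ k else 0) * (2 ^ l * (T l).card)) := by
    intro k l
    have habs : |(2 : ℝ) ^ k * 2 ^ l * ∑ u ∈ S k, ∑ v ∈ T l, W u v| =
        2 ^ k * 2 ^ l * |∑ u ∈ S k, ∑ v ∈ T l, W u v| := by
      rw [abs_mul, abs_of_nonneg (by positivity)]
    rw [habs]
    have r1 := abs_sum_sum_le_row hrow (S k) (T l)
    have r2 : |∑ u ∈ S k, ∑ v ∈ T l, W u v| ≤ Δ * (T l).card := by
      rw [Finset.sum_comm]
      simp_rw [hsymm _]
      have := abs_sum_sum_le_row hrow (T l) (S k)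
      convert this using 6
    rcases lt_trichotomy (l + g) k with h | h | h
    · have e1 : ¬ (l ≤ k + g ∧ k ≤ l + g) := by omega
      have e2 : ¬ (k ≤ l + g ∧ l ≤ k + g) := by omega
      have e3 : ¬ (k + g < l) := by omega
      simp only [e1, e2, e3, h, if_true, if_false]
      have := mul_le_mul_of_nonneg_left r1 (show (0 : ℝ) ≤ 2 ^ k * 2 ^ l by positivity)
      linarith
    all_goals
      by_cases h' : k + g < l
      · have e1 : ¬ (l ≤ k + g ∧ k ≤ l + g) := by omega
        have e2 : ¬ (k ≤ l + g ∧ l ≤ k + g) := by omega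
        have e3 : ¬ (l + g < k) := by omega
        simp only [e1, e2, e3, h', if_true, if_false]
        have := mul_le_mul_of_nonneg_left r2 (show (0 : ℝ) ≤ 2 ^ k * 2 ^ l by positivity)
        linarith
      · have e1 : (l ≤ k + g ∧ k ≤ l + g) := by omega
        have e2 : (k ≤ l + g ∧ l ≤ k + g) := by omega
        have e3 : ¬ (l + g < k) := by omega
        simp only [e1, e3, h', if_false]
        have hd := mul_le_mul_of_nonneg_left (hdisc (S k) (T l))
          (show (0 : ℝ) ≤ 2 ^ k * 2 ^ l by positivity)
        have hsq : √((S k).card * (T l).card) = √(S k).card * √(T l).card :=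
          Real.sqrt_mul (by positivity) _
        rw [hsq] at hd
        have s1 := Real.mul_self_sqrt (show (0 : ℝ) ≤ (S k).card by positivity)
        have s2 := Real.mul_self_sqrt (show (0 : ℝ) ≤ (T l).card by positivity)
        have hPk : P k = (2 ^ k * √(S k).card) ^ 2 := by
          simp only [P]; rw [hfour, mul_pow, sq (√_), s1]; ring
        have hQl : Q l = (2 ^ l * √(T l).card) ^ 2 := by
          simp only [Q]; rw [hfour, mul_pow, sq (√_), s2]; ring
        rw [hPk, hQl]
        -- The geometric mean √(P k · Q l) coming from the discrepancy is at most the arithmetic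
        -- mean.
        have := mul_nonneg hα (sq_nonneg (2 ^ k * √(S k).card - 2 ^ l * √(T l).card))
        simp only [if_true, and_self]
        linarith
  have hnear : ∀ R : ℕ → ℝ, (∀ k, 0 ≤ R k) → ∑ k ∈ Finset.range K, ∑ l ∈ Finset.range K,
      (if l ≤ k + g ∧ k ≤ l + g then 1 else 0) * R k ≤
        (2 * g + 1) * ∑ k ∈ Finset.range K, R k := by
    intro R hR
    rw [Finset.mul_sum]
    refine Finset.sum_le_sum fun k _ => ?_
    rw [← Finset.sum_mul]
    exact mul_le_mul_of_nonneg_right (card_near_le K k g) (hR k)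
  have hfar : ∀ R : ℕ → ℝ, (∀ k, 0 ≤ R k) → ∑ k ∈ Finset.range K, ∑ l ∈ Finset.range K,
      (if l + g < k then 2 ^ l else 0) * (2 ^ k * R k) ≤
        (1 / 2) ^ g * ∑ k ∈ Finset.range K, 4 ^ k * R k := by
    intro R hR
    rw [Finset.mul_sum]
    refine Finset.sum_le_sum fun k _ => ?_
    rw [← Finset.sum_mul]
    refine (mul_le_mul_of_nonneg_right (sum_pow_far_le K k g)
      (mul_nonneg (by positivity) (hR k))).trans (le_of_eq ?_)
    rw [hfour]; ring
  rw [hform]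
  refine (Finset.abs_sum_le_sum_abs _ _).trans ((Finset.sum_le_sum fun k _ =>
    Finset.abs_sum_le_sum_abs _ _).trans ((Finset.sum_le_sum fun k _ =>
    Finset.sum_le_sum fun l _ => hterm k l).trans ?_))
  simp only [Finset.sum_add_distrib, ← Finset.mul_sum]
  have n1 := hnear P hP0
  have n2 := hnear Q hQ0
  rw [Finset.sum_comm] at n2
  have f1 := hfar (fun k => (S k).card) fun _ => by positivity
  have f2 := hfar (fun k => (T k).card) fun _ => by positivity
  rw [Finset.sum_comm] at f2
  have hg : (0 : ℝ) ≤ 2 * g + 1 := by positivity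
  have n1' := mul_le_mul_of_nonneg_left (n1.trans (mul_le_mul_of_nonneg_left hP hg))
    (show 0 ≤ α / 2 by positivity)
  have n2' := mul_le_mul_of_nonneg_left (n2.trans (mul_le_mul_of_nonneg_left hQ hg))
    (show 0 ≤ α / 2 by positivity)
  have f1' := mul_le_mul_of_nonneg_left (f1.trans (mul_le_mul_of_nonneg_left hP
    (show (0 : ℝ) ≤ (1 / 2) ^ g by positivity))) hΔ
  have f2' := mul_le_mul_of_nonneg_left (f2.trans (mul_le_mul_of_nonneg_left hQ
    (show (0 : ℝ) ≤ (1 / 2) ^ g by positivity))) hΔ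
  refine (add_le_add (add_le_add (add_le_add n1' n2') f1') f2').trans (le_of_eq ?_)
  ring

/-- Both sides are continuous and homogeneous of degree two: apply the integer case to the integer
parts of `N x` and `N y`, divide by `N ^ 2` and let `N` tend to infinity. -/
theorem abs_form_nonneg_le {W : ι → ι → ℝ} {α Δ : ℝ} (hα : 0 ≤ α)
    (hdisc : ∀ S T : Finset ι, |∑ u ∈ S, ∑ v ∈ T, W u v| ≤ α * √(S.card * T.card))
    (hsymm : ∀ u v, W u v = W v u) (hrow : ∀ u, ∑ v, |W u v| ≤ Δ) (g : ℕ) {x y : ι → ℝ}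
    (hx : ∀ u, 0 ≤ x u) (hy : ∀ u, 0 ≤ y u) :
    |∑ u, ∑ v, W u v * x u * y v| ≤
      (α * (2 * g + 1) / 2 + Δ * (1 / 2) ^ g) * (∑ u, x u ^ 2 + ∑ u, y u ^ 2) := by
  have hlim : ∀ z : ι → ℝ, (∀ u, 0 ≤ z u) → ∀ u,
      Tendsto (fun N : ℝ => (⌊z u * N⌋₊ : ℝ) / N) atTop (𝓝 (z u)) :=
    fun z hz u => tendsto_nat_floor_mul_div_atTop (hz u)
  have h1 : Tendsto (fun N : ℝ => |∑ u, ∑ v, W u v * ((⌊x u * N⌋₊ : ℝ) / N) *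
      ((⌊y v * N⌋₊ : ℝ) / N)|) atTop (𝓝 |∑ u, ∑ v, W u v * x u * y v|) :=
    (tendsto_finsetSum _ fun u _ => tendsto_finsetSum _ fun v _ =>
      ((hlim x hx u).const_mul _).mul (hlim y hy v)).abs
  have h2 : Tendsto (fun N : ℝ => (α * (2 * g + 1) / 2 + Δ * (1 / 2) ^ g) *
      (∑ u, ((⌊x u * N⌋₊ : ℝ) / N) ^ 2 + ∑ u, ((⌊y u * N⌋₊ : ℝ) / N) ^ 2)) atTop
      (𝓝 ((α * (2 * g + 1) / 2 + Δ * (1 / 2) ^ g) * (∑ u, x u ^ 2 + ∑ u, y u ^ 2))) :=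
    ((tendsto_finsetSum _ fun u _ => (hlim x hx u).pow 2).add
      (tendsto_finsetSum _ fun u _ => (hlim y hy u).pow 2)).const_mul _
  refine le_of_tendsto_of_tendsto h1 h2 ?_
  filter_upwards [eventually_gt_atTop 0] with N hN
  have h := abs_form_nat_le hα hdisc hsymm hrow g (fun u => ⌊x u * N⌋₊) (fun u => ⌊y u * N⌋₊)
  have e1 : ∑ u, ∑ v, W u v * ((⌊x u * N⌋₊ : ℝ) / N) * ((⌊y v * N⌋₊ : ℝ) / N) =
      (∑ u, ∑ v, W u v * ⌊x u * N⌋₊ * ⌊y v * N⌋₊) / N ^ 2 := by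
    simp_rw [Finset.sum_div]
    refine Finset.sum_congr rfl fun u _ => Finset.sum_congr rfl fun v _ => ?_
    field_simp
  have e2 : ∀ z : ι → ℝ, ∑ u, ((⌊z u * N⌋₊ : ℝ) / N) ^ 2 = (∑ u, (⌊z u * N⌋₊ : ℝ) ^ 2) / N ^ 2 := by
    intro z
    rw [Finset.sum_div]
    exact Finset.sum_congr rfl fun u _ => by rw [div_pow]
  rw [e1, e2 x, e2 y, abs_div, abs_of_nonneg (by positivity : (0 : ℝ) ≤ N ^ 2), ← add_div,
    ← mul_div_assoc]
  gcongr

/-- A symmetric matrix with small discrepancy and bounded row sums has small bilinear form. -/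
theorem abs_form_le {W : ι → ι → ℝ} {α Δ : ℝ} (hα : 0 ≤ α)
    (hdisc : ∀ S T : Finset ι, |∑ u ∈ S, ∑ v ∈ T, W u v| ≤ α * √(S.card * T.card))
    (hsymm : ∀ u v, W u v = W v u) (hrow : ∀ u, ∑ v, |W u v| ≤ Δ) (g : ℕ) (x y : ι → ℝ) :
    |∑ u, ∑ v, W u v * x u * y v| ≤
      (α * (2 * g + 1) + 2 * Δ * (1 / 2) ^ g) * (∑ u, x u ^ 2 + ∑ u, y u ^ 2) := by
  have key := fun (x y : ι → ℝ) (hx : ∀ u, 0 ≤ x u) (hy : ∀ u, 0 ≤ y u) =>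
    abs_form_nonneg_le hα hdisc hsymm hrow g hx hy
  have hp : ∀ x : ι → ℝ, ∀ u, 0 ≤ (x u)⁺ := fun x u => posPart_nonneg _
  have hn : ∀ x : ι → ℝ, ∀ u, 0 ≤ (x u)⁻ := fun x u => negPart_nonneg _
  have hsq : ∀ x : ι → ℝ, ∑ u, x u ^ 2 = ∑ u, ((x u)⁺) ^ 2 + ∑ u, ((x u)⁻) ^ 2 := by
    intro x
    rw [← Finset.sum_add_distrib]
    refine Finset.sum_congr rfl fun u _ => ?_
    rcases le_total 0 (x u) with h | h
    · rw [posPart_eq_self.2 h, negPart_eq_zero.2 h]; ring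
    · rw [posPart_eq_zero.2 h, negPart_eq_neg.2 h]; ring
  have hsplit : ∑ u, ∑ v, W u v * x u * y v =
      (∑ u, ∑ v, W u v * (x u)⁺ * (y v)⁺) - (∑ u, ∑ v, W u v * (x u)⁺ * (y v)⁻) -
      (∑ u, ∑ v, W u v * (x u)⁻ * (y v)⁺) + ∑ u, ∑ v, W u v * (x u)⁻ * (y v)⁻ := by
    simp only [← Finset.sum_add_distrib, ← Finset.sum_sub_distrib]
    refine Finset.sum_congr rfl fun u _ => Finset.sum_congr rfl fun v _ => ?_
    conv_lhs => rw [← posPart_sub_negPart (x u), ← posPart_sub_negPart (y v)]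
    ring
  have k1 := key _ _ (hp x) (hp y)
  have k2 := key _ _ (hp x) (hn y)
  have k3 := key _ _ (hn x) (hp y)
  have k4 := key _ _ (hn x) (hn y)
  -- Each of the four positive and negative parts enters two of the four bounds, which doubles the
  -- constant.
  rw [hsplit, hsq x, hsq y]
  rw [abs_le] at *
  constructor <;> linarith [k1.1, k1.2, k2.1, k2.2, k3.1, k3.2, k4.1, k4.2]

/-- The Euclidean operator norm bound that results from a bound for the bilinear form. -/
theorem sum_sq_mulVec_le {W : ι → ι → ℝ} {M : ℝ} (hM : 0 ≤ M)
    (h : ∀ x y : ι → ℝ, |∑ u, ∑ v, W u v * x u * y v| ≤ M * (∑ u, x u ^ 2 + ∑ u, y u ^ 2))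
    (y : ι → ℝ) : ∑ u, (∑ v, W u v * y v) ^ 2 ≤ (2 * M) ^ 2 * ∑ u, y u ^ 2 := by
  rcases hM.eq_or_lt with rfl | hM
  · have := (abs_le.1 (h (fun u => ∑ v, W u v * y v) y)).2
    simp only [zero_mul] at this
    have e : ∑ u, ∑ v, W u v * (∑ v, W u v * y v) * y v = ∑ u, (∑ v, W u v * y v) ^ 2 := by
      refine Finset.sum_congr rfl fun u _ => ?_
      rw [sq, Finset.sum_mul]
      exact Finset.sum_congr rfl fun v _ => by ring
    rw [e] at this
    simpa using this
  -- Testing the form with x = W y / (2M) lets half of the left side absorb the norm of x.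
  · have := (abs_le.1 (h (fun u => (∑ v, W u v * y v) / (2 * M)) y)).2
    have e : ∑ u, ∑ v, W u v * ((∑ v, W u v * y v) / (2 * M)) * y v =
        (∑ u, (∑ v, W u v * y v) ^ 2) / (2 * M) := by
      rw [Finset.sum_div]
      refine Finset.sum_congr rfl fun u _ => ?_
      rw [sq, mul_div_assoc, Finset.sum_mul]
      exact Finset.sum_congr rfl fun v _ => by ring
    have e2 : ∑ u, ((∑ v, W u v * y v) / (2 * M)) ^ 2 =
        (∑ u, (∑ v, W u v * y v) ^ 2) / (2 * M) ^ 2 := by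
      rw [Finset.sum_div]
      exact Finset.sum_congr rfl fun u _ => by rw [div_pow]
    rw [e, e2] at this
    set Z := ∑ u, (∑ v, W u v * y v) ^ 2
    have h4 : Z / (2 * M) = 2 * M * (Z / (2 * M) ^ 2) := by field_simp
    rw [h4] at this
    have h5 : Z = (2 * M) ^ 2 * (Z / (2 * M) ^ 2) := by field_simp
    rw [h5]
    gcongr
    nlinarith

end Discrepancy

/-! ### Power iteration for a perturbed rank one matrix. -/

section Spectral

open Matrix

variable {ι : Type*} [Fintype ι]

theorem dotProduct_self_add_le (x y : ι → ℝ) :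
    (x + y) ⬝ᵥ (x + y) ≤ 2 * (x ⬝ᵥ x) + 2 * (y ⬝ᵥ y) := by
  simp only [dotProduct, Finset.mul_sum, ← Finset.sum_add_distrib]
  refine Finset.sum_le_sum fun u _ => ?_
  simp only [Pi.add_apply]
  nlinarith [sq_nonneg (x u - y u)]

theorem abs_dotProduct_le_of_sq {x y : ι → ℝ} {r : ℝ} (hr : 0 ≤ r)
    (h : y ⬝ᵥ y ≤ r ^ 2 * (x ⬝ᵥ x)) : |x ⬝ᵥ y| ≤ r * (x ⬝ᵥ x) := by
  have hx : 0 ≤ x ⬝ᵥ x := Finset.sum_nonneg fun _ _ => mul_self_nonneg _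
  have hcs : (x ⬝ᵥ y) ^ 2 ≤ (x ⬝ᵥ x) * (y ⬝ᵥ y) := by
    have := Finset.sum_mul_sq_le_sq_mul_sq Finset.univ x y
    simpa [dotProduct, sq] using this
  refine abs_le_of_sq_le_sq ?_ (mul_nonneg hr hx)
  calc (x ⬝ᵥ y) ^ 2 ≤ (x ⬝ᵥ x) * (r ^ 2 * (x ⬝ᵥ x)) := hcs.trans (by gcongr)
    _ = _ := by ring

variable [DecidableEq ι]

theorem exists_eigenvectors {B : Matrix ι ι ℝ} (hB : B.IsSymm) :
    ∃ (l : ι → ℝ) (v : ι → ι → ℝ), (∀ i k, v i ⬝ᵥ v k = if i = k then 1 else 0) ∧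
      (∀ u w, ∑ i, v i u * v i w = if u = w then 1 else 0) ∧ ∀ i, B *ᵥ v i = l i • v i := by
  have hH : B.IsHermitian := by
    rw [Matrix.IsHermitian, Matrix.conjTranspose_eq_transpose_of_trivial]; exact hB
  set U : Matrix ι ι ℝ := (hH.eigenvectorUnitary : Matrix ι ι ℝ) with hU
  have h1 : Uᵀ * U = 1 := by
    have := Unitary.coe_star_mul_self hH.eigenvectorUnitary
    rwa [Matrix.star_eq_conjTranspose, Matrix.conjTranspose_eq_transpose_of_trivial] at this
  have h2 : U * Uᵀ = 1 := mul_eq_one_comm.mp h1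
  refine ⟨hH.eigenvalues, fun i u => U u i, fun i k => ?_, fun u w => ?_, fun i => ?_⟩
  · have := congrFun (congrFun h1 i) k
    rw [Matrix.mul_apply, Matrix.one_apply] at this
    simpa [dotProduct] using this
  · have := congrFun (congrFun h2 u) w
    rw [Matrix.mul_apply, Matrix.one_apply] at this
    simpa using this
  · exact hH.mulVec_eigenvectorBasis i

theorem pow_apply_eq_sum {B : Matrix ι ι ℝ} {l : ι → ℝ} {v : ι → ι → ℝ}
    (hc : ∀ u w, ∑ i, v i u * v i w = if u = w then 1 else 0)
    (he : ∀ i, B *ᵥ v i = l i • v i) (m : ℕ) (u w : ι) :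
    (B ^ m) u w = ∑ i, l i ^ m * v i u * v i w := by
  induction m generalizing u w with
  | zero => simp [Matrix.one_apply, hc]
  | succ m ih =>
    rw [pow_succ', Matrix.mul_apply]
    simp_rw [ih, Finset.mul_sum]
    rw [Finset.sum_comm]
    refine Finset.sum_congr rfl fun i _ => ?_
    have h := congrFun (he i) u
    simp only [Matrix.mulVec, dotProduct, Pi.smul_apply, smul_eq_mul] at h
    rw [pow_succ, mul_assoc (l i ^ m), ← h, Finset.mul_sum, Finset.sum_mul]
    exact Finset.sum_congr rfl fun k _ => by ring

theorem dotProduct_eq_sum {v : ι → ι → ℝ}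
    (hc : ∀ u w, ∑ i, v i u * v i w = if u = w then 1 else 0) (x y : ι → ℝ) :
    x ⬝ᵥ y = ∑ i, (v i ⬝ᵥ x) * (v i ⬝ᵥ y) := by
  simp_rw [dotProduct, Finset.sum_mul_sum]
  rw [Finset.sum_comm]
  refine Finset.sum_congr rfl fun u _ => ?_
  rw [Finset.sum_comm]
  have : ∀ w, ∑ i, v i u * x u * (v i w * y w) = (if u = w then 1 else 0) * (x u * y w) := by
    intro w
    rw [← hc, Finset.sum_mul]
    exact Finset.sum_congr rfl fun i _ => by ring
  simp [this]

/-- A symmetric matrix close to the rank one matrix `θ h hᵀ`: the column of a high power with the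
largest diagonal entry is close to a multiple of `h`. -/
theorem exists_column_close {B R : Matrix ι ι ℝ} {θ r κ η : ℝ} {h : ι → ℝ} (hB : B.IsSymm)
    (hBR : ∀ z, B *ᵥ z = (θ * (h ⬝ᵥ z)) • h + R *ᵥ z) (hr : 0 ≤ r)
    (hR : ∀ z, (R *ᵥ z) ⬝ᵥ (R *ᵥ z) ≤ r ^ 2 * (z ⬝ᵥ z)) (hκ : 0 < κ) (hh : 0 < h ⬝ᵥ h)
    (hθ : κ + r ≤ |θ| * (h ⬝ᵥ h)) (hη0 : 0 < η) (hη : η ≤ 1 / 2) (hrκ : r ≤ η * κ) {j : ι}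
    (hj : ∀ i, (B ^ (2 * Fintype.card ι)) i i ≤ (B ^ (2 * Fintype.card ι)) j j) :
    0 < (B ^ (2 * Fintype.card ι)) j j ∧
    ∃ c : ℝ, c ≠ 0 ∧ ∑ u, ((B ^ (2 * Fintype.card ι)) u j - c * h u) ^ 2 ≤
      16 * η ^ 2 * (c ^ 2 * (h ⬝ᵥ h)) := by
  obtain ⟨l, v, ho, hc, he⟩ := exists_eigenvectors hB
  set n := Fintype.card ι with hn
  have hn0 : 0 < n := Fintype.card_pos_iff.2 ⟨j⟩
  have hRv : ∀ i, (v i ⬝ᵥ v i) = 1 := fun i => by simp [ho]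
  -- a large eigenvalue
  obtain ⟨k, hk⟩ : ∃ k, κ ≤ |l k| := by
    by_contra! hcon
    have h1 : h ⬝ᵥ (B *ᵥ h) = ∑ i, l i * (v i ⬝ᵥ h) ^ 2 := by
      rw [dotProduct_eq_sum hc]
      refine Finset.sum_congr rfl fun i _ => ?_
      rw [dotProduct_mulVec, ← mulVec_transpose, hB.eq, he, smul_dotProduct, smul_eq_mul]
      ring
    have h2 : |h ⬝ᵥ (B *ᵥ h)| ≤ ∑ i, |l i| * (v i ⬝ᵥ h) ^ 2 := by
      rw [h1]
      refine (Finset.abs_sum_le_sum_abs _ _).trans (le_of_eq ?_)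
      exact Finset.sum_congr rfl fun i _ => by
        rw [abs_mul, abs_of_nonneg (sq_nonneg (v i ⬝ᵥ h))]
    have h3 : h ⬝ᵥ h = ∑ i, (v i ⬝ᵥ h) ^ 2 := by
      rw [dotProduct_eq_sum hc]; simp_rw [sq]
    have h4 : ∑ i, |l i| * (v i ⬝ᵥ h) ^ 2 < κ * (h ⬝ᵥ h) := by
      rw [h3, Finset.mul_sum]
      refine Finset.sum_lt_sum (fun i _ => by gcongr; exact (hcon i).le) ?_
      obtain ⟨i, hi⟩ : ∃ i, (v i ⬝ᵥ h) ^ 2 ≠ 0 := by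
        by_contra! h0
        rw [h3, Finset.sum_eq_zero fun i _ => h0 i] at hh
        exact lt_irrefl _ hh
      exact ⟨i, Finset.mem_univ _, mul_lt_mul_of_pos_right (hcon i)
        (lt_of_le_of_ne (sq_nonneg _) hi.symm)⟩
    have h5 : h ⬝ᵥ (B *ᵥ h) = θ * (h ⬝ᵥ h) * (h ⬝ᵥ h) + h ⬝ᵥ (R *ᵥ h) := by
      rw [hBR, dotProduct_add, dotProduct_smul, smul_eq_mul]
    have h6 := abs_dotProduct_le_of_sq hr (hR h)
    have h7 : |θ * (h ⬝ᵥ h) * (h ⬝ᵥ h)| = |θ| * (h ⬝ᵥ h) * (h ⬝ᵥ h) := by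
      rw [abs_mul, abs_mul, abs_of_pos hh]
    have h8 : |θ * (h ⬝ᵥ h) * (h ⬝ᵥ h)| ≤ |h ⬝ᵥ (B *ᵥ h)| + |h ⬝ᵥ (R *ᵥ h)| := by
      have : θ * (h ⬝ᵥ h) * (h ⬝ᵥ h) = h ⬝ᵥ (B *ᵥ h) - h ⬝ᵥ (R *ᵥ h) := by rw [h5]; ring
      rw [this]
      exact abs_sub _ _
    nlinarith [mul_le_mul_of_nonneg_right hθ hh.le]
  have hrl : r < |l k| := by nlinarith
  -- the other eigenvalues are small
  have hsmall : ∀ i, i ≠ k → |l i| ≤ r := by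
    intro i hik
    by_contra! hcon
    set p := h ⬝ᵥ v i
    set q := h ⬝ᵥ v k
    have hnorm : ∀ x y : ℝ, (x • v i + y • v k) ⬝ᵥ (x • v i + y • v k) = x ^ 2 + y ^ 2 := by
      intro x y
      simp only [dotProduct_add, add_dotProduct, dotProduct_smul, smul_dotProduct, smul_eq_mul,
        ho, hik, hik.symm, if_true, if_false]
      ring
    -- The plane of two eigenvectors contains a nonzero vector orthogonal to `h`. There the matrix
    -- acts as `R`, so two eigenvalues larger than `r` in modulus are impossible.
    have hz : ∀ x y : ℝ, x * p + y * q = 0 →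
        (x * l i) ^ 2 + (y * l k) ^ 2 ≤ r ^ 2 * (x ^ 2 + y ^ 2) := by
      intro x y hxy
      have h1 := hBR (x • v i + y • v k)
      have h0 : h ⬝ᵥ (x • v i + y • v k) = 0 := by
        rw [dotProduct_add, dotProduct_smul, dotProduct_smul]; exact hxy
      rw [h0, mul_zero, zero_smul, zero_add, mulVec_add, mulVec_smul, mulVec_smul, he, he,
        smul_smul, smul_smul] at h1
      have h2 := hR (x • v i + y • v k)
      rw [← h1, hnorm, hnorm] at h2
      exact h2
    have a1 : r ^ 2 < l i ^ 2 := by rw [← sq_abs (l i)]; gcongr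
    have a2 : r ^ 2 < l k ^ 2 := by rw [← sq_abs (l k)]; gcongr
    by_cases hp : p = 0
    · have := hz 1 0 (by rw [hp]; ring)
      nlinarith
    · have h1 := hz q (-p) (by ring)
      have hp2 : 0 < p ^ 2 := by positivity
      nlinarith [mul_pos (sub_pos.2 a2) hp2, mul_nonneg (sub_pos.2 a1).le (sq_nonneg q)]
  -- The even exponent makes all `l i ^ m` nonnegative, whatever the sign of `θ`.
  set m := 2 * n with hm
  have hlk : 0 < |l k| := hr.trans_lt hrl
  set Λ := l k ^ m with hΛ
  have hΛabs : Λ = |l k| ^ m := by rw [hΛ, hm, pow_mul, pow_mul, sq_abs]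
  have hΛ0 : 0 < Λ := by rw [hΛabs]; positivity
  have hΛη : r ^ m ≤ η ^ m * Λ := by
    rw [hΛabs, ← mul_pow]
    gcongr
    exact hrκ.trans (by gcongr)
  have hli : ∀ i, i ≠ k → l i ^ m ≤ r ^ m := by
    intro i hi
    have : l i ^ m = |l i| ^ m := by rw [hm, pow_mul, pow_mul, sq_abs]
    rw [this]
    gcongr
    exact hsmall i hi
  have hli0 : ∀ i, 0 ≤ l i ^ m := fun i => by rw [hm, pow_mul]; positivity
  have hpow := pow_apply_eq_sum hc he m
  have hdiag : ∀ u, Λ * v k u ^ 2 ≤ (B ^ m) u u := by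
    intro u
    rw [hpow]
    refine le_trans (le_of_eq ?_) (Finset.single_le_sum (f := fun i => l i ^ m * v i u * v i u)
      (fun i _ => ?_) (Finset.mem_univ k))
    · simp only [hΛ]; ring
    · rw [mul_assoc]
      exact mul_nonneg (hli0 i) (mul_self_nonneg _)
  have hsumv : ∀ u, ∑ i, v i u ^ 2 = 1 := by
    intro u
    have := hc u u
    simpa [sq] using this
  have hnR : (0 : ℝ) < n := by exact_mod_cast hn0
  -- The largest diagonal entry is at least the average, and the leading eigenvector alone
  -- contributes `Λ` to the trace.
  have hDj : Λ ≤ n * (B ^ m) j j := by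
    have h1 : ∑ u, Λ * v k u ^ 2 = Λ := by
      rw [← Finset.mul_sum]
      have := hRv k
      simp only [dotProduct] at this
      simp [sq, this]
    calc Λ = ∑ u, Λ * v k u ^ 2 := h1.symm
      _ ≤ ∑ u : ι, (B ^ m) j j := Finset.sum_le_sum fun u _ => (hdiag u).trans (hj u)
      _ = n * (B ^ m) j j := by rw [Finset.sum_const, nsmul_eq_mul, Finset.card_univ]
  have hDj' : (B ^ m) j j ≤ Λ * v k j ^ 2 + r ^ m := by
    rw [hpow, ← Finset.add_sum_erase _ _ (Finset.mem_univ k)]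
    refine add_le_add (le_of_eq (by simp only [hΛ]; ring)) ?_
    calc ∑ i ∈ Finset.univ.erase k, l i ^ m * v i j * v i j
        ≤ ∑ i ∈ Finset.univ.erase k, r ^ m * v i j ^ 2 := by
          refine Finset.sum_le_sum fun i hi => ?_
          rw [mul_assoc, ← sq]
          exact mul_le_mul_of_nonneg_right (hli i (Finset.ne_of_mem_erase hi)) (sq_nonneg _)
      _ = r ^ m * ∑ i ∈ Finset.univ.erase k, v i j ^ 2 := by rw [Finset.mul_sum]
      _ ≤ r ^ m * 1 := by
          gcongr
          rw [← hsumv j]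
          exact Finset.sum_le_sum_of_subset_of_nonneg (Finset.erase_subset _ _)
            fun _ _ _ => sq_nonneg _
      _ = r ^ m := mul_one _
  -- With η ≤ 1/2 the exponent `2 * n` beats the factor `n` lost in the averaging.
  have hηm : η ^ m * (2 * n) ≤ η ∧ η ^ m ≤ η := by
    have h2 : (n : ℝ) ≤ 2 ^ (n - 1) := by
      exact_mod_cast (show n ≤ 2 ^ (n - 1) by
        have := Nat.lt_two_pow_self (n := n - 1); omega)
    have h3 : η ^ m ≤ η * (1 / 2) ^ (m - 1) := by
      calc η ^ m = η * η ^ (m - 1) := by rw [← pow_succ']; congr 1; omega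
        _ ≤ _ := by gcongr
    have h4 : (1 / 2 : ℝ) ^ (m - 1) * (2 * n) ≤ 1 := by
      have e : m - 1 = (n - 1) + (n - 1) + 1 := by omega
      have hp : (1 / 2 : ℝ) ^ (n - 1) * 2 ^ (n - 1) = 1 := by rw [← mul_pow]; norm_num
      have hq : (1 / 2 : ℝ) ^ (n - 1) ≤ 1 := pow_le_one₀ (by norm_num) (by norm_num)
      rw [e, pow_succ, pow_add]
      calc (1 / 2 : ℝ) ^ (n - 1) * (1 / 2) ^ (n - 1) * (1 / 2) * (2 * n)
          = (1 / 2) ^ (n - 1) * ((1 / 2) ^ (n - 1) * n) := by ring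
        _ ≤ 1 * ((1 / 2) ^ (n - 1) * 2 ^ (n - 1)) := by gcongr
        _ = 1 := by rw [hp]; ring
    constructor
    · calc η ^ m * (2 * n) ≤ η * (1 / 2) ^ (m - 1) * (2 * n) := by gcongr
        _ = η * ((1 / 2) ^ (m - 1) * (2 * n)) := by ring
        _ ≤ η * 1 := by gcongr
        _ = η := mul_one _
    · refine h3.trans (mul_le_of_le_one_right hη0.le (pow_le_one₀ (by norm_num) (by norm_num)))
  have hvkj : 1 ≤ 2 * n * v k j ^ 2 := by
    have h1 : Λ ≤ n * (Λ * v k j ^ 2 + η ^ m * Λ) := hDj.trans (by gcongr; linarith)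
    have h2 : 1 ≤ n * (v k j ^ 2 + η ^ m) := by
      have : Λ * 1 ≤ Λ * (n * (v k j ^ 2 + η ^ m)) := by linarith
      exact le_of_mul_le_mul_left this hΛ0
    nlinarith [hηm.1]
  have hv0 : v k j ≠ 0 := by
    intro h0
    rw [h0] at hvkj
    norm_num at hvkj
  refine ⟨?_, ?_⟩
  · have : 0 < n * (B ^ m) j j := hΛ0.trans_le hDj
    exact pos_of_mul_pos_right this hnR.le
  -- the scalar
  set C := Λ * v k j with hC
  have hC0 : C ≠ 0 := mul_ne_zero hΛ0.ne' hv0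
  -- Dividing the eigenvalue equation by `l k` gives `v k` as `μ • h` plus an error of norm at most
  -- `η`.
  set μ := θ * (h ⬝ᵥ v k) / l k with hμ
  have hlk0 : l k ≠ 0 := abs_pos.1 hlk
  -- the eigenvector
  have hvk : v k = μ • h + (1 / l k) • (R *ᵥ v k) := by
    have h1 := hBR (v k)
    rw [he] at h1
    have h2 : v k = (1 / l k) • (l k • v k) := by
      rw [smul_smul, one_div, inv_mul_cancel₀ hlk0, one_smul]
    conv_lhs => rw [h2, h1]
    rw [smul_add, smul_smul, hμ]
    congr 2
    ring
  set q := (1 / l k) • (R *ᵥ v k) with hq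
  have hqq : q ⬝ᵥ q ≤ η ^ 2 := by
    have h1 := hR (v k)
    rw [hRv, mul_one] at h1
    rw [hq, smul_dotProduct, dotProduct_smul, smul_eq_mul, smul_eq_mul, ← mul_assoc]
    have h2 : (1 / l k * (1 / l k)) = 1 / |l k| ^ 2 := by rw [sq_abs]; field_simp
    rw [h2, div_mul_eq_mul_div, one_mul, div_le_iff₀ (by positivity)]
    refine h1.trans ?_
    rw [← mul_pow]
    gcongr
    exact hrκ.trans (by gcongr)
  have hμh : 1 / 4 ≤ μ ^ 2 * (h ⬝ᵥ h) := by
    have h1 := dotProduct_self_add_le (μ • h) q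
    rw [← hvk, hRv, smul_dotProduct, dotProduct_smul, smul_eq_mul, smul_eq_mul] at h1
    nlinarith
  have hμ0 : μ ≠ 0 := by
    intro h0
    rw [h0] at hμh
    norm_num at hμh
  refine ⟨C * μ, mul_ne_zero hC0 hμ0, ?_⟩
  -- the remainder
  let t : ι → ℝ := fun u => ∑ i ∈ Finset.univ.erase k, l i ^ m * v i u * v i j
  have ht : t ⬝ᵥ t ≤ (r ^ m) ^ 2 := by
    have h1 : ∀ i, v i ⬝ᵥ t = if i = k then 0 else l i ^ m * v i j := by
      intro i
      have : t = ∑ i' ∈ Finset.univ.erase k, (l i' ^ m * v i' j) • v i' := by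
        ext u
        simp only [t, Finset.sum_apply, Pi.smul_apply, smul_eq_mul]
        exact Finset.sum_congr rfl fun _ _ => by ring
      rw [this, dotProduct_sum]
      simp only [dotProduct_smul, ho, smul_eq_mul, mul_ite, mul_one, mul_zero]
      rw [Finset.sum_ite_eq]
      simp
    rw [dotProduct_eq_sum hc]
    calc ∑ i, v i ⬝ᵥ t * v i ⬝ᵥ t ≤ ∑ i, (r ^ m) ^ 2 * v i j ^ 2 := by
          refine Finset.sum_le_sum fun i _ => ?_
          rw [h1]
          split_ifs with hi
          · rw [mul_zero]; positivity
          · calc l i ^ m * v i j * (l i ^ m * v i j) = (l i ^ m) ^ 2 * v i j ^ 2 := by ring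
              _ ≤ _ := mul_le_mul_of_nonneg_right
                (pow_le_pow_left₀ (hli0 i) (hli i hi) 2) (sq_nonneg _)
      _ = (r ^ m) ^ 2 := by rw [← Finset.mul_sum, hsumv, mul_one]
  have ht2 : t ⬝ᵥ t ≤ C ^ 2 * η ^ 2 := by
    refine ht.trans ?_
    have h1 : (r ^ m) ^ 2 ≤ (η ^ m * Λ) ^ 2 := pow_le_pow_left₀ (by positivity) hΛη 2
    refine h1.trans ?_
    have h2 : (η ^ m) ^ 2 ≤ η ^ 2 * v k j ^ 2 := by
      calc (η ^ m) ^ 2 = η ^ m * η ^ m * 1 := by ring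
        _ ≤ η * η ^ m * (2 * n * v k j ^ 2) := by
            gcongr
            exact hηm.2
        _ = η * (η ^ m * (2 * n)) * v k j ^ 2 := by ring
        _ ≤ η * η * v k j ^ 2 := by gcongr; exact hηm.1
        _ = _ := by ring
    calc (η ^ m * Λ) ^ 2 = Λ ^ 2 * (η ^ m) ^ 2 := by ring
      _ ≤ Λ ^ 2 * (η ^ 2 * v k j ^ 2) := by gcongr
      _ = _ := by rw [hC]; ring
  have hcol : ∀ u, (B ^ m) u j - C * μ * h u = (C • q + t) u := by
    intro u
    have h1 := congrFun hvk u
    simp only [Pi.add_apply, Pi.smul_apply, smul_eq_mul] at h1 ⊢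
    rw [hpow, ← Finset.add_sum_erase _ _ (Finset.mem_univ k)]
    simp only [t]
    rw [hC, ← hΛ]
    have : Λ * v k u * v k j = Λ * v k j * (μ * h u + q u) := by rw [← h1]; ring
    rw [this]
    ring
  have hsum : ∑ u, ((B ^ m) u j - C * μ * h u) ^ 2 = (C • q + t) ⬝ᵥ (C • q + t) := by
    simp only [dotProduct]
    exact Finset.sum_congr rfl fun u _ => by rw [hcol, sq]
  rw [hsum]
  have h1 := dotProduct_self_add_le (C • q) t
  rw [smul_dotProduct, dotProduct_smul, smul_eq_mul, smul_eq_mul] at h1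
  have h2 : C * (C * (q ⬝ᵥ q)) ≤ C ^ 2 * η ^ 2 := by
    rw [← mul_assoc, ← sq]; gcongr
  have h3 : C ^ 2 * η ^ 2 * (1 / 4) ≤ C ^ 2 * η ^ 2 * (μ ^ 2 * (h ⬝ᵥ h)) := by gcongr
  calc _ ≤ 4 * (C ^ 2 * η ^ 2) := by linarith
    _ ≤ 16 * (C ^ 2 * η ^ 2 * (μ ^ 2 * (h ⬝ᵥ h))) := by linarith
    _ = _ := by ring

end Spectral

/-! ### Signs of the labels and the spectral stage of the algorithm. -/

noncomputable section

open Matrix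

/-- The labels as signs. -/
def spin {n : ℕ} (x : Fin n → Fin 2) (u : Fin n) : ℝ := if x u = 0 then 1 else -1

/-- The labels computed by the machine as signs. -/
def machineSpin {n : ℕ} (L : ℕ → ℕ) (u : Fin n) : ℝ := if L u ≠ 0 then 1 else -1

open scoped Classical in
/-- The adjacency matrix. -/
def adj {n : ℕ} (G : SimpleGraph (Fin n)) : Matrix (Fin n) (Fin n) ℝ :=
  fun u v => if G.Adj u v then 1 else 0

/-- The connection probabilities for labels `x`. -/
def prob {n : ℕ} (pa pb : ℝ) (x : Fin n → Fin 2) (u v : Fin n) : ℝ := if x u = x v then pa else pb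

/-- The centered adjacency matrix. -/
def noise {n : ℕ} (pa pb : ℝ) (x : Fin n → Fin 2) (G : SimpleGraph (Fin n)) :
    Matrix (Fin n) (Fin n) ℝ :=
  fun u v => if u = v then 0 else adj G u v - prob pa pb x u v

/-- The projection onto the orthogonal complement of the constant vectors. -/
def centering (n : ℕ) : Matrix (Fin n) (Fin n) ℝ := fun u v => (if u = v then 1 else 0) - 1 / n

theorem spin_eq_or {n : ℕ} (x : Fin n → Fin 2) (u : Fin n) : spin x u = 1 ∨ spin x u = -1 := by
  unfold spin; split_ifs <;> simp

theorem spin_mul_self {n : ℕ} (x : Fin n → Fin 2) (u : Fin n) : spin x u * spin x u = 1 := by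
  rcases spin_eq_or x u with h | h <;> rw [h] <;> norm_num

theorem machineSpin_eq_or {n : ℕ} (L : ℕ → ℕ) (u : Fin n) :
    machineSpin L u = 1 ∨ machineSpin L u = -1 := by
  unfold machineSpin; split_ifs <;> simp

theorem adj_symm {n : ℕ} (G : SimpleGraph (Fin n)) (u v : Fin n) : adj G u v = adj G v u := by
  have := G.adj_comm u v
  unfold adj
  split_ifs <;> simp_all

theorem adj_nonneg {n : ℕ} (G : SimpleGraph (Fin n)) (u v : Fin n) : 0 ≤ adj G u v := by
  unfold adj; split_ifs <;> norm_num

theorem noise_symm {n : ℕ} (pa pb : ℝ) (x : Fin n → Fin 2) (G : SimpleGraph (Fin n))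
    (u v : Fin n) : noise pa pb x G u v = noise pa pb x G v u := by
  simp only [noise, adj_symm G u v, prob, eq_comm]

theorem prob_eq_spin {n : ℕ} (pa pb : ℝ) (x : Fin n → Fin 2) (u v : Fin n) :
    prob pa pb x u v = (pa + pb) / 2 + (pa - pb) / 2 * (spin x u * spin x v) := by
  unfold prob spin
  have h : ∀ i j : Fin 2, (if i = j then pa else pb) =
      (pa + pb) / 2 + (pa - pb) / 2 * ((if i = 0 then 1 else -1) * (if j = 0 then 1 else -1)) := by
    intro i j
    fin_cases i <;> fin_cases j <;> simp <;> ring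
  exact h _ _

/-- Extended to the diagonal, the rank two mean has the value `pa` there, whereas both the adjacency
matrix and the noise vanish; the last term corrects this. -/
theorem adj_eq {n : ℕ} (pa pb : ℝ) (x : Fin n → Fin 2) (G : SimpleGraph (Fin n)) (u v : Fin n) :
    adj G u v = noise pa pb x G u v + (pa + pb) / 2 + (pa - pb) / 2 * (spin x u * spin x v) -
      if u = v then pa else 0 := by
  by_cases h : u = v
  · subst h
    simp only [noise, adj, if_true, spin_mul_self, SimpleGraph.irrefl, if_false]
    ring
  · simp only [noise, h, if_false]
    rw [add_assoc, ← prob_eq_spin]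
    ring

theorem centering_mulVec {n : ℕ} (z : Fin n → ℝ) (u : Fin n) :
    (centering n *ᵥ z) u = z u - (∑ v, z v) / n := by
  simp only [centering, mulVec, dotProduct, sub_mul, Finset.sum_sub_distrib, ite_mul, one_mul,
    zero_mul, Finset.sum_ite_eq, Finset.mem_univ, if_true, ← Finset.mul_sum]
  ring

theorem centering_transpose (n : ℕ) : (centering n)ᵀ = centering n := by
  ext u v; simp [centering, eq_comm]

theorem sum_centering_mulVec {n : ℕ} (z : Fin n → ℝ) : ∑ u, (centering n *ᵥ z) u = 0 := by
  rcases Nat.eq_zero_or_pos n with rfl | hn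
  · simp
  · have : (n : ℝ) ≠ 0 := by positivity
    simp only [centering_mulVec, Finset.sum_sub_distrib, Finset.sum_const, Finset.card_univ,
      Fintype.card_fin, nsmul_eq_mul]
    field_simp
    ring

theorem centering_mul_self (n : ℕ) : centering n * centering n = centering n := by
  refine Matrix.ext_of_mulVec_single fun i => ?_
  rw [← mulVec_mulVec]
  ext u
  rw [centering_mulVec, sum_centering_mulVec]
  simp

theorem dotProduct_centering_le {n : ℕ} (z : Fin n → ℝ) :
    (centering n *ᵥ z) ⬝ᵥ (centering n *ᵥ z) ≤ z ⬝ᵥ z := by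
  have h1 : (centering n *ᵥ z) ⬝ᵥ (centering n *ᵥ z) = z ⬝ᵥ (centering n *ᵥ z) := by
    rw [dotProduct_mulVec, ← mulVec_transpose, centering_transpose, mulVec_mulVec,
      centering_mul_self, dotProduct_comm]
  rw [h1]
  have h2 : z ⬝ᵥ (centering n *ᵥ z) = z ⬝ᵥ z - (∑ v, z v) ^ 2 / n := by
    simp only [dotProduct, centering_mulVec, mul_sub, Finset.sum_sub_distrib, ← Finset.sum_mul]
    ring
  rw [h2]
  have : 0 ≤ (∑ v, z v) ^ 2 / (n : ℝ) := by positivity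
  linarith

theorem edge_inputMemory {n : ℕ} (G : SimpleGraph (Fin n)) (u v : Fin n) :
    (edge n ((inputMemory G).arr 0) u v : ℝ) = adj G u v := by
  have h : (∃ u' v' : Fin n, n * (u : ℕ) + v = n * u' + v' ∧ G.Adj u' v') ↔ G.Adj u v := by
    constructor
    · rintro ⟨u', v', h, ha⟩
      have hn : 0 < n := u.pos
      have h1 : (u : ℕ) = u' := by
        have := congrArg (· / n) h
        simpa [Nat.mul_add_div hn, Nat.div_eq_of_lt v.2, Nat.div_eq_of_lt v'.2] using this
      have h2 : (v : ℕ) = v' := by rw [h1] at h; omega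
      rwa [Fin.ext h1, Fin.ext h2]
    · exact fun ha => ⟨u, v, rfl, ha⟩
  simp only [edge, inputMemory, adj, true_and, h]
  split_ifs <;> simp_all

theorem sum_range_eq_sum_fin {n : ℕ} (f : ℕ → ℝ) :
    ∑ v ∈ Finset.range n, f v = ∑ v : Fin n, f v := Finset.sum_range f

/-- The compressed adjacency matrix. -/
def centeredAdj {n : ℕ} (G : SimpleGraph (Fin n)) : Matrix (Fin n) (Fin n) ℝ :=
  centering n * adj G * centering n

theorem centeredAdj_isSymm {n : ℕ} (G : SimpleGraph (Fin n)) : (centeredAdj G).IsSymm := by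
  have h : (adj G)ᵀ = adj G := by ext u v; exact adj_symm G v u
  simp only [Matrix.IsSymm, centeredAdj, transpose_mul, centering_transpose, h]
  rw [mul_assoc]

/-- Since the projection is idempotent, one projection per step of the program is enough to produce
powers of the symmetric matrix. -/
theorem centeredAdj_pow {n : ℕ} (G : SimpleGraph (Fin n)) (k : ℕ) :
    centeredAdj G ^ (k + 1) = (centering n * adj G) ^ (k + 1) * centering n := by
  induction k with
  | zero => simp [centeredAdj]
  | succ k ih =>
    rw [pow_succ, ih, centeredAdj, pow_succ _ (k + 1)]
    simp only [mul_assoc]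
    rw [← mul_assoc (centering n) (centering n), centering_mul_self]

/-- The machine has neither negative numbers nor division, so the vector is kept as a difference of
two natural vectors and the projection is multiplied by `n`. This, and the start n e_i - 1, account
for the factor `n ^ (k + 1)`. -/
theorem powerIterate_eq {n : ℕ} (G : SimpleGraph (Fin n)) (i : Fin n) (k : ℕ) (u : Fin n) :
    (((powerStep n (edge n ((inputMemory G).arr 0)))^[k] (startVector n i)).1 u : ℝ) -
      ((powerStep n (edge n ((inputMemory G).arr 0)))^[k] (startVector n i)).2 u =
      n ^ (k + 1) * ((centering n * adj G) ^ k * centering n) u i := by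
  have hn : (n : ℝ) ≠ 0 := by have := u.pos; positivity
  induction k generalizing u with
  | zero =>
    simp only [Function.iterate_zero, id_eq, startVector, Nat.cast_ite, Nat.cast_one,
      Nat.cast_zero, zero_add, pow_one, pow_zero, one_mul, centering, Fin.val_inj]
    split_ifs <;> field_simp <;> ring
  | succ k ih =>
    rw [Function.iterate_succ_apply']
    set z := (powerStep n (edge n ((inputMemory G).arr 0)))^[k] (startVector n i)
    set y : Fin n → ℝ := fun v => ((centering n * adj G) ^ k * centering n) v i with hy
    have h1 : ((centering n * adj G) ^ (k + 1) * centering n) u i =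
        (centering n *ᵥ (adj G *ᵥ y)) u := by
      rw [mulVec_mulVec, pow_succ', mul_assoc, Matrix.mul_apply]
      rfl
    rw [h1, centering_mulVec]
    simp only [powerStep]
    push_cast
    simp only [sum_range_eq_sum_fin, edge_inputMemory]
    rw [← Finset.sum_sub_distrib]
    simp only [← Finset.sum_sub_distrib]
    have h2 : ∀ v w : Fin n, adj G u v * (z.1 v : ℝ) + adj G w v * z.2 v -
        (adj G u v * z.2 v + adj G w v * z.1 v) =
        n ^ (k + 1) * (adj G u v * y v) - n ^ (k + 1) * (adj G w v * y v) := by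
      intro v w
      have := ih v
      linear_combination (adj G u v - adj G w v) * this
    simp only [h2, Finset.sum_sub_distrib, Finset.sum_const, Finset.card_univ,
      Fintype.card_fin, nsmul_eq_mul, ← Finset.mul_sum, mulVec, dotProduct]
    rw [Finset.sum_comm]
    simp only [Finset.mul_sum, Finset.sum_div, mul_sub]
    congr 1
    · refine Finset.sum_congr rfl fun v _ => ?_
      ring
    · refine Finset.sum_congr rfl fun v _ => Finset.sum_congr rfl fun w _ => ?_
      field_simp
      ring

theorem powerVector_eq {n : ℕ} (G : SimpleGraph (Fin n)) (i u : Fin n) :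
    ((powerVector n (edge n ((inputMemory G).arr 0)) i).1 u : ℝ) -
      (powerVector n (edge n ((inputMemory G).arr 0)) i).2 u =
      n ^ (2 * n + 1) * (centeredAdj G ^ (2 * n)) u i := by
  have h := powerIterate_eq G i (2 * n) u
  have hn : 2 * n = (2 * n - 1) + 1 := by have := u.pos; omega
  rw [show centeredAdj G ^ (2 * n) = (centering n * adj G) ^ (2 * n) * centering n by
    rw [hn]; exact centeredAdj_pow G _]
  exact h

open Matrix

/-- The projection annihilates the constant part of the mean. What remains is the rank one signal
along the centred spins, plus noise and the diagonal correction. -/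
theorem centeredAdj_mulVec {n : ℕ} (pa pb : ℝ) (x : Fin n → Fin 2) (G : SimpleGraph (Fin n))
    (z : Fin n → ℝ) : centeredAdj G *ᵥ z =
      ((pa - pb) / 2 * ((centering n *ᵥ spin x) ⬝ᵥ z)) • (centering n *ᵥ spin x) +
      (centering n *ᵥ (noise pa pb x G *ᵥ (centering n *ᵥ z)) + (-pa) • (centering n *ᵥ z)) := by
  have hn : centering n *ᵥ (fun _ => (1 : ℝ)) = 0 := by
    ext u
    have : (n : ℝ) ≠ 0 := by have := u.pos; positivity
    rw [centering_mulVec]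
    simp [this]
  set y := centering n *ᵥ z with hy
  have hsum : ∑ v, y v = 0 := sum_centering_mulVec z
  have hdot : (centering n *ᵥ spin x) ⬝ᵥ z = spin x ⬝ᵥ y := by
    rw [hy, dotProduct_mulVec (spin x), ← mulVec_transpose, centering_transpose]
  have hA : adj G *ᵥ y = noise pa pb x G *ᵥ y + ((pa - pb) / 2 * (spin x ⬝ᵥ y)) • spin x +
      (-pa) • y := by
    ext u
    simp only [mulVec, dotProduct, Pi.add_apply, Pi.smul_apply, smul_eq_mul]
    calc ∑ v, adj G u v * y v = ∑ v, (noise pa pb x G u v * y v + (pa + pb) / 2 * y v +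
          (pa - pb) / 2 * (spin x v * y v) * spin x u - if u = v then pa * y v else 0) := by
          refine Finset.sum_congr rfl fun v _ => ?_
          rw [adj_eq pa pb x G u v]
          split_ifs <;> ring
      _ = _ := by
          simp only [Finset.sum_add_distrib, Finset.sum_sub_distrib, ← Finset.mul_sum,
            ← Finset.sum_mul, hsum, Finset.sum_ite_eq, Finset.mem_univ, if_true]
          ring
  have hyy : centering n *ᵥ y = y := by rw [hy, mulVec_mulVec, centering_mul_self]
  rw [centeredAdj, ← mulVec_mulVec, ← mulVec_mulVec, ← hy, hA, mulVec_add, mulVec_add,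
    mulVec_smul, mulVec_smul, hyy, hdot]
  abel

theorem dotProduct_remainder_le {n : ℕ} {pa pb M : ℝ} {x : Fin n → Fin 2}
    {G : SimpleGraph (Fin n)} (hpa : 0 ≤ pa) (hpM : pa ≤ M)
    (hW : ∀ y : Fin n → ℝ, ∑ u, (∑ v, noise pa pb x G u v * y v) ^ 2 ≤ (2 * M) ^ 2 * ∑ u, y u ^ 2)
    (z : Fin n → ℝ) {w : Fin n → ℝ}
    (hw : w = centering n *ᵥ (noise pa pb x G *ᵥ (centering n *ᵥ z)) +
      (-pa) • (centering n *ᵥ z)) : w ⬝ᵥ w ≤ (4 * M) ^ 2 * (z ⬝ᵥ z) := by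
  rw [hw]
  refine (dotProduct_self_add_le _ _).trans ?_
  have h1 := dotProduct_centering_le (noise pa pb x G *ᵥ (centering n *ᵥ z))
  have h2 := dotProduct_centering_le z
  have h3 := hW (centering n *ᵥ z)
  have e1 : ∑ u, (∑ v, noise pa pb x G u v * (centering n *ᵥ z) v) ^ 2 =
      (noise pa pb x G *ᵥ (centering n *ᵥ z)) ⬝ᵥ (noise pa pb x G *ᵥ (centering n *ᵥ z)) := by
    simp only [dotProduct, mulVec, sq]
  have e2 : ∑ u, (centering n *ᵥ z) u ^ 2 = (centering n *ᵥ z) ⬝ᵥ (centering n *ᵥ z) := by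
    simp only [dotProduct, sq]
  rw [e1, e2] at h3
  rw [smul_dotProduct, dotProduct_smul, smul_eq_mul, smul_eq_mul]
  set Y := (centering n *ᵥ z) ⬝ᵥ (centering n *ᵥ z)
  have hY : 0 ≤ Y := Finset.sum_nonneg fun _ _ => mul_self_nonneg _
  have hM : 0 ≤ M := hpa.trans hpM
  have h4 : pa * pa * Y ≤ M * M * Y := by gcongr
  have h5 : M ^ 2 * Y ≤ M ^ 2 * (z ⬝ᵥ z) := by gcongr
  have h6 : 0 ≤ M ^ 2 * (z ⬝ᵥ z) :=
    mul_nonneg (sq_nonneg _) (Finset.sum_nonneg fun _ _ => mul_self_nonneg _)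
  nlinarith

/-- As |s - d| ≥ 1/2, the target has modulus at least |c|/2, and a wrong sign puts `X` on the other
side of zero or at zero. So every misclassified vertex costs a fixed amount of squared error. -/
theorem sq_div_four_le_of_sign_ne {c X s d : ℝ} (hs : s = 1 ∨ s = -1) (hd : |d| ≤ 1 / 2)
    (hne : (if 0 < X then (1 : ℝ) else -1) ≠ (if 0 < c then 1 else -1) * s) :
    c ^ 2 / 4 ≤ (X - c * (s - d)) ^ 2 := by
  obtain ⟨d1, d2⟩ := abs_le.1 hd
  have hX : X * c * s ≤ 0 := by
    rcases hs with rfl | rfl <;> split_ifs at hne with h1 h2 h2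
    all_goals first | (exfalso; revert hne; norm_num; done) | nlinarith
  have hst : 1 / 2 ≤ s * (s - d) := by rcases hs with rfl | rfl <;> linarith
  have h1 : X * c * (s - d) ≤ 0 := by
    have : X * c * (s - d) = X * c * s * (s * (s - d)) := by
      rcases hs with rfl | rfl <;> ring
    rw [this]
    exact mul_nonpos_of_nonpos_of_nonneg hX (by linarith)
  have h2 : 1 / 4 ≤ (s - d) ^ 2 := by rcases hs with rfl | rfl <;> nlinarith
  have h3 : c ^ 2 * (1 / 4) ≤ c ^ 2 * (s - d) ^ 2 := by gcongr
  nlinarith [sq_nonneg X]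

/-- If the noise is small in operator norm, the signs of the best column are the communities, up to
few errors. -/
theorem card_error_le_of_isBestLabel {n : ℕ} (hn : 0 < n) {pa pb M η : ℝ} {x : Fin n → Fin 2}
    {G : SimpleGraph (Fin n)} (hpa : 0 ≤ pa) (hpM : pa ≤ M)
    (hW : ∀ y : Fin n → ℝ, ∑ u, (∑ v, noise pa pb x G u v * y v) ^ 2 ≤ (2 * M) ^ 2 * ∑ u, y u ^ 2)
    (hab : pa ≠ pb) (hη0 : 0 < η) (hη : η ≤ 1 / 2) (hM : 16 * M ≤ η * (|pa - pb| * n))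
    (hbal : |∑ u, spin x u| ≤ n / 2) {L : ℕ → ℕ}
    (hL : IsBestLabel n (edge n ((inputMemory G).arr 0)) L) :
    ∃ t : ℝ, (t = 1 ∨ t = -1) ∧
      ((Finset.univ.filter fun u => machineSpin L u ≠ t * spin x u).card : ℝ) ≤ 64 * η ^ 2 * n := by
  have hnR : (0 : ℝ) < n := by exact_mod_cast hn
  set h := centering n *ᵥ spin x with hh
  have hspin2 : spin x ⬝ᵥ spin x = n := by simp [dotProduct, spin_mul_self]
  have hhh : h ⬝ᵥ h = n - (∑ u, spin x u) ^ 2 / n := by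
    have h1 : h ⬝ᵥ h = spin x ⬝ᵥ h := by
      rw [hh, dotProduct_mulVec, ← mulVec_transpose, centering_transpose, mulVec_mulVec,
        centering_mul_self, dotProduct_comm]
    rw [h1]
    simp only [dotProduct, hh, centering_mulVec, mul_sub, Finset.sum_sub_distrib,
      ← Finset.sum_mul]
    simp only [dotProduct] at hspin2
    rw [hspin2]
    ring
  have hsq : (∑ u, spin x u) ^ 2 / n ≤ n / 4 := by
    rw [div_le_iff₀ hnR]
    have := sq_le_sq' (by linarith [abs_le.1 hbal]) (abs_le.1 hbal).2
    nlinarith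
  have hM0 : 0 ≤ M := hpa.trans hpM
  have hab' : 0 < |pa - pb| := abs_pos.2 (sub_ne_zero.2 hab)
  -- Balance makes the signal at least 3/8 · |pa - pb| n. Of this, `κ` takes 1/4 and the remainder
  -- norm 4M takes at most 1/8.
  set κ := |pa - pb| * n / 4 with hκ
  have hκ0 : 0 < κ := by positivity
  set R := centeredAdj G - ((pa - pb) / 2) • vecMulVec h h with hR
  have hBR : ∀ z, centeredAdj G *ᵥ z = ((pa - pb) / 2 * (h ⬝ᵥ z)) • h + R *ᵥ z := by
    intro z
    rw [hR, sub_mulVec, smul_mulVec, vecMulVec_mulVec]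
    ext u
    simp
    ring
  have hRn : ∀ z, (R *ᵥ z) ⬝ᵥ (R *ᵥ z) ≤ (4 * M) ^ 2 * (z ⬝ᵥ z) := by
    intro z
    refine dotProduct_remainder_le hpa hpM hW z ?_
    have h1 := hBR z
    rw [centeredAdj_mulVec pa pb x G z, ← hh] at h1
    exact (add_left_cancel h1).symm
  have hpv := powerVector_eq G
  set e := edge n ((inputMemory G).arr 0) with he
  have hpos : (0 : ℝ) < (n : ℝ) ^ (2 * n + 1) := by positivity
  have hθ : κ + 4 * M ≤ |(pa - pb) / 2| * (h ⬝ᵥ h) := by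
    rw [abs_div, abs_two, hhh]
    have h1 : |pa - pb| / 2 * (n * (3 / 4)) ≤ |pa - pb| / 2 * (n - (∑ u, spin x u) ^ 2 / n) := by
      gcongr
      linarith
    have h2 : η * (|pa - pb| * n) ≤ 1 / 2 * (|pa - pb| * n) := by gcongr
    rw [hκ]
    linarith
  have hspec : ∀ j : Fin n, (∀ i, (centeredAdj G ^ (2 * n)) i i ≤ (centeredAdj G ^ (2 * n)) j j) →
      0 < (centeredAdj G ^ (2 * n)) j j ∧ ∃ c : ℝ, c ≠ 0 ∧
        ∑ u, ((centeredAdj G ^ (2 * n)) u j - c * h u) ^ 2 ≤ 16 * η ^ 2 * (c ^ 2 * (h ⬝ᵥ h)) := by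
    intro j hj
    have := exists_column_close (j := j) (centeredAdj_isSymm G) hBR (by positivity) hRn hκ0
      (by rw [hhh]; linarith) hθ hη0 hη (by rw [hκ]; linarith)
      (by simpa only [Fintype.card_fin] using hj)
    simpa only [Fintype.card_fin] using this
  rcases hL with hL | ⟨j, hjn, hj, hLj⟩
  -- The case in which no start has a positive diagonal entry is excluded, since the largest
  -- diagonal entry of the power is positive.
  · exfalso
    obtain ⟨j, -, hj⟩ := Finset.exists_max_image Finset.univ
      (fun i : Fin n => (centeredAdj G ^ (2 * n)) i i) ⟨⟨0, hn⟩, Finset.mem_univ _⟩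
    obtain ⟨h1, -⟩ := hspec j fun i => hj i (Finset.mem_univ i)
    have h2 := hpv j j
    have h3 : ((powerVector n e j).1 j : ℝ) ≤ (powerVector n e j).2 j := by
      exact_mod_cast hL j j.2
    have := mul_pos hpos h1
    linarith
  · set j' : Fin n := ⟨j, hjn⟩ with hj'
    obtain ⟨-, c, hc0, hc⟩ := hspec j' fun i => by
      have h1 := hpv i i
      have h2 := hpv j' j'
      have h3 : ((powerVector n e i).1 i : ℝ) + (powerVector n e j).2 j ≤
        (powerVector n e j).1 j + (powerVector n e i).2 i := by exact_mod_cast hj i i.2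
      refine le_of_mul_le_mul_left ?_ hpos
      rw [← h1, ← h2]
      simp only [hj']
      linarith
    refine ⟨if 0 < c then 1 else -1, by split_ifs <;> simp, ?_⟩
    set E := Finset.univ.filter fun u =>
      machineSpin L u ≠ (if 0 < c then 1 else -1) * spin x u with hE
    have hterm : ∀ u ∈ E, c ^ 2 / 4 ≤ ((centeredAdj G ^ (2 * n)) u j' - c * h u) ^ 2 := by
      intro u hu
      rw [hE, Finset.mem_filter] at hu
      set X := (centeredAdj G ^ (2 * n)) u j'
      have hsgn : machineSpin L u = if 0 < X then 1 else -1 := by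
        have h1 := hpv j' u
        simp only [machineSpin, hLj u u.2, signLabel]
        have : (powerVector n e j).2 u < (powerVector n e j).1 u ↔ 0 < X := by
          rw [← mul_pos_iff_of_pos_left hpos, ← h1, sub_pos, Nat.cast_lt]
        simp only [this]
        split_ifs <;> simp_all
      have hhu : h u = spin x u - (∑ v, spin x v) / n := by rw [hh, centering_mulVec]
      have hm : |(∑ v, spin x v) / n| ≤ 1 / 2 := by
        rw [abs_div, abs_of_pos hnR, div_le_iff₀ hnR]
        linarith
      have hne := hu.2
      rw [hsgn] at hne
      rw [hhu]
      set d := (∑ v, spin x v) / n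
      exact sq_div_four_le_of_sign_ne (spin_eq_or x u) hm hne
    have h1 : (E.card : ℝ) * (c ^ 2 / 4) ≤ 16 * η ^ 2 * (c ^ 2 * n) := by
      calc (E.card : ℝ) * (c ^ 2 / 4) = ∑ u ∈ E, c ^ 2 / 4 := by
            rw [Finset.sum_const, nsmul_eq_mul]
        _ ≤ ∑ u ∈ E, ((centeredAdj G ^ (2 * n)) u j' - c * h u) ^ 2 := Finset.sum_le_sum hterm
        _ ≤ ∑ u, ((centeredAdj G ^ (2 * n)) u j' - c * h u) ^ 2 :=
            Finset.sum_le_univ_sum_of_nonneg fun _ => sq_nonneg _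
        _ ≤ _ := hc.trans (by
            gcongr
            rw [hhh]
            have : 0 ≤ (∑ u, spin x u) ^ 2 / (n : ℝ) := by positivity
            linarith)
    have hc2 : 0 < c ^ 2 / 4 := by positivity
    refine le_of_mul_le_mul_right ?_ hc2
    linarith

/-! ### Repeated voting. -/

/-- The sign of the vote: `-1` if vertices join the minority of their neighbours. -/
def voteSign (r : Bool) : ℝ := if r then -1 else 1

theorem machineSpin_vote {n : ℕ} (G : SimpleGraph (Fin n)) (r : Bool) (L : ℕ → ℕ) (u : Fin n) :
    machineSpin (vote n (edge n ((inputMemory G).arr 0)) r L) u =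
      if 0 < voteSign r * ∑ v, adj G u v * machineSpin L v then 1 else -1 := by
  set e := edge n ((inputMemory G).arr 0) with he
  set X := ∑ v ∈ Finset.range n, if L v ≠ 0 then e u v else 0 with hX
  set Y := ∑ v ∈ Finset.range n, if L v ≠ 0 then 0 else e u v with hY
  have h1 : ∑ v, adj G u v * machineSpin L v = (X : ℝ) - Y := by
    rw [hX, hY]
    push_cast
    rw [sum_range_eq_sum_fin (fun v => if L v ≠ 0 then (e u v : ℝ) else 0),
      sum_range_eq_sum_fin (fun v => if L v ≠ 0 then (0 : ℝ) else e u v),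
      ← Finset.sum_sub_distrib]
    refine Finset.sum_congr rfl fun v _ => ?_
    rw [he, edge_inputMemory, machineSpin]
    split_ifs <;> ring
  have h2 : vote n e r L u = if (if r then X < Y else Y < X) then 1 else 0 := rfl
  rw [h1, machineSpin, h2]
  have h3 : (if r then X < Y else Y < X) ↔ 0 < voteSign r * ((X : ℝ) - Y) := by
    cases r
    · simp [voteSign]
    · simp [voteSign]
  simp only [h3]
  split_ifs <;> simp_all

/-- The vertices whose label is wrong. -/
def wrong {n : ℕ} (x : Fin n → Fin 2) (t : ℝ) (L : ℕ → ℕ) : Finset (Fin n) :=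
  Finset.univ.filter fun u => machineSpin L u ≠ t * spin x u

/-- One round of voting decreases the number of errors. -/
theorem card_wrong_vote_lt {n : ℕ} {pa pb p α β t : ℝ} {x : Fin n → Fin 2}
    {G : SimpleGraph (Fin n)} (hα : 0 ≤ α) (hpa : pa ≤ p) (hpb : pb ≤ p)
    (hp : 0 ≤ p) (hαβ : 4 * α < β)
    (hdisc : ∀ S T : Finset (Fin n),
      |∑ u ∈ S, ∑ v ∈ T, noise pa pb x G u v| ≤ α * √(S.card * T.card)) {r : Bool}
    (hvote : ∀ u, β ≤ voteSign r * (spin x u * ∑ v, adj G u v * spin x v)) (ht : t = 1 ∨ t = -1)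
    {L : ℕ → ℕ} (hL : 4 * (p * (wrong x t L).card) ≤ β) :
    (wrong x t (vote n (edge n ((inputMemory G).arr 0)) r L)).card ≤ (wrong x t L).card - 1 := by
  set S := wrong x t L with hS
  set S' := wrong x t (vote n (edge n ((inputMemory G).arr 0)) r L) with hS'
  -- Under the true labels the margin at `u` is at least `β`, and each wrong neighbour changes the
  -- vote by at most 2. A wrong outcome thus needs at least β/2 neighbours in `S`.
  have hmem : ∀ u ∈ S', β ≤ 2 * ∑ v ∈ S, adj G u v := by
    intro u hu
    have hu' : machineSpin (vote n (edge n ((inputMemory G).arr 0)) r L) u ≠ t * spin x u := by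
      simpa [hS', wrong] using hu
    rw [machineSpin_vote] at hu'
    have h1 : t * spin x u * (voteSign r * ∑ v, adj G u v * machineSpin L v) ≤ 0 := by
      rcases spin_eq_or x u with hs | hs <;> rcases ht with ht | ht <;> rw [hs, ht] at hu' ⊢ <;>
        split_ifs at hu' with hv
      all_goals first | (exfalso; revert hu'; norm_num; done) | linarith
    have h2 : ∀ v, machineSpin L v = t * spin x v - if v ∈ S then 2 * t * spin x v else 0 := by
      intro v
      split_ifs with hv
      · have hv' : machineSpin L v ≠ t * spin x v := by simpa [hS, wrong] using hv
        rcases machineSpin_eq_or L v with hm | hm <;> rcases spin_eq_or x v with hs | hs <;>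
          rcases ht with ht | ht <;> rw [hm, hs, ht] at hv' ⊢
        all_goals first | (exfalso; revert hv'; norm_num; done) | norm_num
      · have hv' : machineSpin L v = t * spin x v := by simpa [hS, wrong] using hv
        rw [hv', sub_zero]
    have h3 : t * spin x u * (voteSign r * ∑ v, adj G u v * machineSpin L v) =
        voteSign r * (spin x u * ∑ v, adj G u v * spin x v) -
          2 * ∑ v ∈ S, voteSign r * (spin x u * (adj G u v * spin x v)) := by
      have htt : t * t = 1 := by rcases ht with ht | ht <;> rw [ht] <;> norm_num
      simp only [Finset.mul_sum]
      rw [← Finset.sum_filter_add_sum_filter_not Finset.univ (· ∈ S),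
        ← Finset.sum_filter_add_sum_filter_not Finset.univ (· ∈ S)
          (fun v => voteSign r * (spin x u * (adj G u v * spin x v))),
        Finset.filter_mem_eq_inter, Finset.univ_inter, add_sub_right_comm,
        ← Finset.sum_sub_distrib]
      congr 1
      · refine Finset.sum_congr rfl fun v hv => ?_
        rw [h2, if_pos hv]
        linear_combination (-(spin x u * voteSign r * adj G u v * spin x v)) * htt
      · refine Finset.sum_congr rfl fun v hv => ?_
        rw [h2, if_neg (Finset.mem_filter.1 hv).2]
        linear_combination ((spin x u * voteSign r * adj G u v * spin x v)) * htt
    have h4 : ∑ v ∈ S, voteSign r * (spin x u * (adj G u v * spin x v)) ≤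
        ∑ v ∈ S, adj G u v := by
      refine Finset.sum_le_sum fun v _ => ?_
      have := adj_nonneg G u v
      rcases spin_eq_or x u with hs | hs <;> rcases spin_eq_or x v with hs' | hs' <;>
        rw [hs, hs'] <;> cases r <;> simp only [voteSign] <;> norm_num <;> linarith
    have h5 := hvote u
    linarith
  have hsum : β * S'.card ≤ 2 * ∑ u ∈ S', ∑ v ∈ S, adj G u v := by
    rw [Finset.mul_sum]
    calc β * S'.card = ∑ u ∈ S', β := by rw [Finset.sum_const, nsmul_eq_mul, mul_comm]
      _ ≤ _ := Finset.sum_le_sum hmem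
  have hupper : ∑ u ∈ S', ∑ v ∈ S, adj G u v ≤
      α * √(S'.card * S.card) + p * S.card * S'.card := by
    have h1 : ∑ u ∈ S', ∑ v ∈ S, adj G u v ≤ ∑ u ∈ S', ∑ v ∈ S, (noise pa pb x G u v + p) := by
      refine Finset.sum_le_sum fun u _ => Finset.sum_le_sum fun v _ => ?_
      unfold noise
      split_ifs with h
      · simp [adj, h, hp]
      · have : prob pa pb x u v ≤ p := by unfold prob; split_ifs <;> assumption
        linarith
    simp only [Finset.sum_add_distrib, Finset.sum_const, nsmul_eq_mul] at h1
    have h2 := (abs_le.1 (hdisc S' S)).2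
    linarith
  -- If `S'` is nonempty and at least as large as `S`, counting the edges between them gives β|S'| ≤
  -- 2α|S'| + 2p|S||S'| ≤ (2α + β/2)|S'|, against 4α < β. The truncated `- 1` also covers an empty
  -- `S`.
  by_contra hcon
  have hS'0 : 0 < S'.card := by omega
  have hle : S.card ≤ S'.card := by omega
  have hS'R : (0 : ℝ) < S'.card := by exact_mod_cast hS'0
  have hsqrt : √(S'.card * S.card : ℝ) ≤ S'.card := by
    refine Real.sqrt_le_iff.2 ⟨hS'R.le, ?_⟩
    have : (S.card : ℝ) ≤ S'.card := by exact_mod_cast hle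
    rw [sq]
    gcongr
  have h1 : α * √(S'.card * S.card) ≤ α * S'.card := by gcongr
  have h2 := mul_le_mul_of_nonneg_right hL hS'R.le
  have h3 := mul_lt_mul_of_pos_right hαβ hS'R
  linarith

/-- Every round removes at least one of the at most `n` errors. There are `2 * n` rounds because
each turn of the program votes twice, back and forth between two arrays. -/
theorem wrong_iterate_vote_eq_empty {n : ℕ} {pa pb p α β t : ℝ} {x : Fin n → Fin 2}
    {G : SimpleGraph (Fin n)} (hα : 0 ≤ α) (hpa : pa ≤ p) (hpb : pb ≤ p)
    (hp : 0 ≤ p) (hαβ : 4 * α < β)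
    (hdisc : ∀ S T : Finset (Fin n),
      |∑ u ∈ S, ∑ v ∈ T, noise pa pb x G u v| ≤ α * √(S.card * T.card)) {r : Bool}
    (hvote : ∀ u, β ≤ voteSign r * (spin x u * ∑ v, adj G u v * spin x v)) (ht : t = 1 ∨ t = -1)
    {L : ℕ → ℕ} (hL : 4 * (p * (wrong x t L).card) ≤ β) :
    wrong x t ((vote n (edge n ((inputMemory G).arr 0)) r)^[2 * n] L) = ∅ := by
  have key : ∀ k, (wrong x t ((vote n (edge n ((inputMemory G).arr 0)) r)^[k] L)).card ≤
      (wrong x t L).card - k := by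
    intro k
    induction k with
    | zero => simp
    | succ k ih =>
      rw [Function.iterate_succ_apply']
      have h1 := card_wrong_vote_lt hα hpa hpb hp hαβ hdisc hvote ht
        (L := (vote n (edge n ((inputMemory G).arr 0)) r)^[k] L) (by
          have h2 : ((wrong x t ((vote n (edge n ((inputMemory G).arr 0)) r)^[k] L)).card : ℝ) ≤
            (wrong x t L).card := by exact_mod_cast ih.trans (Nat.sub_le _ _)
          linarith [mul_le_mul_of_nonneg_left h2 hp])
      omega
  have h1 := key (2 * n)
  have h2 : (wrong x t L).card ≤ n := (Finset.card_le_univ _).trans (by simp)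
  exact Finset.card_eq_zero.1 (by omega)

/-- The deterministic guarantee of the algorithm. -/
theorem machineSpin_iterate_vote_eq {n : ℕ} (hn : 0 < n) {pa pb p α β Δ η : ℝ} {g : ℕ}
    {x : Fin n → Fin 2} {G : SimpleGraph (Fin n)} (hα : 0 ≤ α) (hpa0 : 0 ≤ pa) (hpa : pa ≤ p)
    (hpb : pb ≤ p) (hab : pa ≠ pb) (hαβ : 4 * α < β)
    (hdisc : ∀ S T : Finset (Fin n),
      |∑ u ∈ S, ∑ v ∈ T, noise pa pb x G u v| ≤ α * √(S.card * T.card))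
    (hrow : ∀ u, ∑ v, |noise pa pb x G u v| ≤ Δ)
    (hbal : |∑ u, spin x u| ≤ n / 2) {r : Bool}
    (hvote : ∀ u, β ≤ voteSign r * (spin x u * ∑ v, adj G u v * spin x v))
    (hpM : pa ≤ α * (2 * g + 1) + 2 * Δ * (1 / 2) ^ g) (hη0 : 0 < η) (hη : η ≤ 1 / 2)
    (hM : 16 * (α * (2 * g + 1) + 2 * Δ * (1 / 2) ^ g) ≤ η * (|pa - pb| * n))
    (hηβ : 256 * η ^ 2 * (p * n) ≤ β) {L : ℕ → ℕ}
    (hL : IsBestLabel n (edge n ((inputMemory G).arr 0)) L) :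
    ∃ t : ℝ, (t = 1 ∨ t = -1) ∧ ∀ u,
      machineSpin ((vote n (edge n ((inputMemory G).arr 0)) r)^[2 * n] L) u = t * spin x u := by
  have hform := abs_form_le hα hdisc (noise_symm pa pb x G) hrow g
  have hp : 0 ≤ p := hpa0.trans hpa
  obtain ⟨t, ht, hcard⟩ := card_error_le_of_isBestLabel hn hpa0 hpM
    (sum_sq_mulVec_le (hpa0.trans hpM) hform) hab hη0 hη hM hbal hL
  refine ⟨t, ht, fun u => ?_⟩
  have h := wrong_iterate_vote_eq_empty hα hpa hpb hp hαβ hdisc hvote ht (L := L) (by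
    have : p * ((wrong x t L).card : ℝ) ≤ p * (64 * η ^ 2 * n) := by gcongr; exact hcard
    linarith)
  by_contra hne
  have hu : u ∈ wrong x t ((vote n (edge n ((inputMemory G).arr 0)) r)^[2 * n] L) := by
    simpa [wrong] using hne
  rw [h] at hu
  exact absurd hu (Finset.notMem_empty u)

/-! ### The random graph with independent edges: means, union bounds and exponential moments. -/

open scoped Classical in
/-- The pairs `u < v`. -/
def pairs (n : ℕ) : Finset (Fin n × Fin n) := Finset.univ.filter fun e => e.1 < e.2

open scoped Classical in
/-- The probability of a graph under edge probabilities `q`. -/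
def graphWeight {n : ℕ} (q : Fin n → Fin n → ℝ) (G : SimpleGraph (Fin n)) : ℝ :=
  ∏ e ∈ pairs n, if G.Adj e.1 e.2 then q e.1 e.2 else 1 - q e.1 e.2

/-- The expectation of a function of the random graph. -/
def graphMean {n : ℕ} (q : Fin n → Fin n → ℝ) (F : SimpleGraph (Fin n) → ℝ) : ℝ :=
  ∑ G, graphWeight q G * F G

open scoped Classical in
/-- The probability of an event for the random graph. -/
def graphProb {n : ℕ} (q : Fin n → Fin n → ℝ) (E : SimpleGraph (Fin n) → Prop) : ℝ :=
  graphMean q fun G => if E G then 1 else 0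

section Basic

variable {n : ℕ} {q : Fin n → Fin n → ℝ}

-- Independence of the edges in computational form: the mean of a product over pairs factorizes.
-- Exponential moments and probabilities of neighbourhoods are all reduced to this identity.
open scoped Classical in
theorem graphMean_prod (q : Fin n → Fin n → ℝ) (f g : Fin n × Fin n → ℝ) :
    graphMean q (fun G => ∏ e ∈ pairs n, if G.Adj e.1 e.2 then f e else g e) =
      ∏ e ∈ pairs n, (q e.1 e.2 * f e + (1 - q e.1 e.2) * g e) := by
  let F : {e : Fin n × Fin n // e.1 < e.2} → Bool → ℝ := fun e c =>
    if c = true then q e.1.1 e.1.2 * f e.1 else (1 - q e.1.1 e.1.2) * g e.1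
  have h := Finset.prod_univ_sum (fun _ : {e : Fin n × Fin n // e.1 < e.2} =>
    (Finset.univ : Finset Bool)) F
  rw [Fintype.piFinset_univ] at h
  have hR : ∏ e ∈ pairs n, (q e.1 e.2 * f e + (1 - q e.1 e.2) * g e) =
      ∏ e : {e : Fin n × Fin n // e.1 < e.2}, ∑ c, F e c := by
    rw [Finset.prod_subtype (pairs n) (p := fun e => e.1 < e.2) (by simp [pairs])]
    exact Finset.prod_congr rfl fun e _ => by simp [F]
  rw [hR, h, graphMean, ← Equiv.sum_comp (graphEquiv n)]
  refine Finset.sum_congr rfl fun G _ => ?_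
  rw [graphWeight, ← Finset.prod_mul_distrib,
    Finset.prod_subtype (pairs n) (p := fun e => e.1 < e.2) (by simp [pairs])]
  refine Finset.prod_congr rfl fun e _ => ?_
  simp only [F, graphEquiv, Equiv.coe_fn_mk, decide_eq_true_eq]
  split_ifs <;> rfl

theorem graphMean_one (q : Fin n → Fin n → ℝ) : graphMean q (fun _ => 1) = 1 := by
  have h := graphMean_prod q (fun _ => 1) (fun _ => 1)
  simpa using h

theorem graphWeight_nonneg (h0 : ∀ u v, 0 ≤ q u v) (h1 : ∀ u v, q u v ≤ 1)
    (G : SimpleGraph (Fin n)) : 0 ≤ graphWeight q G := by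
  refine Finset.prod_nonneg fun e _ => ?_
  split_ifs
  · exact h0 _ _
  · linarith [h1 e.1 e.2]

theorem graphMean_mono (h0 : ∀ u v, 0 ≤ q u v) (h1 : ∀ u v, q u v ≤ 1)
    {F F' : SimpleGraph (Fin n) → ℝ} (h : ∀ G, F G ≤ F' G) : graphMean q F ≤ graphMean q F' :=
  Finset.sum_le_sum fun G _ => mul_le_mul_of_nonneg_left (h G) (graphWeight_nonneg h0 h1 G)

theorem graphProb_le_graphMean (h0 : ∀ u v, 0 ≤ q u v) (h1 : ∀ u v, q u v ≤ 1)
    {E : SimpleGraph (Fin n) → Prop} {F : SimpleGraph (Fin n) → ℝ} (hF : ∀ G, 0 ≤ F G)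
    (h : ∀ G, E G → 1 ≤ F G) : graphProb q E ≤ graphMean q F := by
  refine graphMean_mono h0 h1 fun G => ?_
  split_ifs with hG
  · exact h G hG
  · exact hF G

theorem graphProb_mono (h0 : ∀ u v, 0 ≤ q u v) (h1 : ∀ u v, q u v ≤ 1)
    {E E' : SimpleGraph (Fin n) → Prop} (h : ∀ G, E G → E' G) :
    graphProb q E ≤ graphProb q E' := by
  refine graphProb_le_graphMean h0 h1 (fun G => ?_) fun G hG => ?_
  · split_ifs <;> norm_num
  · rw [if_pos (h G hG)]

theorem graphProb_nonneg (h0 : ∀ u v, 0 ≤ q u v) (h1 : ∀ u v, q u v ≤ 1)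
    (E : SimpleGraph (Fin n) → Prop) : 0 ≤ graphProb q E :=
  Finset.sum_nonneg fun G _ => mul_nonneg (graphWeight_nonneg h0 h1 G) (by
    dsimp only; split_ifs <;> norm_num)

theorem graphMean_sum {ι : Type*} (s : Finset ι) (F : ι → SimpleGraph (Fin n) → ℝ) :
    graphMean q (fun G => ∑ i ∈ s, F i G) = ∑ i ∈ s, graphMean q (F i) := by
  simp only [graphMean, Finset.mul_sum]
  exact Finset.sum_comm

theorem graphMean_const_mul (c : ℝ) (F : SimpleGraph (Fin n) → ℝ) :
    graphMean q (fun G => c * F G) = c * graphMean q F := by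
  simp only [graphMean, Finset.mul_sum]
  exact Finset.sum_congr rfl fun G _ => by ring

theorem graphProb_exists_le {ι : Type*} (h0 : ∀ u v, 0 ≤ q u v) (h1 : ∀ u v, q u v ≤ 1)
    (s : Finset ι) (E : ι → SimpleGraph (Fin n) → Prop) :
    graphProb q (fun G => ∃ i ∈ s, E i G) ≤ ∑ i ∈ s, graphProb q (E i) := by
  classical
  unfold graphProb
  rw [← graphMean_sum]
  refine graphMean_mono h0 h1 fun G => ?_
  have hnn : ∀ i ∈ s, (0 : ℝ) ≤ if E i G then 1 else 0 := fun i _ => by split_ifs <;> norm_num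
  split_ifs with h
  · obtain ⟨i, hi, hE⟩ := h
    refine le_trans (le_of_eq ?_)
      (Finset.single_le_sum (f := fun i => if E i G then (1 : ℝ) else 0) hnn hi)
    simp [hE]
  · exact Finset.sum_nonneg hnn

theorem graphProb_or_le (h0 : ∀ u v, 0 ≤ q u v) (h1 : ∀ u v, q u v ≤ 1)
    (E E' : SimpleGraph (Fin n) → Prop) :
    graphProb q (fun G => E G ∨ E' G) ≤ graphProb q E + graphProb q E' := by
  unfold graphProb graphMean
  rw [← Finset.sum_add_distrib]
  refine Finset.sum_le_sum fun G _ => ?_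
  rw [← mul_add]
  refine mul_le_mul_of_nonneg_left ?_ (graphWeight_nonneg h0 h1 G)
  by_cases h : E G <;> by_cases h' : E' G <;> simp [h, h']

theorem sum_sum_eq_sum_pairs (f : Fin n → Fin n → ℝ) (hf : ∀ u, f u u = 0) :
    ∑ u, ∑ v, f u v = ∑ e ∈ pairs n, (f e.1 e.2 + f e.2 e.1) := by
  classical
  have h1 : ∑ e ∈ pairs n, f e.1 e.2 = ∑ u, ∑ v, if u < v then f u v else 0 := by
    rw [← Finset.sum_product', pairs, Finset.sum_filter]
    rfl
  have h2 : ∑ e ∈ pairs n, f e.2 e.1 = ∑ u, ∑ v, if v < u then f u v else 0 := by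
    rw [Finset.sum_comm, ← Finset.sum_product', pairs, Finset.sum_filter]
    rfl
  rw [Finset.sum_add_distrib, h1, h2]
  simp only [← Finset.sum_add_distrib]
  refine Finset.sum_congr rfl fun u _ => Finset.sum_congr rfl fun v _ => ?_
  rcases lt_trichotomy u v with h | h | h
  · simp [h, h.not_gt]
  · subst h; simp [hf]
  · simp [h, h.not_gt]

/-- The moment generating function of a linear function of the adjacency matrix. -/
theorem graphMean_exp_le (h0 : ∀ u v, 0 ≤ q u v) (h1 : ∀ u v, q u v ≤ 1)
    (θ : Fin n → Fin n → ℝ) :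
    graphMean q (fun G => Real.exp (∑ u, ∑ v, θ u v * adj G u v)) ≤
      Real.exp (∑ e ∈ pairs n, q e.1 e.2 * (Real.exp (θ e.1 e.2 + θ e.2 e.1) - 1)) := by
  classical
  have h : ∀ G : SimpleGraph (Fin n), Real.exp (∑ u, ∑ v, θ u v * adj G u v) =
      ∏ e ∈ pairs n, if G.Adj e.1 e.2 then Real.exp (θ e.1 e.2 + θ e.2 e.1) else 1 := by
    intro G
    rw [sum_sum_eq_sum_pairs _ (fun u => by simp [adj]), Real.exp_sum]
    refine Finset.prod_congr rfl fun e _ => ?_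
    rw [adj_symm G e.2 e.1, adj]
    split_ifs <;> simp
  simp only [h]
  have hm := graphMean_prod q (fun e => Real.exp (θ e.1 e.2 + θ e.2 e.1)) fun _ => 1
  rw [Real.exp_sum]
  rw [hm]
  refine Finset.prod_le_prod (fun e _ => ?_) fun e _ => ?_
  · have := h1 e.1 e.2
    have := mul_nonneg (h0 e.1 e.2) (Real.exp_nonneg (θ e.1 e.2 + θ e.2 e.1))
    linarith
  · have := Real.add_one_le_exp (q e.1 e.2 * (Real.exp (θ e.1 e.2 + θ e.2 e.1) - 1))
    linarith

/-- The moment generating function of a linear function of the edges at `v`. -/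
theorem graphMean_exp_star_le (h0 : ∀ u v, 0 ≤ q u v) (h1 : ∀ u v, q u v ≤ 1)
    (hq : ∀ u v, q u v = q v u) (v : Fin n) (θ : Fin n → ℝ) :
    graphMean q (fun G => Real.exp (∑ w, θ w * adj G v w)) ≤
      Real.exp (∑ w, q v w * (Real.exp (θ w) - 1) - q v v * (Real.exp (θ v) - 1)) := by
  classical
  have h := graphMean_exp_le h0 h1 fun u w => if u = v then θ w else 0
  have e1 : ∀ G : SimpleGraph (Fin n), ∑ u, ∑ w, (if u = v then θ w else 0) * adj G u w =
      ∑ w, θ w * adj G v w := by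
    intro G
    rw [Finset.sum_eq_single v (fun u _ hu => by simp [hu]) (by simp)]
    simp
  simp only [e1] at h
  refine h.trans (le_of_eq ?_)
  congr 1
  have e2 := sum_sum_eq_sum_pairs (n := n)
    (fun u w => if u = v ∧ w ≠ v then q u w * (Real.exp (θ w) - 1) else 0) (by simp)
  have e3 : ∑ u, ∑ w, (if u = v ∧ w ≠ v then q u w * (Real.exp (θ w) - 1) else 0) =
      ∑ w, q v w * (Real.exp (θ w) - 1) - q v v * (Real.exp (θ v) - 1) := by
    rw [Finset.sum_eq_single v (fun u _ hu => by simp [hu]) (by simp),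
      ← Finset.add_sum_erase Finset.univ (fun w => q v w * (Real.exp (θ w) - 1))
        (Finset.mem_univ v), add_sub_cancel_left,
      ← Finset.add_sum_erase Finset.univ _ (Finset.mem_univ v)]
    simp only [ne_eq, not_true_eq_false, and_false, if_false, zero_add, true_and]
    exact Finset.sum_congr rfl fun w hw => by rw [if_pos (Finset.ne_of_mem_erase hw)]
  rw [← e3, e2]
  refine Finset.sum_congr rfl fun e he => ?_
  have hlt : e.1 < e.2 := by simpa [pairs] using he
  by_cases h1 : e.1 = v
  · have h2 : e.2 ≠ v := fun h => by rw [h1, h] at hlt; exact lt_irrefl _ hlt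
    simp [h1, h2]
  · by_cases h2 : e.2 = v
    · simp [h1, h2, hq v]
    · simp [h1, h2]

end Basic

/-! ### Chernoff bounds for degrees, noise and votes. -/

section Tail

variable {n : ℕ} {pa pb p : ℝ} {x : Fin n → Fin 2}

theorem prob_symm (pa pb : ℝ) (x : Fin n → Fin 2) (u v : Fin n) :
    prob pa pb x u v = prob pa pb x v u := by simp only [prob, eq_comm]

theorem prob_nonneg (ha : 0 ≤ pa) (hb : 0 ≤ pb) (u v : Fin n) : 0 ≤ prob pa pb x u v := by
  unfold prob; split_ifs <;> assumption

theorem prob_le (ha : pa ≤ p) (hb : pb ≤ p) (u v : Fin n) : prob pa pb x u v ≤ p := by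
  unfold prob; split_ifs <;> assumption

/-- Markov's inequality for the exponential of the degree with parameter 1, where e - 1 ≤ 2, and a
union bound over the vertices. -/
theorem graphProb_degree_le (ha0 : 0 ≤ pa) (hb0 : 0 ≤ pb) (ha : pa ≤ p) (hb : pb ≤ p)
    (hp : p ≤ 1) (D : ℝ) :
    graphProb (prob pa pb x) (fun G => ∃ u ∈ Finset.univ, D < ∑ w, adj G u w) ≤
      n * Real.exp (2 * (n * p) - D) := by
  have h0 := prob_nonneg (x := x) ha0 hb0
  have h1 : ∀ u v, prob pa pb x u v ≤ 1 := fun u v => (prob_le ha hb u v).trans hp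
  refine (graphProb_exists_le h0 h1 Finset.univ fun u G => D < ∑ w, adj G u w).trans ?_
  have h : ∀ u ∈ (Finset.univ : Finset (Fin n)),
      graphProb (prob pa pb x) (fun G => D < ∑ w, adj G u w) ≤ Real.exp (2 * (n * p) - D) := by
    intro u _
    refine (graphProb_le_graphMean h0 h1
      (F := fun G => Real.exp (-D) * Real.exp (∑ w, 1 * adj G u w))
      (fun G => by positivity) fun G hG => ?_).trans ?_
    · rw [← Real.exp_add]
      refine Real.one_le_exp ?_
      simp only [one_mul]
      linarith
    · rw [graphMean_const_mul, sub_eq_neg_add, Real.exp_add]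
      refine mul_le_mul_of_nonneg_left ((graphMean_exp_star_le h0 h1 (prob_symm pa pb x) u
        fun _ => 1).trans (Real.exp_le_exp.2 ?_)) (Real.exp_nonneg _)
      have he : Real.exp 1 - 1 ≤ 2 := by linarith [Real.exp_one_lt_d9]
      have he0 : 0 ≤ Real.exp 1 - 1 := by linarith [Real.exp_one_gt_d9]
      have h2 : ∑ w, prob pa pb x u w * (Real.exp 1 - 1) ≤ ∑ w : Fin n, p * 2 :=
        Finset.sum_le_sum fun w _ => mul_le_mul (prob_le ha hb u w) he he0
          ((h0 u w).trans (prob_le ha hb u w))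
      rw [Finset.sum_const, Finset.card_univ, Fintype.card_fin, nsmul_eq_mul] at h2
      have h3 := mul_nonneg (h0 u u) he0
      linarith
  refine (Finset.sum_le_sum h).trans (le_of_eq ?_)
  rw [Finset.sum_const, Finset.card_univ, Fintype.card_fin, nsmul_eq_mul]

theorem sum_abs_noise_le (ha0 : 0 ≤ pa) (hb0 : 0 ≤ pb) (ha : pa ≤ p) (hb : pb ≤ p)
    (G : SimpleGraph (Fin n)) (u : Fin n) :
    ∑ v, |noise pa pb x G u v| ≤ ∑ v, adj G u v + n * p := by
  have h : ∀ v, |noise pa pb x G u v| ≤ adj G u v + p := by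
    intro v
    have h1 := prob_nonneg (x := x) ha0 hb0 u v
    have h2 := prob_le (x := x) ha hb u v
    have h3 := adj_nonneg G u v
    unfold noise
    split_ifs
    · rw [abs_zero]; linarith
    · rw [abs_le]; constructor <;> linarith
  refine (Finset.sum_le_sum fun v _ => h v).trans (le_of_eq ?_)
  rw [Finset.sum_add_distrib, Finset.sum_const, Finset.card_univ, Fintype.card_fin, nsmul_eq_mul]

/-- Centring cancels the linear term, so only exp t - 1 - t remains for each pair. A pair inside S ∩
T is counted twice, which is why `t` ranges up to 2|l|. -/
theorem graphMean_exp_noise_le (ha0 : 0 ≤ pa) (hb0 : 0 ≤ pb) (ha : pa ≤ p) (hb : pb ≤ p)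
    (hp : p ≤ 1) (S T : Finset (Fin n)) {l Γ : ℝ}
    (hΓ : ∀ t : ℝ, |t| ≤ 2 * |l| → Real.exp t - 1 - t ≤ Γ) :
    graphMean (prob pa pb x)
      (fun G => Real.exp (l * ∑ u ∈ S, ∑ v ∈ T, noise pa pb x G u v)) ≤
      Real.exp (Γ * (p * (S.card * T.card))) := by
  classical
  have h0 := prob_nonneg (x := x) ha0 hb0
  have h1 : ∀ u v, prob pa pb x u v ≤ 1 := fun u v => (prob_le ha hb u v).trans hp
  have hΓ0 : 0 ≤ Γ := by simpa using hΓ 0 (by simp)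
  let c : Fin n → Fin n → ℝ := fun u v => if u ∈ S ∧ v ∈ T then 1 else 0
  have hc : ∀ f : Fin n → Fin n → ℝ, ∑ u ∈ S, ∑ v ∈ T, f u v = ∑ u, ∑ v, c u v * f u v := by
    intro f
    rw [← Finset.sum_subset (Finset.subset_univ S)]
    · refine Finset.sum_congr rfl fun u hu => ?_
      rw [← Finset.sum_subset (Finset.subset_univ T)]
      · exact Finset.sum_congr rfl fun v hv => by simp [c, hu, hv]
      · intro v _ hv; simp [c, hv]
    · intro u _ hu; simp [c, hu]
  let K : ℝ := ∑ e ∈ pairs n, l * (c e.1 e.2 + c e.2 e.1) * prob pa pb x e.1 e.2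
  have hsplit : ∀ G : SimpleGraph (Fin n), l * ∑ u ∈ S, ∑ v ∈ T, noise pa pb x G u v =
      -K + ∑ u, ∑ v, (l * c u v) * adj G u v := by
    intro G
    rw [hc fun u v => noise pa pb x G u v, sum_sum_eq_sum_pairs _ (fun u => by simp [noise]),
      sum_sum_eq_sum_pairs _ (fun u => by simp [adj]), Finset.mul_sum, ← Finset.sum_neg_distrib,
      ← Finset.sum_add_distrib]
    refine Finset.sum_congr rfl fun e he => ?_
    have hlt : e.1 < e.2 := by simpa [pairs] using he
    rw [noise_symm pa pb x G e.2 e.1, adj_symm G e.2 e.1, noise, if_neg hlt.ne]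
    ring
  simp only [hsplit, Real.exp_add]
  rw [graphMean_const_mul]
  refine (mul_le_mul_of_nonneg_left (graphMean_exp_le h0 h1 _) (Real.exp_nonneg _)).trans ?_
  rw [← Real.exp_add, ← Finset.sum_neg_distrib, ← Finset.sum_add_distrib]
  refine Real.exp_le_exp.2 ?_
  have hst : ∑ e ∈ pairs n, (c e.1 e.2 + c e.2 e.1) ≤ S.card * T.card := by
    have h2 := sum_sum_eq_sum_pairs (n := n) (fun u v => if u = v then 0 else c u v) (by simp)
    have h3 : ∑ e ∈ pairs n, (c e.1 e.2 + c e.2 e.1) =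
        ∑ u, ∑ v, (if u = v then 0 else c u v) := by
      rw [h2]
      refine Finset.sum_congr rfl fun e he => ?_
      have hlt : e.1 < e.2 := by simpa [pairs] using he
      rw [if_neg hlt.ne, if_neg hlt.ne']
    rw [h3]
    have h4 := hc fun _ _ => 1
    simp only [Finset.sum_const, nsmul_eq_mul, mul_one] at h4
    rw [h4]
    refine Finset.sum_le_sum fun u _ => Finset.sum_le_sum fun v _ => ?_
    split_ifs
    · simp only [c]; split_ifs <;> norm_num
    · exact le_rfl
  calc _ ≤ ∑ e ∈ pairs n, Γ * p * (c e.1 e.2 + c e.2 e.1) := by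
        refine Finset.sum_le_sum fun e _ => ?_
        have hp0 := h0 e.1 e.2
        have hpp := prob_le (x := x) ha hb e.1 e.2
        have hcc : c e.1 e.2 + c e.2 e.1 = 0 ∨
            (1 ≤ c e.1 e.2 + c e.2 e.1 ∧ c e.1 e.2 + c e.2 e.1 ≤ 2) := by
          simp only [c]; split_ifs <;> norm_num
        set k := c e.1 e.2 + c e.2 e.1 with hk
        have hlk : l * c e.1 e.2 + l * c e.2 e.1 = l * k := by rw [hk]; ring
        rw [hlk]
        rcases hcc with h | ⟨h, h'⟩
        · simp [h]
        · have h2 : Real.exp (l * k) - 1 - l * k ≤ Γ := by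
            refine hΓ _ ?_
            rw [abs_mul, abs_of_nonneg (by linarith : (0 : ℝ) ≤ k), mul_comm]
            exact mul_le_mul_of_nonneg_right h' (abs_nonneg _)
          calc -(l * k * prob pa pb x e.1 e.2) + prob pa pb x e.1 e.2 * (Real.exp (l * k) - 1)
              = prob pa pb x e.1 e.2 * (Real.exp (l * k) - 1 - l * k) := by ring
            _ ≤ prob pa pb x e.1 e.2 * Γ := by gcongr
            _ ≤ p * Γ := by gcongr
            _ ≤ Γ * p * k := by
              have : 0 ≤ Γ * p := mul_nonneg hΓ0 (hp0.trans hpp)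
              nlinarith
    _ = Γ * p * ∑ e ∈ pairs n, (c e.1 e.2 + c e.2 e.1) := by rw [Finset.mul_sum]
    _ ≤ Γ * p * (S.card * T.card) := by
        exact mul_le_mul_of_nonneg_left hst (mul_nonneg hΓ0 (ha0.trans ha))
    _ = _ := by ring

theorem graphProb_discrepancy_le (ha0 : 0 ≤ pa) (hb0 : 0 ≤ pb) (ha : pa ≤ p) (hb : pb ≤ p)
    (hp : p ≤ 1) (S T : Finset (Fin n)) {l Γ : ℝ} (hl : 0 ≤ l)
    (hΓ : ∀ t : ℝ, |t| ≤ 2 * l → Real.exp t - 1 - t ≤ Γ) (D : ℝ) :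
    graphProb (prob pa pb x) (fun G => D < |∑ u ∈ S, ∑ v ∈ T, noise pa pb x G u v|) ≤
      2 * Real.exp (Γ * (p * (S.card * T.card)) - l * D) := by
  have h0 := prob_nonneg (x := x) ha0 hb0
  have h1 : ∀ u v, prob pa pb x u v ≤ 1 := fun u v => (prob_le ha hb u v).trans hp
  have key : ∀ s : ℝ, |s| = 1 → graphProb (prob pa pb x)
      (fun G => D < s * ∑ u ∈ S, ∑ v ∈ T, noise pa pb x G u v) ≤
      Real.exp (Γ * (p * (S.card * T.card)) - l * D) := by
    intro s hs
    refine (graphProb_le_graphMean h0 h1 (F := fun G => Real.exp (-(l * D)) *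
      Real.exp ((l * s) * ∑ u ∈ S, ∑ v ∈ T, noise pa pb x G u v))
      (fun G => by positivity) fun G hG => ?_).trans ?_
    · rw [← Real.exp_add]
      refine Real.one_le_exp ?_
      have := mul_le_mul_of_nonneg_left hG.le hl
      rw [mul_assoc]
      linarith
    · rw [graphMean_const_mul, sub_eq_neg_add, Real.exp_add]
      refine mul_le_mul_of_nonneg_left (graphMean_exp_noise_le ha0 hb0 ha hb hp S T ?_)
        (Real.exp_nonneg _)
      rwa [abs_mul, hs, mul_one, abs_of_nonneg hl]
  have h2 := (graphProb_mono h0 h1 (E := fun G =>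
      D < |∑ u ∈ S, ∑ v ∈ T, noise pa pb x G u v|)
      (E' := fun G => (D < 1 * ∑ u ∈ S, ∑ v ∈ T, noise pa pb x G u v) ∨
        (D < -1 * ∑ u ∈ S, ∑ v ∈ T, noise pa pb x G u v)) fun G hG => by
        rcases lt_abs.1 hG with h | h
        · left; linarith
        · right; linarith).trans (graphProb_or_le h0 h1 _ _)
  have h3 := key 1 (by simp)
  have h4 := key (-1) (by simp)
  linarith

/-- `X` and `Y` bound the logarithmic moment of a pair within and across the communities. The
community sizes enter through the imbalance of the spins, and the final `- X` removes the pair of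
`v` with itself. -/
theorem graphProb_vote_le (ha0 : 0 ≤ pa) (hb0 : 0 ≤ pb) (ha : pa ≤ 1) (hb : pb ≤ 1)
    {r : Bool} {τ β X Y : ℝ} (hτ : 0 ≤ τ) (hX : X = pa * (Real.exp (-(τ * voteSign r)) - 1))
    (hY : Y = pb * (Real.exp (τ * voteSign r) - 1)) (v : Fin n) :
    graphProb (prob pa pb x)
      (fun G => voteSign r * (spin x v * ∑ w, adj G v w * spin x w) < β) ≤
      Real.exp (τ * β + n * (X + Y) / 2 + (spin x v * ∑ w, spin x w) * ((X - Y) / 2) - X) := by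
  have h0 := prob_nonneg (x := x) ha0 hb0
  have h1 : ∀ u v, prob pa pb x u v ≤ 1 := prob_le ha hb
  refine (graphProb_le_graphMean h0 h1 (F := fun G => Real.exp (τ * β) *
      Real.exp (∑ w, (-(τ * voteSign r) * (spin x v * spin x w)) * adj G v w))
      (fun G => by positivity) fun G hG => ?_).trans ?_
  · rw [← Real.exp_add]
    refine Real.one_le_exp ?_
    have h2 : ∑ w, (-(τ * voteSign r) * (spin x v * spin x w)) * adj G v w =
        -(τ * (voteSign r * (spin x v * ∑ w, adj G v w * spin x w))) := by
      simp only [Finset.mul_sum, ← Finset.sum_neg_distrib]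
      exact Finset.sum_congr rfl fun w _ => by ring
    rw [h2]
    have := mul_le_mul_of_nonneg_left hG.le hτ
    linarith
  · rw [graphMean_const_mul, add_assoc, add_sub_assoc, Real.exp_add]
    refine mul_le_mul_of_nonneg_left ((graphMean_exp_star_le h0 h1 (prob_symm pa pb x) v
      _).trans (Real.exp_le_exp.2 (le_of_eq ?_))) (Real.exp_nonneg _)
    have h2 : ∀ w, prob pa pb x v w * (Real.exp (-(τ * voteSign r) * (spin x v * spin x w)) - 1) =
        (X + Y) / 2 + (X - Y) / 2 * (spin x v * spin x w) := by
      intro w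
      have h3 : prob pa pb x v w = if spin x v * spin x w = 1 then pa else pb := by
        rw [prob_eq_spin]
        rcases spin_eq_or x v with h | h <;> rcases spin_eq_or x w with h' | h' <;> rw [h, h'] <;>
          norm_num <;> ring
      rcases spin_eq_or x v with h | h <;> rcases spin_eq_or x w with h' | h' <;>
        rw [h3, h, h', hX, hY] <;> norm_num <;> ring
    rw [Finset.sum_congr rfl fun w _ => h2 w, h2, spin_mul_self, Finset.sum_add_distrib,
      Finset.sum_const, Finset.card_univ, Fintype.card_fin, nsmul_eq_mul, ← Finset.mul_sum,
      ← Finset.mul_sum]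
    ring

end Tail

/-! ### Discrepancy of the noise, uniformly over pairs of sets. -/

theorem exp_sub_one_sub_le {t b : ℝ} (h : |t| ≤ b) : Real.exp t - 1 - t ≤ Real.exp b + b := by
  have h1 := (abs_le.1 h).1
  have h2 : Real.exp t ≤ Real.exp b := Real.exp_le_exp.2 (abs_le.1 h).2
  linarith

theorem exp_sub_one_sub_le_sq {t b : ℝ} (h : |t| ≤ b) (hb : b ≤ 1) :
    Real.exp t - 1 - t ≤ b ^ 2 := by
  have h1 := Real.abs_exp_sub_one_sub_id_le (h.trans hb)
  have h2 : t ^ 2 ≤ b ^ 2 := by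
    rw [← sq_abs t]
    exact pow_le_pow_left₀ (abs_nonneg _) h 2
  exact (le_abs_self _).trans (h1.trans h2)

/-- Large deviations of the noise on a pair of sets of comparable size. -/
theorem exists_rate_discrepancy {P K ε : ℝ} (hP : 0 < P) (hK : 0 < K) (hε : 0 < ε) :
    ∃ ρ : ℝ, 0 < ρ ∧ ∀ (n : ℕ) (c pa pb : ℝ) (x : Fin n → Fin 2) (S T : Finset (Fin n)),
      0 < n → 0 ≤ c → 0 ≤ pa → 0 ≤ pb → pa ≤ P * c / n → pb ≤ P * c / n → P * c / n ≤ 1 →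
      ε ^ 2 * T.card ≤ K ^ 2 * S.card → ε ^ 2 * S.card ≤ K ^ 2 * T.card →
      graphProb (prob pa pb x) (fun G => ε * c * √(S.card * T.card) <
        |∑ u ∈ S, ∑ v ∈ T, noise pa pb x G u v|) ≤
        2 * (Real.exp (-(2 * c)) ^ S.card * Real.exp (-(2 * c)) ^ T.card) +
          2 * Real.exp (-(ρ * c * n)) := by
  -- For small sets the linear gain is 8K/ε · cz with z = √(|S||T|), and `y` is chosen so that the
  -- quadratic loss is at most half of it. What is left is at least 2c(|S| + |T|), because |S| and
  -- |T| are at most Kz/ε.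
  set l₁ := 8 * K / ε ^ 2 with hl₁
  have hl₁0 : 0 < l₁ := by positivity
  set Γ₁ := Real.exp (2 * l₁) + 2 * l₁ with hΓ₁
  have hΓ₁0 : 0 < Γ₁ := by positivity
  set y := 4 * K / (ε * (Γ₁ * P)) with hy
  have hy0 : 0 < y := by positivity
  -- For large sets a small parameter keeps the quadratic loss below half the linear gain; with z >
  -- yn this leaves an exponent of order cn.
  set l₂ := min (1 / 2) (ε / (8 * P)) with hl₂
  have hl₂0 : 0 < l₂ := by positivity
  refine ⟨y * l₂ * ε / 2, by positivity, ?_⟩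
  intro n c pa pb x S T hn hc ha0 hb0 ha hb hp hTS hST
  have hnR : (0 : ℝ) < n := by exact_mod_cast hn
  set z := √(S.card * T.card : ℝ) with hz
  have hz0 : 0 ≤ z := Real.sqrt_nonneg _
  have hz2 : (S.card : ℝ) * T.card = z * z := (Real.mul_self_sqrt (mul_nonneg (Nat.cast_nonneg _) (Nat.cast_nonneg _))).symm
  have hS : ε * S.card ≤ K * z := by
    refine abs_le_of_sq_le_sq' ?_ (mul_nonneg hK.le hz0) |>.2
    have h1 := mul_le_mul_of_nonneg_right hST (Nat.cast_nonneg (α := ℝ) S.card)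
    nlinarith
  have hT : ε * T.card ≤ K * z := by
    refine abs_le_of_sq_le_sq' ?_ (mul_nonneg hK.le hz0) |>.2
    have h1 := mul_le_mul_of_nonneg_right hTS (Nat.cast_nonneg (α := ℝ) T.card)
    nlinarith
  have hSn : (S.card : ℝ) ≤ n := by exact_mod_cast (Finset.card_le_univ S).trans (by simp)
  have hTn : (T.card : ℝ) ≤ n := by exact_mod_cast (Finset.card_le_univ T).trans (by simp)
  have hzn : z ≤ n := by
    refine Real.sqrt_le_iff.2 ⟨hnR.le, ?_⟩
    rw [sq]
    exact mul_le_mul hSn hTn (Nat.cast_nonneg _) hnR.le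
  clear_value z
  rcases le_or_gt z (y * n) with hsmall | hlarge
  · refine (graphProb_discrepancy_le ha0 hb0 ha hb hp S T hl₁0.le
      (fun t ht => exp_sub_one_sub_le ht) _).trans ?_
    have h1 : Γ₁ * (P * c / n * (S.card * T.card)) - l₁ * (ε * c * z) ≤
        -(2 * c) * S.card + -(2 * c) * T.card := by
      rw [hz2]
      have h2 : Γ₁ * (P * c / n * (z * z)) ≤ 4 * K / ε * (c * z) := by
        calc Γ₁ * (P * c / n * (z * z)) = Γ₁ * P * c * z * (z / n) := by ring
          _ ≤ Γ₁ * P * c * z * y := by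
              gcongr
              rwa [div_le_iff₀ hnR]
          _ = _ := by rw [hy]; field_simp
      have h3 : l₁ * (ε * c * z) = 8 * K / ε * (c * z) := by rw [hl₁]; field_simp
      have h4 : (S.card : ℝ) ≤ K / ε * z := by
        rw [div_mul_eq_mul_div, le_div_iff₀ hε]; linarith
      have h5 : (T.card : ℝ) ≤ K / ε * z := by
        rw [div_mul_eq_mul_div, le_div_iff₀ hε]; linarith
      have h6 := mul_le_mul_of_nonneg_left (add_le_add h4 h5) hc
      have h7 : 4 * K / ε * (c * z) = 4 * (c * (K / ε * z)) := by ring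
      have h8 : 8 * K / ε * (c * z) = 8 * (c * (K / ε * z)) := by ring
      rw [h3, h8]
      rw [h7] at h2
      linarith
    have h2 := Real.exp_le_exp.2 h1
    rw [Real.exp_add, mul_comm (-(2 * c)) (S.card : ℝ), mul_comm (-(2 * c)) (T.card : ℝ),
      Real.exp_nat_mul, Real.exp_nat_mul] at h2
    have h3 := Real.exp_nonneg (-(y * l₂ * ε / 2 * c * n))
    linarith
  · have h2l : 2 * l₂ ≤ 1 := by linarith [min_le_left (1 / 2) (ε / (8 * P))]
    refine (graphProb_discrepancy_le ha0 hb0 ha hb hp S T hl₂0.le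
      (fun t ht => exp_sub_one_sub_le_sq ht h2l) _).trans ?_
    have h1 : (2 * l₂) ^ 2 * (P * c / n * (S.card * T.card)) - l₂ * (ε * c * z) ≤
        -(y * l₂ * ε / 2 * c * n) := by
      rw [hz2]
      have h2 : (2 * l₂) ^ 2 * (P * c / n * (z * z)) ≤ l₂ * ε / 2 * (c * z) := by
        have h3 : 8 * P * l₂ ≤ ε := by
          have := min_le_right (1 / 2) (ε / (8 * P))
          rw [← hl₂, le_div_iff₀ (by positivity)] at this
          linarith
        calc (2 * l₂) ^ 2 * (P * c / n * (z * z)) = l₂ / 2 * (8 * P * l₂) * (c * z) * (z / n) := by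
              ring
          _ ≤ l₂ / 2 * ε * (c * z) * 1 := by
              gcongr
              rw [div_le_one hnR]; exact hzn
          _ = _ := by ring
      have h3 : l₂ * ε / 2 * (c * (y * n)) ≤ l₂ * ε / 2 * (c * z) := by gcongr
      linarith
    have h2 := Real.exp_le_exp.2 h1
    have h3 : 0 ≤ Real.exp (-(2 * c)) ^ S.card * Real.exp (-(2 * c)) ^ T.card := by positivity
    linarith

/-- The binomial theorem over subsets. The empty set has to be left out, as its term does not tend
to zero. -/
theorem sum_nonempty_pow (n : ℕ) (y : ℝ) :
    ∑ S : Finset (Fin n), (if S.Nonempty then y ^ S.card else 0) = (1 + y) ^ n - 1 := by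
  have h := Fintype.sum_pow_mul_eq_add_pow (Fin n) y 1
  simp only [one_pow, mul_one, Fintype.card_fin] at h
  rw [add_comm 1 y, ← h, ← Finset.add_sum_erase _ _ (Finset.mem_univ ∅),
    ← Finset.add_sum_erase _ (fun S : Finset (Fin n) => y ^ S.card) (Finset.mem_univ ∅)]
  simp only [Finset.not_nonempty_empty, if_false, Finset.card_empty, pow_zero, zero_add,
    add_sub_cancel_left]
  refine Finset.sum_congr rfl fun S hS => ?_
  rw [if_pos (Finset.nonempty_iff_ne_empty.2 (Finset.ne_of_mem_erase hS))]

/-- The two parts of the union bound. Small sets have weights n^(-2|S|) n^(-2|T|), whose sums over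
nonempty sets tend to zero; for large sets the 4^n pairs are outweighed by n^(-ρn). -/
theorem tendsto_union_bound {ρ : ℝ} (hρ : 0 < ρ) :
    Tendsto (fun n : ℕ => 2 * ((1 + Real.exp (-(2 * Real.log n))) ^ n - 1) ^ 2 +
      2 * (4 : ℝ) ^ n * Real.exp (-(ρ * Real.log n * n))) atTop (𝓝 0) := by
  have h1 : Tendsto (fun n : ℕ => (1 + Real.exp (-(2 * Real.log n))) ^ n - 1) atTop (𝓝 0) := by
    have hu : Tendsto (fun n : ℕ => Real.exp (1 / (n : ℝ)) - 1) atTop (𝓝 0) := by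
      have := (Real.continuous_exp.tendsto 0).comp (tendsto_one_div_atTop_nhds_zero_nat (𝕜 := ℝ))
      simpa using this.sub_const 1
    refine squeeze_zero' ?_ ?_ hu
    · filter_upwards with n
      have : (1 : ℝ) ≤ (1 + Real.exp (-(2 * Real.log n))) ^ n :=
        one_le_pow₀ (by linarith [Real.exp_pos (-(2 * Real.log n))])
      linarith
    · filter_upwards [eventually_gt_atTop 0] with n hn
      have hnR : (0 : ℝ) < n := by exact_mod_cast hn
      have h2 : Real.exp (-(2 * Real.log n)) = 1 / (n : ℝ) ^ 2 := by
        rw [Real.exp_neg, two_mul, Real.exp_add, Real.exp_log hnR, one_div, sq]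
      have h3 : 1 + Real.exp (-(2 * Real.log n)) ≤ Real.exp (1 / (n : ℝ) ^ 2) := by
        rw [h2, add_comm]
        exact Real.add_one_le_exp _
      have h4 : (1 + Real.exp (-(2 * Real.log n))) ^ n ≤ Real.exp (1 / (n : ℝ)) := by
        refine (pow_le_pow_left₀ (by positivity) h3 n).trans (le_of_eq ?_)
        rw [← Real.exp_nat_mul]
        congr 1
        field_simp
      linarith
  have h2 : Tendsto (fun n : ℕ => (4 : ℝ) ^ n * Real.exp (-(ρ * Real.log n * n))) atTop
      (𝓝 0) := by
    have hlog : Tendsto (fun n : ℕ => Real.log n) atTop atTop :=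
      Real.tendsto_log_atTop.comp tendsto_natCast_atTop_atTop
    have hu : Tendsto (fun n : ℕ => Real.exp (-(n : ℝ))) atTop (𝓝 0) :=
      Real.tendsto_exp_neg_atTop_nhds_zero.comp tendsto_natCast_atTop_atTop
    refine squeeze_zero' (Eventually.of_forall fun n => by positivity) ?_ hu
    filter_upwards [hlog.eventually_ge_atTop ((Real.log 4 + 1) / ρ)] with n hn
    rw [div_le_iff₀ hρ] at hn
    have h4 : (4 : ℝ) ^ n = Real.exp (n * Real.log 4) := by
      rw [Real.exp_nat_mul, Real.exp_log (by norm_num)]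
    rw [h4, ← Real.exp_add]
    refine Real.exp_le_exp.2 ?_
    have : (0 : ℝ) ≤ n := by positivity
    nlinarith
  have h3 := ((h1.pow 2).const_mul 2).add (h2.const_mul 2)
  simp only [ne_eq, OfNat.ofNat_ne_zero, not_false_eq_true, zero_pow, mul_zero, add_zero] at h3
  refine h3.congr fun n => ?_
  ring

/-- With high probability the noise has small discrepancy on comparable sets. -/
theorem eventually_discrepancy {P K ε : ℝ} (hP : 0 < P) (hK : 0 < K) (hε : 0 < ε) :
    ∃ err : ℕ → ℝ, Tendsto err atTop (𝓝 0) ∧ ∀ (n : ℕ) (pa pb : ℝ) (x : Fin n → Fin 2),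
      0 < n → 0 ≤ pa → 0 ≤ pb → pa ≤ P * Real.log n / n → pb ≤ P * Real.log n / n →
      P * Real.log n / n ≤ 1 →
      graphProb (prob pa pb x) (fun G => ∃ ST ∈ (Finset.univ : Finset
        (Finset (Fin n) × Finset (Fin n))), (ST.1.Nonempty ∧ ST.2.Nonempty ∧
          ε ^ 2 * ST.2.card ≤ K ^ 2 * ST.1.card ∧ ε ^ 2 * ST.1.card ≤ K ^ 2 * ST.2.card) ∧
        ε * Real.log n * √(ST.1.card * ST.2.card) <
          |∑ u ∈ ST.1, ∑ v ∈ ST.2, noise pa pb x G u v|) ≤ err n := by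
  obtain ⟨ρ, hρ, hrate⟩ := exists_rate_discrepancy hP hK hε
  refine ⟨_, tendsto_union_bound hρ, ?_⟩
  intro n pa pb x hn ha0 hb0 ha hb hp
  have h0 := prob_nonneg (x := x) ha0 hb0
  have h1 : ∀ u v, prob pa pb x u v ≤ 1 := fun u v => (prob_le ha hb u v).trans hp
  refine (graphProb_exists_le h0 h1 _ _).trans ?_
  set y := Real.exp (-(2 * Real.log n)) with hy
  have hterm : ∀ ST ∈ (Finset.univ : Finset (Finset (Fin n) × Finset (Fin n))),
      graphProb (prob pa pb x) (fun G => (ST.1.Nonempty ∧ ST.2.Nonempty ∧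
          ε ^ 2 * ST.2.card ≤ K ^ 2 * ST.1.card ∧ ε ^ 2 * ST.1.card ≤ K ^ 2 * ST.2.card) ∧
        ε * Real.log n * √(ST.1.card * ST.2.card) <
          |∑ u ∈ ST.1, ∑ v ∈ ST.2, noise pa pb x G u v|) ≤
      2 * ((if ST.1.Nonempty then y ^ ST.1.card else 0) *
        (if ST.2.Nonempty then y ^ ST.2.card else 0)) +
        2 * Real.exp (-(ρ * Real.log n * n)) := by
    intro ST _
    have hnn : 0 ≤ 2 * Real.exp (-(ρ * Real.log n * n)) := by positivity
    by_cases hST : ST.1.Nonempty ∧ ST.2.Nonempty ∧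
          ε ^ 2 * ST.2.card ≤ K ^ 2 * ST.1.card ∧ ε ^ 2 * ST.1.card ≤ K ^ 2 * ST.2.card
    · rw [if_pos hST.1, if_pos hST.2.1]
      exact (graphProb_mono h0 h1 fun G hG => hG.2).trans
        (hrate n _ pa pb x ST.1 ST.2 hn (Real.log_natCast_nonneg n) ha0 hb0 ha hb hp
          hST.2.2.1 hST.2.2.2)
    · have : graphProb (prob pa pb x) (fun G => (ST.1.Nonempty ∧ ST.2.Nonempty ∧
          ε ^ 2 * ST.2.card ≤ K ^ 2 * ST.1.card ∧ ε ^ 2 * ST.1.card ≤ K ^ 2 * ST.2.card) ∧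
        ε * Real.log n * √(ST.1.card * ST.2.card) <
          |∑ u ∈ ST.1, ∑ v ∈ ST.2, noise pa pb x G u v|) = 0 := by
        simp [graphProb, graphMean, hST]
      rw [this]
      have : 0 ≤ (if ST.1.Nonempty then y ^ ST.1.card else 0) *
        (if ST.2.Nonempty then y ^ ST.2.card else 0) := by
        refine mul_nonneg ?_ ?_ <;> split_ifs <;> positivity
      linarith
  refine (Finset.sum_le_sum hterm).trans (le_of_eq ?_)
  rw [Finset.sum_add_distrib, ← Finset.mul_sum, Fintype.sum_prod_type]
  simp only [← Finset.mul_sum, ← Finset.sum_mul, sum_nonempty_pow]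
  rw [Finset.sum_const, Finset.card_univ, Fintype.card_prod, Fintype.card_finset,
    Fintype.card_fin, nsmul_eq_mul]
  push_cast
  rw [← mul_pow]
  norm_num
  ring

/-! ### Success of the algorithm above the threshold, for balanced labels. -/

theorem exists_exponent_of_lt {A B : ℝ} (hB : 0 ≤ B) (hAB : √2 < A - B) :
    ∃ τ : ℝ, 0 < τ ∧ A ^ 2 * (Real.exp (-τ) - 1) + B ^ 2 * (Real.exp τ - 1) < -2 := by
  have h2 : 0 < √2 := by positivity
  have hA : 0 < A := by linarith
  have hsq : 2 < (A - B) ^ 2 := by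
    have := Real.sq_sqrt (show (0 : ℝ) ≤ 2 by norm_num)
    nlinarith
  -- For B > 0 the minimum -(A - B)² is attained at exp τ = A/B. Replacing the denominator by B + ε
  -- costs at most εA and also covers B = 0.
  obtain ⟨ε, hε, h1, h3⟩ : ∃ ε : ℝ, 0 < ε ∧ B + ε < A ∧ ε * A < (A - B) ^ 2 - 2 := by
    refine ⟨min ((A - B) / 2) (((A - B) ^ 2 - 2) / (2 * A)), ?_, ?_, ?_⟩
    · exact lt_min (by linarith) (div_pos (by linarith) (by linarith))
    · linarith [min_le_left ((A - B) / 2) (((A - B) ^ 2 - 2) / (2 * A))]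
    · have h := min_le_right ((A - B) / 2) (((A - B) ^ 2 - 2) / (2 * A))
      rw [le_div_iff₀ (by linarith)] at h
      linarith
  have hBε : 0 < B + ε := by linarith
  have hy : 1 < A / (B + ε) := (one_lt_div hBε).2 h1
  refine ⟨Real.log (A / (B + ε)), Real.log_pos hy, ?_⟩
  rw [Real.exp_neg, Real.exp_log (by positivity), inv_div]
  have e1 : A ^ 2 * ((B + ε) / A - 1) = A * (B + ε) - A ^ 2 := by field_simp
  have e2 : B ^ 2 * (A / (B + ε)) ≤ A * B := by
    rw [← mul_div_assoc, div_le_iff₀ hBε]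
    nlinarith [mul_nonneg (mul_nonneg hA.le hB) hε.le]
  rw [e1]
  nlinarith

/-- The Chernoff exponent above the threshold. -/
theorem exists_exponent {a b : ℝ} (ha : 0 ≤ a) (hb : 0 ≤ b) (h : √2 < |√a - √b|) :
    ∃ (r : Bool) (τ : ℝ), 0 < τ ∧ a * (Real.exp (-(τ * voteSign r)) - 1) +
      b * (Real.exp (τ * voteSign r) - 1) < -2 := by
  rcases le_total (√b) (√a) with hab | hab
  · rw [abs_of_nonneg (by linarith)] at h
    obtain ⟨τ, hτ, h1⟩ := exists_exponent_of_lt (Real.sqrt_nonneg b) h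
    rw [Real.sq_sqrt ha, Real.sq_sqrt hb] at h1
    exact ⟨false, τ, hτ, by simpa [voteSign] using h1⟩
  · rw [abs_of_nonpos (by linarith)] at h
    obtain ⟨τ, hτ, h1⟩ := exists_exponent_of_lt (Real.sqrt_nonneg a)
      (show √2 < √b - √a by linarith)
    rw [Real.sq_sqrt ha, Real.sq_sqrt hb] at h1
    refine ⟨true, τ, hτ, ?_⟩
    simp only [voteSign, if_true, mul_neg, mul_one, neg_neg]
    linarith

/-- If K²|S| < ε²|T|, the row sum bound Kc|S| is already below εc√(|S||T|), and symmetrically. So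
probability is needed only for pairs of comparable sizes. -/
theorem discrepancy_of_comparable {n : ℕ} {W : Fin n → Fin n → ℝ} {c K ε : ℝ} (hc : 0 ≤ c)
    (hε : 0 < ε) (hsymm : ∀ u v, W u v = W v u) (hrow : ∀ u, ∑ v, |W u v| ≤ K * c)
    (h : ∀ S T : Finset (Fin n), S.Nonempty → T.Nonempty → ε ^ 2 * T.card ≤ K ^ 2 * S.card →
      ε ^ 2 * S.card ≤ K ^ 2 * T.card → |∑ u ∈ S, ∑ v ∈ T, W u v| ≤ ε * c * √(S.card * T.card))
    (S T : Finset (Fin n)) : |∑ u ∈ S, ∑ v ∈ T, W u v| ≤ ε * c * √(S.card * T.card) := by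
  have key : ∀ s t : ℝ, 0 ≤ s → K ^ 2 * s < ε ^ 2 * t → K * c * s ≤ ε * c * √(s * t) := by
    intro s t hs hst
    have ht : 0 ≤ t := by
      by_contra! h
      have := mul_neg_of_pos_of_neg (pow_pos hε 2) h
      have := mul_nonneg (sq_nonneg K) hs
      linarith
    have h1 : K * s ≤ ε * √(s * t) := by
      refine abs_le_of_sq_le_sq' ?_ (by positivity) |>.2
      rw [mul_pow ε, Real.sq_sqrt (by positivity)]
      nlinarith
    have := mul_le_mul_of_nonneg_left h1 hc
    linarith
  have hr1 := abs_sum_sum_le_row hrow S T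
  have hr2 := abs_sum_sum_le_row hrow T S
  rw [Finset.sum_comm] at hr2
  simp only [fun u v => hsymm u v] at hr2
  have hr2' : |∑ u ∈ S, ∑ v ∈ T, W u v| ≤ K * c * T.card := by
    refine le_trans (le_of_eq ?_) hr2
    congr 1
  by_cases h1 : ε ^ 2 * T.card ≤ K ^ 2 * S.card
  · by_cases h2 : ε ^ 2 * S.card ≤ K ^ 2 * T.card
    · rcases S.eq_empty_or_nonempty with rfl | hS
      · simp
      rcases T.eq_empty_or_nonempty with rfl | hT
      · simp
      exact h S T hS hT h1 h2
    · rw [mul_comm (S.card : ℝ)]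
      exact hr2'.trans (key _ _ (Nat.cast_nonneg _) (not_le.1 h2))
  · exact hr1.trans (key _ _ (Nat.cast_nonneg _) (not_le.1 h1))

set_option maxHeartbeats 1000000 in
/-- Above the threshold the algorithm succeeds with high probability, given balanced labels. -/
theorem exists_recovery_bound {a b : ℝ} (ha : 0 ≤ a) (hb : 0 ≤ b) (h : √2 < |√a - √b|) :
    ∃ (r : Bool) (ε₀ : ℝ) (err : ℕ → ℝ), 0 < ε₀ ∧ Tendsto err atTop (𝓝 0) ∧
      ∀ᶠ n : ℕ in atTop, ∀ x : Fin n → Fin 2, |∑ u, spin x u| ≤ ε₀ * n →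
        graphProb (prob (a * Real.log n / n) (b * Real.log n / n) x) (fun G =>
          ¬ ∀ L, IsBestLabel n (edge n ((inputMemory G).arr 0)) L →
            ∃ t : ℝ, (t = 1 ∨ t = -1) ∧ ∀ u,
              machineSpin ((vote n (edge n ((inputMemory G).arr 0)) r)^[2 * n] L) u =
                t * spin x u) ≤ err n := by
  obtain ⟨r, τ, hτ, hf⟩ := exists_exponent ha hb h
  have hab : a ≠ b := by
    rintro rfl
    rw [sub_self, abs_zero] at h
    exact absurd h (by positivity : (0 : ℝ) ≤ √2).not_gt
  set P := max a b with hP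
  have haP : a ≤ P := le_max_left _ _
  have hbP : b ≤ P := le_max_right _ _
  have hP0 : 0 < P := by
    rcases lt_or_gt_of_ne hab with h | h
    · exact lt_of_lt_of_le (lt_of_le_of_lt ha h) hbP
    · exact lt_of_lt_of_le (lt_of_le_of_lt hb h) haP
  have hd : 0 < |a - b| := abs_pos.2 (sub_ne_zero.2 hab)
  set X₀ := a * (Real.exp (-(τ * voteSign r)) - 1) with hX₀
  set Y₀ := b * (Real.exp (τ * voteSign r) - 1) with hY₀
  set K₁ := |X₀| + |Y₀| with hK₁
  have hK₁0 : 0 ≤ K₁ := by positivity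
  -- The exponent of a bad vote is -(1 + gap) in units of log n. The margin `δ`, the imbalance `ε₀`
  -- and the missing pair of a vertex with itself may each use gap/4; the remaining n^(-1-gap/4)
  -- survives the union over `n` vertices.
  set gap := -(X₀ + Y₀ + 2) / 2 with hgap
  have hgap0 : 0 < gap := by rw [hgap]; linarith
  set δ := gap / (4 * τ) with hδ
  have hδ0 : 0 < δ := by positivity
  set ε₀ := min (1 / 2) (gap / (2 * (K₁ + 1))) with hε₀
  have hε₀0 : 0 < ε₀ := by positivity
  have hε₀K : ε₀ * K₁ ≤ gap / 2 := by
    have h1 : ε₀ ≤ gap / (2 * (K₁ + 1)) := min_le_right _ _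
    rw [le_div_iff₀ (by positivity)] at h1
    nlinarith
  set η := min (1 / 2) (δ / (256 * P)) with hη
  have hη0 : 0 < η := by positivity
  have hη2 : η ≤ 1 / 2 := min_le_left _ _
  have hηδ : 256 * η ^ 2 * P ≤ δ := by
    have h1 : η ≤ δ / (256 * P) := min_le_right _ _
    rw [le_div_iff₀ (by positivity)] at h1
    have h2 : η ^ 2 ≤ η := by nlinarith
    nlinarith
  -- The degrees are at most (2P + 2) log n with high probability, and the expected part adds P log
  -- n to the absolute row sums.
  set K := 3 * P + 2 with hK
  have hK0 : 0 < K := by positivity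
  -- The order of choice matters: `g` makes the contribution of distant dyadic levels small, and
  -- only then is `ε` taken small enough to absorb the factor 2g + 1.
  obtain ⟨g, hg⟩ : ∃ g : ℕ, 2 * K * (1 / 2) ^ g ≤ η * |a - b| / 32 := by
    obtain ⟨g, hg⟩ := exists_pow_lt_of_lt_one
      (show 0 < η * |a - b| / 32 / (2 * K) by positivity) (show (1 / 2 : ℝ) < 1 by norm_num)
    rw [lt_div_iff₀ (by positivity)] at hg
    exact ⟨g, by linarith⟩
  obtain ⟨ε, hε, hεg, hεδ⟩ : ∃ ε : ℝ, 0 < ε ∧ ε * (2 * g + 1) ≤ η * |a - b| / 32 ∧ 4 * ε < δ := by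
    refine ⟨min (η * |a - b| / 32 / (2 * g + 1)) (δ / 8), by positivity, ?_, ?_⟩
    · have := min_le_left (η * |a - b| / 32 / (2 * g + 1)) (δ / 8)
      rwa [le_div_iff₀ (by positivity)] at this
    · linarith [min_le_right (η * |a - b| / 32 / (2 * g + 1)) (δ / 8)]
  obtain ⟨err₂, herr₂, hdisc⟩ := eventually_discrepancy hP0 hK0 hε
  have hlog : Tendsto (fun n : ℕ => Real.log n) atTop atTop :=
    Real.tendsto_log_atTop.comp tendsto_natCast_atTop_atTop
  have hlogn : Tendsto (fun n : ℕ => Real.log n / n) atTop (𝓝 0) := by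
    have := Real.isLittleO_log_id_atTop.tendsto_div_nhds_zero.comp
      (tendsto_natCast_atTop_atTop (R := ℝ))
    exact this
  refine ⟨r, ε₀, fun n => Real.exp (-Real.log n) + err₂ n + Real.exp (-(gap / 4 * Real.log n)),
    hε₀0, ?_, ?_⟩
  · have h1 : Tendsto (fun n : ℕ => Real.exp (-Real.log n)) atTop (𝓝 0) :=
      Real.tendsto_exp_neg_atTop_nhds_zero.comp hlog
    have h3 : Tendsto (fun n : ℕ => Real.exp (-(gap / 4 * Real.log n))) atTop (𝓝 0) :=
      Real.tendsto_exp_neg_atTop_nhds_zero.comp (hlog.const_mul_atTop (by positivity))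
    simpa using (h1.add herr₂).add h3
  have hcast := tendsto_natCast_atTop_atTop (R := ℝ)
  filter_upwards [eventually_gt_atTop 0, hlog.eventually_gt_atTop 0,
    (hlogn.const_mul P).eventually (eventually_le_nhds (by simp : P * 0 < 1)),
    hcast.eventually_ge_atTop (a / ε), hcast.eventually_ge_atTop (4 * K₁ / gap)]
    with n hn hc hp1 hna hnK x hbal
  set c := Real.log n with hcdef
  have hnR : (0 : ℝ) < n := by exact_mod_cast hn
  have hp1' : P * c / n ≤ 1 := by rw [mul_div_assoc]; exact hp1
  set pa := a * c / n with hpa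
  set pb := b * c / n with hpb
  have ha0 : 0 ≤ pa := by positivity
  have hb0 : 0 ≤ pb := by positivity
  have hpaP : pa ≤ P * c / n := by rw [hpa]; gcongr
  have hpbP : pb ≤ P * c / n := by rw [hpb]; gcongr
  have h0 := prob_nonneg (x := x) ha0 hb0
  have h1 : ∀ u v, prob pa pb x u v ≤ 1 := fun u v => (prob_le hpaP hpbP u v).trans hp1'
  have B1 := graphProb_degree_le (x := x) ha0 hb0 hpaP hpbP hp1' ((2 * P + 2) * c)
  have B2 := hdisc n pa pb x hn ha0 hb0 hpaP hpbP hp1'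
  have B3 : graphProb (prob pa pb x) (fun G => ∃ v ∈ Finset.univ,
      voteSign r * (spin x v * ∑ w, adj G v w * spin x w) < δ * c) ≤
      Real.exp (-(gap / 4 * c)) := by
    refine (graphProb_exists_le h0 h1 _ _).trans ((Finset.sum_le_sum fun v _ =>
      graphProb_vote_le ha0 hb0 (hpaP.trans hp1') (hpbP.trans hp1') hτ.le rfl rfl v).trans ?_)
    have hX : pa * (Real.exp (-(τ * voteSign r)) - 1) = c / n * X₀ := by rw [hpa, hX₀]; ring
    have hY : pb * (Real.exp (τ * voteSign r) - 1) = c / n * Y₀ := by rw [hpb, hY₀]; ring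
    have hv : ∀ v : Fin n, Real.exp (τ * (δ * c) +
        n * (pa * (Real.exp (-(τ * voteSign r)) - 1) + pb * (Real.exp (τ * voteSign r) - 1)) / 2 +
        (spin x v * ∑ w, spin x w) * ((pa * (Real.exp (-(τ * voteSign r)) - 1) -
          pb * (Real.exp (τ * voteSign r) - 1)) / 2) - pa * (Real.exp (-(τ * voteSign r)) - 1)) ≤
        Real.exp (-c + -(gap / 4 * c)) := by
      intro v
      refine Real.exp_le_exp.2 ?_
      rw [hX, hY]
      have e1 : (n : ℝ) * (c / n * X₀ + c / n * Y₀) / 2 = c * (-1 - gap) := by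
        rw [hgap]; field_simp; ring
      have e2 : τ * (δ * c) = gap / 4 * c := by rw [hδ]; field_simp
      have e3 : spin x v * (∑ w, spin x w) * ((c / n * X₀ - c / n * Y₀) / 2) ≤ gap / 4 * c := by
        refine (le_abs_self _).trans ?_
        have s1 : |spin x v * ∑ w, spin x w| ≤ ε₀ * n := by
          rw [abs_mul]
          rcases spin_eq_or x v with h | h <;> rw [h] <;> simpa using hbal
        have s2 : |(c / n * X₀ - c / n * Y₀) / 2| ≤ c / n * K₁ / 2 := by
          rw [abs_div, abs_two, ← mul_sub, abs_mul, abs_of_nonneg (by positivity : 0 ≤ c / n)]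
          gcongr
          exact abs_sub _ _
        rw [abs_mul]
        calc _ ≤ ε₀ * n * (c / n * K₁ / 2) := by gcongr
          _ = ε₀ * K₁ * (c / 2) := by field_simp
          _ ≤ gap / 2 * (c / 2) := by gcongr
          _ = _ := by ring
      have e4 : -(c / n * X₀) ≤ gap / 4 * c := by
        have s1 : -X₀ ≤ K₁ := by linarith [neg_abs_le X₀, abs_nonneg Y₀]
        rw [div_le_iff₀ hgap0] at hnK
        calc -(c / n * X₀) = c / n * (-X₀) := by ring
          _ ≤ c / n * K₁ := by gcongr
          _ ≤ c / n * (n * gap / 4) := by gcongr; linarith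
          _ = _ := by field_simp
      linarith
    refine (Finset.sum_le_sum fun v _ => hv v).trans (le_of_eq ?_)
    rw [Finset.sum_const, Finset.card_univ, Fintype.card_fin, nsmul_eq_mul, Real.exp_add,
      Real.exp_neg c, hcdef, Real.exp_log hnR, ← mul_assoc, mul_inv_cancel₀ hnR.ne', one_mul]
  have hB1 : (n : ℝ) * Real.exp (2 * (n * (P * c / n)) - (2 * P + 2) * c) = Real.exp (-c) := by
    have e1 : 2 * (n * (P * c / n)) - (2 * P + 2) * c = -c + -c := by field_simp; ring
    rw [e1, Real.exp_add, ← mul_assoc, Real.exp_neg, hcdef, Real.exp_log hnR,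
      mul_inv_cancel₀ hnR.ne', one_mul]
  rw [hB1] at B1
  refine le_trans ?_ (add_le_add (add_le_add B1 B2) B3)
  refine le_trans (graphProb_mono h0 h1 fun G hG => ?_) ((graphProb_or_le h0 h1 _ _).trans
    (add_le_add (graphProb_or_le h0 h1 _ _) le_rfl))
  by_contra hcon
  push Not at hcon
  obtain ⟨⟨c1, c2⟩, c3⟩ := hcon
  refine hG fun L hL => ?_
  have hrow : ∀ u, ∑ v, |noise pa pb x G u v| ≤ K * c := by
    intro u
    refine (sum_abs_noise_le ha0 hb0 hpaP hpbP G u).trans ?_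
    have h1 := c1 u (Finset.mem_univ u)
    have h2 : (n : ℝ) * (P * c / n) = P * c := by field_simp
    rw [h2, hK]
    linarith
  have hD := discrepancy_of_comparable hc.le hε (noise_symm pa pb x G) hrow
    fun S T hS hT h1 h2 => c2 (S, T) (Finset.mem_univ _) ⟨hS, hT, h1, h2⟩
  have hM : ε * c * (2 * g + 1) + 2 * (K * c) * (1 / 2) ^ g =
      c * (ε * (2 * g + 1) + 2 * K * (1 / 2) ^ g) := by ring
  have hpab : pa - pb = (a - b) * (c / n) := by rw [hpa, hpb]; ring
  have hcn : 0 < c / n := by positivity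
  refine machineSpin_iterate_vote_eq hn (p := P * c / n) (α := ε * c) (β := δ * c) (Δ := K * c)
    (η := η) (g := g) (by positivity) ha0 hpaP hpbP ?_ ?_ hD hrow ?_
    (fun u => c3 u (Finset.mem_univ u)) ?_ hη0 hη2 ?_ ?_ hL
  · intro hcon
    have : (a - b) * (c / n) = 0 := by rw [← hpab, hcon, sub_self]
    rcases mul_eq_zero.1 this with h | h
    · exact hab (sub_eq_zero.1 h)
    · exact hcn.ne' h
  · have := mul_lt_mul_of_pos_right hεδ hc
    linarith
  · refine hbal.trans ?_
    have := mul_le_mul_of_nonneg_right (min_le_left _ _ : ε₀ ≤ 1 / 2) hnR.le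
    linarith
  · rw [hM, hpa, mul_comm a, mul_div_assoc]
    refine mul_le_mul_of_nonneg_left ?_ hc.le
    rw [div_le_iff₀ hε] at hna
    have h1 : a / n ≤ ε := by rw [div_le_iff₀ hnR]; linarith
    have h2 : ε ≤ ε * (2 * g + 1) := by
      have : 0 ≤ ε * (2 * g) := by positivity
      linarith
    have h3 : 0 ≤ 2 * K * (1 / 2) ^ g := by positivity
    linarith
  · rw [hM, hpab, abs_mul, abs_of_pos hcn]
    have e1 : η * (|a - b| * (c / n) * n) = c * (η * |a - b|) := by field_simp
    rw [e1]
    have := mul_le_mul_of_nonneg_left (add_le_add hεg hg) hc.le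
    linarith
  · have e1 : P * c / n * n = P * c := by field_simp
    rw [e1]
    have := mul_le_mul_of_nonneg_right hηδ hc.le
    linarith

/-! ### Uniform labels, and recovery for the model itself. -/

/-- Change the label of the vertex `u`. -/
def flip {n : ℕ} (u : Fin n) (x : Fin n → Fin 2) : Fin n → Fin 2 :=
  Function.update x u (x u + 1)

theorem flip_flip {n : ℕ} (u : Fin n) (x : Fin n → Fin 2) : flip u (flip u x) = x := by
  ext v
  by_cases h : v = u
  · subst h
    have : ∀ i : Fin 2, i + 1 + 1 = i := by decide
    simp [flip, this]
  · simp [flip, h]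

theorem spin_flip_self {n : ℕ} (u : Fin n) (x : Fin n → Fin 2) :
    spin (flip u x) u = -spin x u := by
  have : ∀ i : Fin 2, (if i + 1 = 0 then (1 : ℝ) else -1) = -(if i = 0 then 1 else -1) := by
    intro i
    fin_cases i <;> simp
  simpa [spin, flip] using this (x u)

theorem spin_flip_of_ne {n : ℕ} {u v : Fin n} (h : v ≠ u) (x : Fin n → Fin 2) :
    spin (flip u x) v = spin x v := by
  simp [spin, flip, h]

theorem sum_flip {n : ℕ} (u : Fin n) (F : (Fin n → Fin 2) → ℝ) :
    ∑ x, F (flip u x) = ∑ x, F x :=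
  Equiv.sum_comp (⟨flip u, flip u, flip_flip u, flip_flip u⟩ :
    (Fin n → Fin 2) ≃ (Fin n → Fin 2)) F

/-- Flipping `u` preserves the uniform law and changes the sign of the spin at `u`, so distinct
spins are uncorrelated. -/
theorem sum_sq_sum_spin (n : ℕ) :
    ∑ x : Fin n → Fin 2, (1 / 2 : ℝ) ^ n * (∑ u, spin x u) ^ 2 = n := by
  have h : ∀ u v : Fin n, ∑ x : Fin n → Fin 2, (1 / 2 : ℝ) ^ n * (spin x u * spin x v) =
      if u = v then 1 else 0 := by
    intro u v
    split_ifs with h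
    · subst h
      simp only [spin_mul_self, Finset.sum_const, Finset.card_univ, Fintype.card_fun,
        Fintype.card_fin, nsmul_eq_mul, mul_one]
      push_cast
      rw [← mul_pow]
      norm_num
    · have h1 := sum_flip u fun x => (1 / 2 : ℝ) ^ n * (spin x u * spin x v)
      simp only [spin_flip_self, spin_flip_of_ne (Ne.symm h)] at h1
      have h2 : ∑ x : Fin n → Fin 2, (1 / 2 : ℝ) ^ n * (-spin x u * spin x v) =
          -∑ x : Fin n → Fin 2, (1 / 2 : ℝ) ^ n * (spin x u * spin x v) := by
        rw [← Finset.sum_neg_distrib]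
        exact Finset.sum_congr rfl fun x _ => by ring
      linarith
  have h2 : ∀ x : Fin n → Fin 2, (1 / 2 : ℝ) ^ n * (∑ u, spin x u) ^ 2 =
      ∑ u, ∑ v, (1 / 2 : ℝ) ^ n * (spin x u * spin x v) := by
    intro x
    rw [sq, Finset.sum_mul_sum, Finset.mul_sum]
    exact Finset.sum_congr rfl fun u _ => Finset.mul_sum _ _ _
  simp only [h2]
  rw [Finset.sum_comm]
  rw [Finset.sum_congr rfl fun u _ => Finset.sum_comm]
  simp only [h]
  simp

open scoped Classical in
/-- Chebyshev's inequality for the imbalance of the communities. -/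
theorem sum_unbalanced_le (n : ℕ) {K : ℝ} (hK : 0 < K) :
    ∑ x : Fin n → Fin 2, (1 / 2 : ℝ) ^ n * (if |∑ u, spin x u| ≤ K then 0 else 1) ≤
      n / K ^ 2 := by
  rw [le_div_iff₀ (by positivity), ← sum_sq_sum_spin n, Finset.sum_mul]
  refine Finset.sum_le_sum fun x _ => ?_
  rw [mul_assoc]
  refine mul_le_mul_of_nonneg_left ?_ (by positivity)
  split_ifs with h
  · rw [zero_mul]; positivity
  · rw [one_mul, ← sq_abs (∑ u, spin x u)]
    exact pow_le_pow_left₀ hK.le (not_le.1 h).le 2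

theorem sum_half_pow (n : ℕ) : ∑ _x : Fin n → Fin 2, (1 / 2 : ℝ) ^ n = 1 := by
  simp only [Finset.sum_const, Finset.card_univ, Fintype.card_fun, Fintype.card_fin, nsmul_eq_mul]
  push_cast
  rw [← mul_pow]
  norm_num

theorem SSBM_apply (n : ℕ) (A B : unitInterval) (x : Fin n → Fin 2) (G : SimpleGraph (Fin n)) :
    SSBM n 2 A B (x, G) = ENNReal.ofReal ((1 / 2) ^ n * graphWeight (prob A B x) G) := by
  classical
  have hlabel : labelLaw n (PMF.uniformOfFintype (Fin 2)) x = ENNReal.ofReal ((1 / 2) ^ n) := by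
    rw [labelLaw, PMF.ofFintype_apply]
    simp only [PMF.uniformOfFintype_apply, Fintype.card_fin, Finset.prod_const, Finset.card_univ]
    rw [ENNReal.ofReal_pow (by norm_num), one_div, ENNReal.ofReal_inv_of_pos (by norm_num)]
    norm_num
  have hgraph : graphLaw n (fun u v => if (s(x u, x v) : Sym2 (Fin 2)).IsDiag then A else B) G =
      ENNReal.ofReal (graphWeight (prob A B x) G) := by
    rw [graphLaw, PMF.ofFintype_apply, graphWeight, ENNReal.ofReal_prod_of_nonneg]
    · unfold pairs
      refine Finset.prod_congr (by congr) fun e _ => ?_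
      congr 1
      simp only [Sym2.mk_isDiag_iff, prob]
      split_ifs <;> rfl
    · intro e _
      have h1 : 0 ≤ prob (A : ℝ) B x e.1 e.2 := prob_nonneg A.2.1 B.2.1 _ _
      have h2 : prob (A : ℝ) B x e.1 e.2 ≤ 1 := prob_le A.2.2 B.2.2 _ _
      split_ifs <;> linarith
  rw [SSBM, SBM, PMF.bind_apply, tsum_eq_single x]
  · rw [PMF.map_apply, tsum_eq_single G]
    · rw [if_pos rfl, hlabel, hgraph, ENNReal.ofReal_mul (by positivity)]
    · intro G' hG'
      rw [if_neg]
      simpa using hG'.symm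
  · intro x' hx'
    rw [PMF.map_apply]
    rw [ENNReal.tsum_eq_zero.2, mul_zero]
    intro G'
    rw [if_neg]
    simp [hx'.symm]

/-- From here on the model is a finite real sum over labels and graphs, and all estimates are made
for given labels. -/
theorem successProb_eq {n : ℕ} (A B : unitInterval)
    (Xhat : SimpleGraph (Fin n) → PMF (Fin n → Fin 2)) :
    successProb (SSBM n 2 A B) Xhat = ENNReal.ofReal (∑ x : Fin n → Fin 2, (1 / 2 : ℝ) ^ n *
      graphMean (prob A B x) fun G =>
        ((Xhat G).toOuterMeasure {y | agreement x y = 1}).toReal) := by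
  have hle : ∀ x G, (Xhat G).toOuterMeasure {y | agreement x y = 1} ≤ 1 := by
    intro x G
    rw [PMF.toOuterMeasure_apply]
    refine le_trans (ENNReal.tsum_le_tsum fun y => Set.indicator_le_self _ _ y) ?_
    rw [PMF.tsum_coe]
  have hgw : ∀ (x : Fin n → Fin 2) (G : SimpleGraph (Fin n)),
      0 ≤ graphWeight (prob (A : ℝ) B x) G := fun x G =>
    graphWeight_nonneg (prob_nonneg A.2.1 B.2.1) (prob_le A.2.2 B.2.2) G
  simp only [graphMean]
  rw [successProb, PMF.toOuterMeasure_bind_apply, tsum_fintype, Fintype.sum_prod_type,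
    ENNReal.ofReal_sum_of_nonneg fun x _ => mul_nonneg (by positivity)
      (Finset.sum_nonneg fun G _ => mul_nonneg (hgw x G) ENNReal.toReal_nonneg)]
  refine Finset.sum_congr rfl fun x _ => ?_
  rw [Finset.mul_sum, ENNReal.ofReal_sum_of_nonneg fun G _ => mul_nonneg (by positivity)
    (mul_nonneg (hgw x G) ENNReal.toReal_nonneg)]
  refine Finset.sum_congr rfl fun G _ => ?_
  rw [SSBM_apply, PMF.toOuterMeasure_map_apply, ← mul_assoc, ENNReal.ofReal_mul
    (mul_nonneg (by positivity) (hgw x G)),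
    ENNReal.ofReal_toReal (ne_top_of_le_ne_top ENNReal.one_ne_top (hle x G))]
  rfl

theorem agreement_eq_one_iff {n k : ℕ} (hn : 0 < n) (x y : Fin n → Fin k) :
    agreement x y = 1 ↔ ∃ π : Equiv.Perm (Fin k), ∀ i, x i = π (y i) := by
  have hnR : (0 : ℝ) < n := by exact_mod_cast hn
  have hle : ∀ π : Equiv.Perm (Fin k),
      (1 / (n : ℝ)) * ∑ i, (if x i = π (y i) then 1 else 0) ≤ 1 := by
    intro π
    rw [one_div, inv_mul_le_iff₀ hnR, mul_one]
    calc ∑ i, (if x i = π (y i) then (1 : ℝ) else 0) ≤ ∑ _i : Fin n, (1 : ℝ) :=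
          Finset.sum_le_sum fun i _ => by split_ifs <;> norm_num
      _ = n := by simp
  constructor
  · intro h
    obtain ⟨π, -, hπ⟩ := Finset.exists_mem_eq_sup' (Finset.univ_nonempty)
      fun π : Equiv.Perm (Fin k) => (1 / (n : ℝ)) * ∑ i, if x i = π (y i) then (1 : ℝ) else 0
    refine ⟨π, ?_⟩
    rw [agreement, hπ, one_div, inv_mul_eq_one₀ hnR.ne'] at h
    by_contra! hcon
    obtain ⟨i, hi⟩ := hcon
    have : ∑ i, (if x i = π (y i) then (1 : ℝ) else 0) < ∑ _i : Fin n, (1 : ℝ) := by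
      refine Finset.sum_lt_sum (fun i _ => by split_ifs <;> norm_num) ⟨i, Finset.mem_univ i, ?_⟩
      rw [if_neg hi]; norm_num
    simp only [Finset.sum_const, Finset.card_univ, Fintype.card_fin, nsmul_eq_mul, mul_one] at this
    linarith
  · rintro ⟨π, hπ⟩
    refine le_antisymm (Finset.sup'_le _ _ fun π _ => hle π) ?_
    refine le_trans (le_of_eq ?_) (Finset.le_sup' _ (Finset.mem_univ π))
    simp [hπ, hnR.ne']

theorem logProb_eventually {c : ℝ} (hc : 0 ≤ c) :
    ∀ᶠ n : ℕ in atTop, ((logProb c n : unitInterval) : ℝ) = c * Real.log n / n := by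
  have hlogn : Tendsto (fun n : ℕ => c * (Real.log n / n)) atTop (𝓝 (c * 0)) :=
    (Real.isLittleO_log_id_atTop.tendsto_div_nhds_zero.comp
      (tendsto_natCast_atTop_atTop (R := ℝ))).const_mul c
  filter_upwards [hlogn.eventually (eventually_le_nhds (by simp : c * 0 < 1))] with n hn
  have h0 : 0 ≤ c * Real.log n / n :=
    div_nonneg (mul_nonneg hc (Real.log_natCast_nonneg n)) (Nat.cast_nonneg n)
  rw [logProb, Set.projIcc_of_mem zero_le_one ⟨h0, by rw [mul_div_assoc]; exact hn⟩]

theorem graphProb_not {n : ℕ} (q : Fin n → Fin n → ℝ) (E : SimpleGraph (Fin n) → Prop) :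
    graphProb q (fun G => ¬ E G) = 1 - graphProb q E := by
  rw [← graphMean_one q, graphProb, graphProb, graphMean, graphMean, graphMean,
    ← Finset.sum_sub_distrib]
  refine Finset.sum_congr rfl fun G _ => ?_
  by_cases h : E G <;> simp [h]

theorem successProb_le_one {n k : ℕ} (P : PMF ((Fin n → Fin k) × SimpleGraph (Fin n)))
    (Xhat : SimpleGraph (Fin n) → PMF (Fin n → Fin k)) : successProb P Xhat ≤ 1 := by
  rw [successProb, PMF.toOuterMeasure_apply]
  refine le_trans (ENNReal.tsum_le_tsum fun y => Set.indicator_le_self _ _ y) ?_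
  rw [PMF.tsum_coe]

/-- The machine writes `1` for spin +1 whereas `spin` is +1 at label `0`, hence the minus sign; a
global sign is only a relabelling. After at least one vote all entries are `0` or `1`, so the output
consists of labels. -/
theorem exists_recovery_output (r : Bool) {n : ℕ} (G : SimpleGraph (Fin n)) :
    ∃ y : Fin n → Fin 2, (∃ t s, Runs (recoveryProgram r) (inputMemory G) t s ∧
      t ≤ recoveryTime.eval n ∧ ∀ u : Fin n, s.arr 1 u = (y u : ℕ)) ∧
      ∃ L, IsBestLabel n (edge n ((inputMemory G).arr 0)) L ∧
        ∀ u : Fin n, machineSpin ((vote n (edge n ((inputMemory G).arr 0)) r)^[2 * n] L) u =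
          -spin y u := by
  obtain ⟨t, s, hr, ht, L, hL, hs⟩ := halts_recoveryProgram r (n := n) (s := inputMemory G)
    (by simp [inputMemory]) (by simp [inputMemory]) (by simp [inputMemory])
    (by simp [inputMemory]) rfl
  set e := edge n ((inputMemory G).arr 0)
  have hlt : ∀ u : Fin n, (vote n e r)^[2 * n] L u < 2 := by
    intro u
    have hn : 2 * n = (2 * n - 1) + 1 := by have := u.pos; omega
    rw [hn, Function.iterate_succ_apply']
    simp only [vote]
    split_ifs <;> norm_num
  refine ⟨fun u => ⟨(vote n e r)^[2 * n] L u, hlt u⟩, ⟨t, s, hr, ht, fun u => hs u u.2⟩, L, hL,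
    fun u => ?_⟩
  simp only [machineSpin, spin, Fin.ext_iff, Fin.val_zero]
  split_ifs <;> simp_all

theorem exists_perm_of_spin {n : ℕ} {x y : Fin n → Fin 2} {t : ℝ} (ht : t = 1 ∨ t = -1)
    (h : ∀ u, -spin y u = t * spin x u) : ∃ π : Equiv.Perm (Fin 2), ∀ u, x u = π (y u) := by
  have hspin : ∀ i j : Fin 2, (if i = 0 then (1 : ℝ) else -1) = (if j = 0 then 1 else -1) →
      i = j := by
    intro i j hij
    fin_cases i <;> fin_cases j <;> first | rfl | norm_num at hij
  have hspin' : ∀ i j : Fin 2, (if i = 0 then (1 : ℝ) else -1) = -(if j = 0 then 1 else -1) →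
      i = Equiv.swap 0 1 j := by
    intro i j hij
    fin_cases i <;> fin_cases j <;> first | rfl | norm_num at hij
  rcases ht with rfl | rfl
  · refine ⟨Equiv.swap 0 1, fun u => hspin' _ _ ?_⟩
    have := h u
    simp only [spin] at this
    linarith
  · refine ⟨1, fun u => hspin _ _ ?_⟩
    have := h u
    simp only [spin] at this
    rw [Equiv.Perm.one_apply]
    linarith

theorem efficientlySolvable_of_threshold_lt {a b : ℝ} (ha : 0 ≤ a) (hb : 0 ≤ b)
    (h : √2 < |√a - √b|) :
    ExactRecoveryEfficientlySolvable fun n => SSBM n 2 (logProb a n) (logProb b n) := by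
  classical
  obtain ⟨r, ε₀, err', hε₀, herr', hrec'⟩ := exists_recovery_bound ha hb h
  set err : ℕ → ℝ := fun n => |err' n|
  have herr : Tendsto err atTop (𝓝 0) := by simpa [err] using herr'.abs
  have hrec := hrec'.mono fun n hn x hx => (hn x hx).trans (le_abs_self (err' n))
  choose f hf hL using fun (n : ℕ) (G : SimpleGraph (Fin n)) => exists_recovery_output r G
  refine ⟨recoveryProgram r, f, ⟨recoveryTime, hf⟩, ?_⟩
  have hlim : Tendsto (fun n : ℕ => ENNReal.ofReal (1 - err n - 1 / ε₀ ^ 2 * (1 / (n : ℝ))))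
      atTop (𝓝 1) := by
    have h1 : Tendsto (fun n : ℕ => 1 - err n - 1 / ε₀ ^ 2 * (1 / (n : ℝ))) atTop (𝓝 1) := by
      have h2 := (herr.const_sub 1).sub
        ((tendsto_one_div_atTop_nhds_zero_nat (𝕜 := ℝ)).const_mul (1 / ε₀ ^ 2))
      rwa [mul_zero, sub_zero, sub_zero] at h2
    simpa using ENNReal.tendsto_ofReal h1
  refine tendsto_of_tendsto_of_tendsto_of_le_of_le' hlim tendsto_const_nhds ?_
    (Eventually.of_forall fun n => successProb_le_one _ _)
  filter_upwards [hrec, logProb_eventually ha, logProb_eventually hb, eventually_gt_atTop 0]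
    with n hn hpa hpb hn0
  have hnR : (0 : ℝ) < n := by exact_mod_cast hn0
  rw [successProb_eq]
  refine ENNReal.ofReal_le_ofReal ?_
  set A := logProb a n
  set B := logProb b n
  rw [← hpa, ← hpb] at hn
  have h0 : ∀ (x : Fin n → Fin 2) u v, 0 ≤ prob (A : ℝ) B x u v :=
    fun x => prob_nonneg A.2.1 B.2.1
  have h1 : ∀ (x : Fin n → Fin 2) u v, prob (A : ℝ) B x u v ≤ 1 := fun x => prob_le A.2.2 B.2.2
  -- For unbalanced labels the bound degenerates to the trivial one; Chebyshev's inequality makes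
  -- their total weight small.
  have hx : ∀ x : Fin n → Fin 2, (1 / 2 : ℝ) ^ n * (1 - err n) -
      (1 / 2) ^ n * (if |∑ u, spin x u| ≤ ε₀ * n then 0 else 1) * (1 - err n) ≤
      (1 / 2) ^ n * graphMean (prob (A : ℝ) B x) fun G =>
        ((PMF.pure (f n G)).toOuterMeasure {y | agreement x y = 1}).toReal := by
    intro x
    have hmean : graphProb (prob (A : ℝ) B x) (fun G => agreement x (f n G) = 1) =
        graphMean (prob (A : ℝ) B x) fun G =>
        ((PMF.pure (f n G)).toOuterMeasure {y | agreement x y = 1}).toReal := by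
      rw [graphProb]
      congr 1
      ext G
      rw [PMF.toOuterMeasure_pure_apply]
      by_cases hG : agreement x (f n G) = 1 <;> simp [hG]
    rw [← hmean]
    split_ifs with hbal
    · rw [mul_zero, zero_mul, sub_zero]
      refine mul_le_mul_of_nonneg_left ?_ (by positivity)
      have h2 := hn x hbal
      rw [graphProb_not] at h2
      refine le_trans (by linarith) (graphProb_mono (h0 x) (h1 x) fun G hG => ?_)
      · obtain ⟨L, hL1, hL2⟩ := hL n G
        obtain ⟨t, ht, hu⟩ := hG L hL1
        rw [agreement_eq_one_iff hn0]
        exact exists_perm_of_spin ht fun u => by rw [← hL2, hu]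
    · rw [mul_one, sub_self]
      exact mul_nonneg (by positivity) (graphProb_nonneg (h0 x) (h1 x) _)
  refine le_trans ?_ (Finset.sum_le_sum fun x _ => hx x)
  rw [Finset.sum_sub_distrib, ← Finset.sum_mul, ← Finset.sum_mul, sum_half_pow]
  have hcheb := sum_unbalanced_le n (show 0 < ε₀ * n by positivity)
  have e1 : (n : ℝ) / (ε₀ * n) ^ 2 = 1 / ε₀ ^ 2 * (1 / n) := by field_simp
  rw [e1] at hcheb
  set U := ∑ x : Fin n → Fin 2, (1 / 2 : ℝ) ^ n * (if |∑ u, spin x u| ≤ ε₀ * n then 0 else 1)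
    with hU
  have hU0 : 0 ≤ U := Finset.sum_nonneg fun x _ => mul_nonneg (by positivity) (by
    split_ifs <;> norm_num)
  have herr0 : 0 ≤ err n := abs_nonneg _
  nlinarith

theorem solvable_of_efficientlySolvable {k : ℕ}
    {P : ∀ n : ℕ, PMF ((Fin n → Fin k) × SimpleGraph (Fin n))}
    (h : ExactRecoveryEfficientlySolvable P) : ExactRecoverySolvable P := by
  obtain ⟨-, f, -, hf⟩ := h
  exact ⟨_, hf⟩

/-! ### The law of the neighbourhoods of one or two vertices. -/

section Star

variable {n : ℕ} {q : Fin n → Fin n → ℝ}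

/-- A factor `t w` for the pair of `v` with `w`, and the factor `1` for the other pairs. -/
def starFactor (v : Fin n) (t : Fin n → ℝ) (e : Fin n × Fin n) : ℝ :=
  if e.1 = v then t e.2 else if e.2 = v then t e.1 else 1

theorem prod_starFactor (v : Fin n) (t : Fin n → ℝ) :
    ∏ e ∈ pairs n, starFactor v t e = ∏ w ∈ Finset.univ.erase v, t w := by
  classical
  have h1 : ∏ e ∈ pairs n, starFactor v t e =
      ∏ e ∈ (pairs n).filter (fun e => e.1 = v ∨ e.2 = v), starFactor v t e := by
    refine (Finset.prod_filter_of_ne fun e _ he => ?_).symm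
    by_contra! hcon
    exact he (by simp [starFactor, hcon.1, hcon.2])
  rw [h1]
  refine Finset.prod_nbij' (fun e => if e.1 = v then e.2 else e.1)
    (fun w => if v < w then (v, w) else (w, v)) ?_ ?_ ?_ ?_ ?_
  · rintro ⟨c, d⟩ he
    simp only [pairs, Finset.mem_filter, Finset.mem_univ, true_and, Finset.mem_erase, and_true]
      at he ⊢
    grind
  · intro w hw
    simp only [pairs, Finset.mem_filter, Finset.mem_univ, true_and, Finset.mem_erase, and_true]
      at hw ⊢
    grind
  · rintro ⟨c, d⟩ he
    simp only [pairs, Finset.mem_filter, Finset.mem_univ, true_and] at he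
    grind
  · intro w hw
    simp only [Finset.mem_univ, Finset.mem_erase, and_true] at hw
    grind
  · rintro ⟨c, d⟩ he
    simp only [pairs, Finset.mem_filter, Finset.mem_univ, true_and] at he
    simp only [starFactor]
    grind

/-- The probability that the set of neighbours of `v` is `R`. -/
def starWeight (q : Fin n → Fin n → ℝ) (v : Fin n) (R : Finset (Fin n)) : ℝ :=
  ∏ w ∈ Finset.univ.erase v, if w ∈ R then q v w else 1 - q v w

/-- The indicator of `s` as a real function. -/
def indic (s : Finset (Fin n)) (w : Fin n) : ℝ := if w ∈ s then 1 else 0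

-- One factor per pair brings the event into the form to which `graphMean_prod` applies. A
-- neighbourhood that misses `v` fails to be `R` because of a single pair at `v`.
open scoped Classical in
theorem star_indicator {v : Fin n} {R : Finset (Fin n)} (hv : v ∉ R) (G : SimpleGraph (Fin n)) :
    (if ∀ w, G.Adj v w ↔ w ∈ R then (1 : ℝ) else 0) = ∏ e ∈ pairs n,
      if G.Adj e.1 e.2 then starFactor v (indic R) e else starFactor v (indic Rᶜ) e := by
  split_ifs with h
  · refine (Finset.prod_eq_one fun e _ => ?_).symm
    by_cases h1 : e.1 = v
    · have := h e.2
      simp only [starFactor, h1, if_true, indic, Finset.mem_compl]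
      split_ifs <;> simp_all
    · by_cases h2 : e.2 = v
      · have := h e.1
        simp only [starFactor, h1, h2, if_true, if_false, indic, Finset.mem_compl]
        rw [G.adj_comm] at this
        split_ifs <;> simp_all
      · simp [starFactor, h1, h2]
  · push Not at h
    obtain ⟨w, hw⟩ := h
    have hne : w ≠ v := by
      rintro rfl
      simp [hv] at hw
    rcases lt_or_gt_of_ne hne with hlt | hlt
    · refine (Finset.prod_eq_zero (i := (w, v)) (by simp [pairs, hlt]) ?_).symm
      simp only [starFactor, hne, if_true, if_false, indic, Finset.mem_compl]
      rw [G.adj_comm]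
      rcases hw with hw | hw <;> simp [hw.1, hw.2]
    · refine (Finset.prod_eq_zero (i := (v, w)) (by simp [pairs, hlt]) ?_).symm
      simp only [starFactor, if_true, indic, Finset.mem_compl]
      rcases hw with hw | hw <;> simp [hw.1, hw.2]

theorem star_mean_factor (hq : ∀ u v, q u v = q v u) (v : Fin n) (R : Finset (Fin n))
    (e : Fin n × Fin n) :
    q e.1 e.2 * starFactor v (indic R) e + (1 - q e.1 e.2) * starFactor v (indic Rᶜ) e =
      starFactor v (fun w => if w ∈ R then q v w else 1 - q v w) e := by
  by_cases h1 : e.1 = v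
  · simp only [starFactor, h1, if_true, indic, Finset.mem_compl]
    split_ifs <;> simp_all
  · by_cases h2 : e.2 = v
    · simp only [starFactor, h1, h2, if_true, if_false, indic, Finset.mem_compl]
      rw [hq e.1 v]
      split_ifs <;> simp_all
    · simp [starFactor, h1, h2]

theorem graphProb_star (hq : ∀ u v, q u v = q v u) {v : Fin n} {R : Finset (Fin n)}
    (hv : v ∉ R) : graphProb q (fun G => ∀ w, G.Adj v w ↔ w ∈ R) = starWeight q v R := by
  classical
  have h := graphMean_prod q (starFactor v (indic R)) (starFactor v (indic Rᶜ))
  rw [graphProb, starWeight, ← prod_starFactor]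
  rw [Finset.prod_congr rfl fun e _ => star_mean_factor hq v R e] at h
  rw [← h]
  congr 1
  ext G
  convert star_indicator hv G

/-- The two stars share only the pair `u`, `v`, which both events force to be a non-edge. Its factor
`1 - q u v` occurs once in the joint probability and twice in the product. -/
theorem graphProb_star_and_star (hq : ∀ u v, q u v = q v u) {u v : Fin n} (huv : u ≠ v)
    {R R' : Finset (Fin n)} (hu : u ∉ R) (hv : v ∉ R) (hu' : u ∉ R') (hv' : v ∉ R') :
    graphProb q (fun G => (∀ w, G.Adj u w ↔ w ∈ R) ∧ ∀ w, G.Adj v w ↔ w ∈ R') * (1 - q u v) =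
      starWeight q u R * starWeight q v R' := by
  classical
  have h := graphMean_prod q (fun e => starFactor u (indic R) e * starFactor v (indic R') e)
    (fun e => starFactor u (indic Rᶜ) e * starFactor v (indic R'ᶜ) e)
  have h1 : 1 - q u v =
      ∏ e ∈ pairs n, starFactor u (fun w => if w = v then 1 - q u v else 1) e := by
    rw [prod_starFactor, Finset.prod_ite_eq', if_pos (by simp [huv.symm])]
  have h2 : graphProb q (fun G => (∀ w, G.Adj u w ↔ w ∈ R) ∧ ∀ w, G.Adj v w ↔ w ∈ R') =
      ∏ e ∈ pairs n, (q e.1 e.2 * (starFactor u (indic R) e * starFactor v (indic R') e) +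
        (1 - q e.1 e.2) * (starFactor u (indic Rᶜ) e * starFactor v (indic R'ᶜ) e)) := by
    rw [← h, graphProb]
    congr 1
    ext G
    have e1 := star_indicator hu G
    have e2 := star_indicator hv' G
    rw [Finset.prod_congr rfl fun e _ => show _ = (if G.Adj e.1 e.2 then starFactor u (indic R) e
      else starFactor u (indic Rᶜ) e) * (if G.Adj e.1 e.2 then starFactor v (indic R') e
      else starFactor v (indic R'ᶜ) e) by split_ifs <;> rfl, Finset.prod_mul_distrib, ← e1, ← e2]
    by_cases c1 : ∀ w, G.Adj u w ↔ w ∈ R <;> by_cases c2 : ∀ w, G.Adj v w ↔ w ∈ R' <;>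
      simp [c1, c2]
  rw [h2, starWeight, starWeight, ← prod_starFactor, ← prod_starFactor]
  conv_lhs => rw [h1]
  rw [← Finset.prod_mul_distrib, ← Finset.prod_mul_distrib]
  refine Finset.prod_congr rfl fun e he => ?_
  rw [← star_mean_factor hq, ← star_mean_factor hq]
  have hne : e.1 ≠ e.2 := ne_of_lt (by simpa [pairs] using he)
  obtain ⟨c, d⟩ := e
  simp only at hne ⊢
  by_cases c1 : c = u
  · subst c1
    by_cases d1 : d = v
    · subst d1
      simp [starFactor, indic, huv, hv, hu']
    · simp [starFactor, indic, huv, d1]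
  · by_cases c2 : c = v
    · subst c2
      by_cases d1 : d = u
      · subst d1
        simp [starFactor, indic, huv.symm, hv, hu', hq]
      · simp [starFactor, c1, d1]
    · by_cases d1 : d = u
      · subst d1
        simp [starFactor, c1, c2, huv]
      · simp [starFactor, c1, d1]

end Star

/-! ### The second moment method for neighbourhoods. -/

section SecondMoment

variable {n : ℕ} {q : Fin n → Fin n → ℝ}

open scoped Classical in
/-- The second moment method for events that are pairwise almost independent. -/
theorem graphProb_forall_not_le (h0 : ∀ u v, 0 ≤ q u v) (h1 : ∀ u v, q u v ≤ 1) {ι : Type*}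
    (s : Finset ι) (E : ι → SimpleGraph (Fin n) → Prop) {c : ℝ} (hc : 0 ≤ c)
    (hE : ∀ i ∈ s, ∀ j ∈ s, i ≠ j → graphProb q (fun G => E i G ∧ E j G) ≤
      c * (graphProb q (E i) * graphProb q (E j)))
    (hμ : 0 < ∑ i ∈ s, graphProb q (E i)) :
    graphProb q (fun G => ∀ i ∈ s, ¬ E i G) ≤ 1 / (∑ i ∈ s, graphProb q (E i)) + (c - 1) := by
  set μ := ∑ i ∈ s, graphProb q (E i) with hμdef
  set Z : SimpleGraph (Fin n) → ℝ := fun G => ∑ i ∈ s, if E i G then 1 else 0 with hZ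
  have hEZ : graphMean q Z = μ := graphMean_sum s _
  have hEZ2 : graphMean q (fun G => Z G ^ 2) ≤ μ + c * μ ^ 2 := by
    have e1 : ∀ G, Z G ^ 2 = ∑ i ∈ s, ∑ j ∈ s, if E i G ∧ E j G then (1 : ℝ) else 0 := by
      intro G
      rw [hZ, sq, Finset.sum_mul_sum]
      refine Finset.sum_congr rfl fun i _ => Finset.sum_congr rfl fun j _ => ?_
      by_cases c1 : E i G <;> by_cases c2 : E j G <;> simp [c1, c2]
    simp only [e1]
    rw [graphMean_sum]
    simp only [graphMean_sum]
    have e2 : μ + c * μ ^ 2 = ∑ i ∈ s, ∑ j ∈ s, ((if i = j then graphProb q (E i) else 0) +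
        c * (graphProb q (E i) * graphProb q (E j))) := by
      simp only [Finset.sum_add_distrib, Finset.sum_ite_eq]
      rw [sq, hμdef, Finset.sum_mul_sum, Finset.mul_sum]
      congr 1
      · exact Finset.sum_congr rfl fun i hi => by rw [if_pos hi]
      · exact Finset.sum_congr rfl fun i _ => Finset.mul_sum _ _ _
    rw [e2]
    refine Finset.sum_le_sum fun i hi => Finset.sum_le_sum fun j hj => ?_
    have hnn := mul_nonneg hc (mul_nonneg (graphProb_nonneg h0 h1 (E i))
      (graphProb_nonneg h0 h1 (E j)))
    by_cases hij : i = j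
    · subst hij
      simp only [and_self, if_true]
      exact le_add_of_nonneg_right hnn
    · rw [if_neg hij, zero_add]
      have hij' := hE i hi j hj hij
      rw [graphProb] at hij'
      exact le_trans (le_of_eq (by congr!)) hij'
  -- Chebyshev's inequality: the indicator of Z = 0 is at most (Z/μ - 1)², expanded so that
  -- linearity of the mean applies.
  have hle : graphProb q (fun G => ∀ i ∈ s, ¬ E i G) ≤
      graphMean q fun G => (1 / μ ^ 2) * Z G ^ 2 + ((-2 / μ) * Z G + 1) := by
    have hsq : ∀ G, (1 / μ ^ 2) * Z G ^ 2 + ((-2 / μ) * Z G + 1) = (Z G / μ - 1) ^ 2 := by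
      intro G
      field_simp
      ring
    refine graphProb_le_graphMean h0 h1 (fun G => ?_) fun G hG => ?_
    · rw [hsq]; positivity
    · have : Z G = 0 := Finset.sum_eq_zero fun i hi => if_neg (hG i hi)
      rw [this]; norm_num
  refine hle.trans ?_
  have hadd : ∀ F F' : SimpleGraph (Fin n) → ℝ,
      graphMean q (fun G => F G + F' G) = graphMean q F + graphMean q F' := by
    intro F F'
    simp only [graphMean, mul_add, Finset.sum_add_distrib]
  rw [hadd, hadd, graphMean_const_mul, graphMean_const_mul, graphMean_one, hEZ]
  have : 1 / μ ^ 2 * graphMean q (fun G => Z G ^ 2) ≤ 1 / μ ^ 2 * (μ + c * μ ^ 2) :=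
    mul_le_mul_of_nonneg_left hEZ2 (by positivity)
  have e3 : 1 / μ ^ 2 * (μ + c * μ ^ 2) = 1 / μ + c := by field_simp
  have e4 : -2 / μ * μ = -2 := by field_simp
  linarith

open scoped Classical in
theorem exists_star_indicator (v : Fin n) (𝓡 : Finset (Finset (Fin n)))
    (G : SimpleGraph (Fin n)) :
    (if ∃ R ∈ 𝓡, ∀ w, G.Adj v w ↔ w ∈ R then (1 : ℝ) else 0) =
      ∑ R ∈ 𝓡, if ∀ w, G.Adj v w ↔ w ∈ R then 1 else 0 := by
  split_ifs with h
  · obtain ⟨R, hR, hG⟩ := h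
    rw [Finset.sum_eq_single R]
    · rw [if_pos hG]
    · intro R' _ hne
      rw [if_neg]
      intro h
      exact hne (Finset.ext fun w => (h w).symm.trans (hG w))
    · exact fun h => absurd hR h
  · refine (Finset.sum_eq_zero fun R hR => if_neg fun hG => h ⟨R, hR, hG⟩).symm

theorem graphProb_exists_star (hq : ∀ u v, q u v = q v u) {v : Fin n}
    {𝓡 : Finset (Finset (Fin n))} (hv : ∀ R ∈ 𝓡, v ∉ R) :
    graphProb q (fun G => ∃ R ∈ 𝓡, ∀ w, G.Adj v w ↔ w ∈ R) = ∑ R ∈ 𝓡, starWeight q v R := by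
  classical
  rw [graphProb, ← Finset.sum_congr rfl fun R hR => graphProb_star hq (hv R hR)]
  unfold graphProb
  rw [← graphMean_sum]
  congr 1
  ext G
  convert exists_star_indicator v 𝓡 G

theorem graphProb_exists_star_and (h0 : ∀ u v, 0 ≤ q u v) (h1 : ∀ u v, q u v ≤ 1)
    (hq : ∀ u v, q u v = q v u) {u v : Fin n} (huv : u ≠ v) (hlt : q u v < 1)
    {𝓡 𝓡' : Finset (Finset (Fin n))} (hu : ∀ R ∈ 𝓡, u ∉ R ∧ v ∉ R)
    (hv : ∀ R ∈ 𝓡', u ∉ R ∧ v ∉ R) :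
    graphProb q (fun G => (∃ R ∈ 𝓡, ∀ w, G.Adj u w ↔ w ∈ R) ∧
        ∃ R ∈ 𝓡', ∀ w, G.Adj v w ↔ w ∈ R) ≤
      1 / (1 - q u v) * (graphProb q (fun G => ∃ R ∈ 𝓡, ∀ w, G.Adj u w ↔ w ∈ R) *
        graphProb q (fun G => ∃ R ∈ 𝓡', ∀ w, G.Adj v w ↔ w ∈ R)) := by
  classical
  have hlt' : 0 < 1 - q u v := by linarith
  rw [graphProb_exists_star hq fun R hR => (hu R hR).1,
    graphProb_exists_star hq fun R hR => (hv R hR).2, Finset.sum_mul_sum, Finset.mul_sum]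
  have hle : graphProb q (fun G => (∃ R ∈ 𝓡, ∀ w, G.Adj u w ↔ w ∈ R) ∧
      ∃ R ∈ 𝓡', ∀ w, G.Adj v w ↔ w ∈ R) ≤ ∑ R ∈ 𝓡, ∑ R' ∈ 𝓡',
        graphProb q (fun G => (∀ w, G.Adj u w ↔ w ∈ R) ∧ ∀ w, G.Adj v w ↔ w ∈ R') := by
    rw [← Finset.sum_product']
    refine le_trans (graphProb_mono h0 h1 fun G hG => ?_) (graphProb_exists_le h0 h1 (𝓡 ×ˢ 𝓡')
      fun P G => (∀ w, G.Adj u w ↔ w ∈ P.1) ∧ ∀ w, G.Adj v w ↔ w ∈ P.2)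
    obtain ⟨⟨R, hR, hG⟩, R', hR', hG'⟩ := hG
    exact ⟨(R, R'), Finset.mem_product.2 ⟨hR, hR'⟩, hG, hG'⟩
  refine hle.trans (le_of_eq (Finset.sum_congr rfl fun R hR => ?_))
  rw [Finset.mul_sum]
  refine Finset.sum_congr rfl fun R' hR' => ?_
  rw [← graphProb_star_and_star hq huv (hu R hR).1 (hu R hR).2 (hv R' hR').1 (hv R' hR').2]
  field_simp

/-- A random graph has, with high probability, a vertex of `H` whose neighbourhood belongs to a
given family, if the neighbourhoods in the families avoid `H`. -/
theorem graphProb_forall_not_exists_star_le (h0 : ∀ u v, 0 ≤ q u v) {ε : ℝ} (hε : ε < 1)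
    (h1 : ∀ u v, q u v ≤ ε) (hq : ∀ u v, q u v = q v u) (H : Finset (Fin n))
    (𝓡 : Fin n → Finset (Finset (Fin n))) (hH : ∀ v, ∀ R ∈ 𝓡 v, Disjoint H R)
    (hμ : 0 < ∑ v ∈ H, ∑ R ∈ 𝓡 v, starWeight q v R) :
    graphProb q (fun G => ∀ v ∈ H, ¬ ∃ R ∈ 𝓡 v, ∀ w, G.Adj v w ↔ w ∈ R) ≤
      1 / (∑ v ∈ H, ∑ R ∈ 𝓡 v, starWeight q v R) + (1 / (1 - ε) - 1) := by
  have h1' : ∀ u v, q u v ≤ 1 := fun u v => (h1 u v).trans hε.le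
  have hmem : ∀ v ∈ H, ∀ w, ∀ R ∈ 𝓡 w, v ∉ R := fun v hv w R hR =>
    Finset.disjoint_left.1 (hH w R hR) hv
  have hsum : ∑ v ∈ H, graphProb q (fun G => ∃ R ∈ 𝓡 v, ∀ w, G.Adj v w ↔ w ∈ R) =
      ∑ v ∈ H, ∑ R ∈ 𝓡 v, starWeight q v R :=
    Finset.sum_congr rfl fun v hv => graphProb_exists_star hq (hmem v hv v)
  rw [← hsum] at hμ ⊢
  refine graphProb_forall_not_le h0 h1' H _ (by
    have : 0 < 1 - ε := by linarith
    positivity) (fun u hu v hv huv => ?_) hμ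
  have hlt : q u v < 1 := (h1 u v).trans_lt hε
  refine (graphProb_exists_star_and h0 h1' hq huv hlt
    (fun R hR => ⟨hmem u hu u R hR, hmem v hv u R hR⟩)
    (fun R hR => ⟨hmem u hu v R hR, hmem v hv v R hR⟩)).trans ?_
  refine mul_le_mul_of_nonneg_right ?_ (mul_nonneg (graphProb_nonneg h0 h1' _)
    (graphProb_nonneg h0 h1' _))
  exact one_div_le_one_div_of_le (by linarith) (by linarith [h1 u v])

open scoped Classical in
/-- Changing the edge probabilities at `v` changes the probability of a graph only through the
neighbourhood of `v`. -/
theorem graphWeight_mul_starWeight {q' : Fin n → Fin n → ℝ} (hq : ∀ u v, q u v = q v u)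
    (hq' : ∀ u v, q' u v = q' v u) {v : Fin n}
    (h : ∀ u w, u ≠ v → w ≠ v → q u w = q' u w) (G : SimpleGraph (Fin n)) :
    graphWeight q G * starWeight q' v (Finset.univ.filter fun w => G.Adj v w) =
      graphWeight q' G * starWeight q v (Finset.univ.filter fun w => G.Adj v w) := by
  simp only [starWeight, ← prod_starFactor, graphWeight]
  rw [← Finset.prod_mul_distrib, ← Finset.prod_mul_distrib]
  refine Finset.prod_congr rfl fun e _ => ?_
  simp only [starFactor, Finset.mem_filter, Finset.mem_univ, true_and]
  by_cases c1 : e.1 = v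
  · simp only [c1, if_true]
    ring
  · by_cases c2 : e.2 = v
    · simp only [c1, c2, if_true, if_false, G.adj_comm v, hq v, hq' v]
      ring
    · simp only [c1, c2, if_false, h e.1 e.2 c1 c2]

end SecondMoment

/-! ### Vertices with equally many neighbours in both communities, and the cost of flipping them. -/

section Communities

variable {n : ℕ}

/-- The other vertices in the community of `v`. -/
def inside (x : Fin n → Fin 2) (v : Fin n) : Finset (Fin n) :=
  Finset.univ.filter fun w => w ≠ v ∧ x w = x v

/-- The vertices outside the community of `v`. -/
def outside (x : Fin n → Fin 2) (v : Fin n) : Finset (Fin n) :=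
  Finset.univ.filter fun w => x w ≠ x v

theorem disjoint_inside_outside (x : Fin n → Fin 2) (v : Fin n) :
    Disjoint (inside x v) (outside x v) := by
  rw [Finset.disjoint_left]
  intro w h1 h2
  simp only [inside, outside, Finset.mem_filter] at h1 h2
  exact h2.2 h1.2.2

theorem inside_union_outside (x : Fin n → Fin 2) (v : Fin n) :
    inside x v ∪ outside x v = Finset.univ.erase v := by
  ext w
  simp only [inside, outside, Finset.mem_union, Finset.mem_filter, Finset.mem_univ, true_and,
    Finset.mem_erase, and_true]
  by_cases h : w = v
  · subst h; simp
  · simp [h, em]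

theorem inside_flip (x : Fin n → Fin 2) (v : Fin n) : inside (flip v x) v = outside x v := by
  ext w
  have h2 : ∀ i j : Fin 2, i = j + 1 ↔ i ≠ j := by decide
  by_cases h : w = v
  · subst h; simp [inside, outside]
  · simp [inside, outside, flip, h, h2]

theorem outside_flip (x : Fin n → Fin 2) (v : Fin n) : outside (flip v x) v = inside x v := by
  rw [← inside_flip, flip_flip]

theorem card_outside (x : Fin n → Fin 2) (v : Fin n) :
    ((outside x v).card : ℝ) = (n - spin x v * ∑ w, spin x w) / 2 := by
  have h : ∀ w, (if x w ≠ x v then (1 : ℝ) else 0) = (1 - spin x v * spin x w) / 2 := by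
    intro w
    have : ∀ i j : Fin 2, (if j ≠ i then (1 : ℝ) else 0) =
        (1 - (if i = 0 then 1 else -1) * (if j = 0 then 1 else -1)) / 2 := by
      intro i j
      fin_cases i <;> fin_cases j <;> norm_num
    exact this _ _
  rw [outside, Finset.card_filter]
  push_cast
  simp only [h]
  rw [← Finset.sum_div, Finset.sum_sub_distrib, ← Finset.mul_sum]
  simp

theorem card_inside (x : Fin n → Fin 2) (v : Fin n) :
    ((inside x v).card : ℝ) = (n + spin x v * ∑ w, spin x w) / 2 - 1 := by
  have h := congrArg Finset.card (inside_union_outside x v)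
  rw [Finset.card_union_of_disjoint (disjoint_inside_outside x v),
    Finset.card_erase_of_mem (Finset.mem_univ v), Finset.card_univ, Fintype.card_fin] at h
  have hn : 0 < n := v.pos
  have h' : ((inside x v).card : ℝ) + (outside x v).card + 1 = n := by
    exact_mod_cast (by omega : (inside x v).card + (outside x v).card + 1 = n)
  rw [card_outside] at h'
  linarith

theorem starWeight_prob (pa pb : ℝ) (x : Fin n → Fin 2) (v : Fin n) (R : Finset (Fin n)) :
    starWeight (prob pa pb x) v R =
      pa ^ (inside x v ∩ R).card * (1 - pa) ^ (inside x v \ R).card *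
        (pb ^ (outside x v ∩ R).card * (1 - pb) ^ (outside x v \ R).card) := by
  classical
  have key : ∀ (S : Finset (Fin n)) (p : ℝ), ∏ w ∈ S, (if w ∈ R then p else 1 - p) =
      p ^ (S ∩ R).card * (1 - p) ^ (S \ R).card := by
    intro S p
    rw [Finset.prod_ite, Finset.prod_const, Finset.prod_const, Finset.filter_mem_eq_inter,
      Finset.filter_notMem_eq_sdiff]
  rw [starWeight, ← inside_union_outside x v,
    Finset.prod_union (disjoint_inside_outside x v), ← key, ← key]
  congr 1
  · refine Finset.prod_congr rfl fun w hw => ?_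
    have : x w = x v := (Finset.mem_filter.1 hw).2.2
    simp [prob, this]
  · refine Finset.prod_congr rfl fun w hw => ?_
    have : x w ≠ x v := (Finset.mem_filter.1 hw).2
    simp [prob, this.symm]

/-- The neighbourhoods outside `H` that have `j` vertices in each community. -/
def balancedStars (x : Fin n → Fin 2) (H : Finset (Fin n)) (j : ℕ) (v : Fin n) :
    Finset (Finset (Fin n)) :=
  ((inside x v \ H).powersetCard j ×ˢ (outside x v \ H).powersetCard j).image
    fun P => P.1 ∪ P.2

theorem inter_union_of_subset {S T P Q : Finset (Fin n)} (h : Disjoint S T) (hP : P ⊆ S)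
    (hQ : Q ⊆ T) : S ∩ (P ∪ Q) = P := by
  rw [Finset.inter_union_distrib_left, Finset.inter_eq_right.2 hP,
    Finset.disjoint_iff_inter_eq_empty.1 (h.mono_right hQ), Finset.union_empty]

theorem card_balancedStars (x : Fin n → Fin 2) (H : Finset (Fin n)) (j : ℕ) (v : Fin n) :
    (balancedStars x H j v).card =
      (inside x v \ H).card.choose j * (outside x v \ H).card.choose j := by
  rw [balancedStars, Finset.card_image_of_injOn, Finset.card_product, Finset.card_powersetCard,
    Finset.card_powersetCard]
  rintro ⟨P, Q⟩ h ⟨P', Q'⟩ h' heq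
  simp only [Finset.coe_product, Set.mem_prod, Finset.mem_coe, Finset.mem_powersetCard] at h h'
  have hd := disjoint_inside_outside x v
  have hS : inside x v \ H ⊆ inside x v := Finset.sdiff_subset
  have hT : outside x v \ H ⊆ outside x v := Finset.sdiff_subset
  simp only at heq
  have e1 := inter_union_of_subset hd (h.1.1.trans hS) (h.2.1.trans hT)
  have e2 := inter_union_of_subset hd (h'.1.1.trans hS) (h'.2.1.trans hT)
  have e3 := inter_union_of_subset hd.symm (h.2.1.trans hT) (h.1.1.trans hS)
  have e4 := inter_union_of_subset hd.symm (h'.2.1.trans hT) (h'.1.1.trans hS)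
  rw [Finset.union_comm] at e3 e4
  rw [heq] at e1 e3
  rw [Prod.mk.injEq]
  exact ⟨e1.symm.trans e2, e3.symm.trans e4⟩

theorem mem_balancedStars {x : Fin n → Fin 2} {H : Finset (Fin n)} {j : ℕ} {v : Fin n}
    {R : Finset (Fin n)} (hR : R ∈ balancedStars x H j v) :
    Disjoint H R ∧ (inside x v ∩ R).card = j ∧ (outside x v ∩ R).card = j := by
  simp only [balancedStars, Finset.mem_image, Finset.mem_product, Finset.mem_powersetCard] at hR
  obtain ⟨⟨P, Q⟩, ⟨⟨hP, hPj⟩, hQ, hQj⟩, rfl⟩ := hR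
  simp only at hP hPj hQ hQj ⊢
  have hd := disjoint_inside_outside x v
  refine ⟨?_, ?_, ?_⟩
  · rw [Finset.disjoint_union_right]
    exact ⟨(Finset.sdiff_disjoint.mono_left hP).symm, (Finset.sdiff_disjoint.mono_left hQ).symm⟩
  · rw [inter_union_of_subset hd (hP.trans Finset.sdiff_subset) (hQ.trans Finset.sdiff_subset), hPj]
  · rw [Finset.union_comm, inter_union_of_subset hd.symm (hQ.trans Finset.sdiff_subset)
      (hP.trans Finset.sdiff_subset), hQj]

theorem starWeight_balanced (pa pb : ℝ) {x : Fin n → Fin 2} {v : Fin n} {R : Finset (Fin n)}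
    {j : ℕ} (h1 : (inside x v ∩ R).card = j) (h2 : (outside x v ∩ R).card = j) :
    starWeight (prob pa pb x) v R = pa ^ j * pb ^ j *
      ((1 - pa) ^ ((inside x v).card - j) * (1 - pb) ^ ((outside x v).card - j)) := by
  have e1 := Finset.card_inter_add_card_sdiff (inside x v) R
  have e2 := Finset.card_inter_add_card_sdiff (outside x v) R
  rw [starWeight_prob, h1, h2, show (inside x v \ R).card = (inside x v).card - j by omega,
    show (outside x v \ R).card = (outside x v).card - j by omega]
  ring

/-- Exchanging the exponents changes only |s - t| factors, and Bernoulli's inequality keeps a power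
with that exponent at least 1/2. -/
theorem pow_mul_pow_le_two_mul {α β ε : ℝ} (hα : 0 ≤ α) (hβ : 0 ≤ β) (hα' : α ≤ ε)
    (hβ' : β ≤ ε) (hε : ε ≤ 1) {s t : ℕ} (hst : |(s : ℝ) - t| * ε ≤ 1 / 2) :
    (1 - α) ^ s * (1 - β) ^ t ≤ 2 * ((1 - α) ^ t * (1 - β) ^ s) := by
  have key : ∀ {α β : ℝ}, 0 ≤ α → 0 ≤ β → α ≤ ε → β ≤ ε → ∀ s d : ℕ, (d : ℝ) * ε ≤ 1 / 2 →
      (1 - α) ^ s * (1 - β) ^ (s + d) ≤ 2 * ((1 - α) ^ (s + d) * (1 - β) ^ s) := by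
    intro α β hα hβ hα' hβ' s d hd
    have h1 : (1 - β) ^ d ≤ 1 := pow_le_one₀ (by linarith) (by linarith)
    have h2 : 1 / 2 ≤ (1 - α) ^ d := by
      have := one_add_mul_le_pow (show -2 ≤ -α by linarith) d
      have h3 : (d : ℝ) * α ≤ d * ε := mul_le_mul_of_nonneg_left hα' (Nat.cast_nonneg d)
      rw [← sub_eq_add_neg] at this
      linarith
    have h4 : 0 ≤ (1 - α) ^ s * (1 - β) ^ s :=
      mul_nonneg (pow_nonneg (by linarith) s) (pow_nonneg (by linarith) s)
    rw [pow_add, pow_add]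
    nlinarith
  rcases le_total s t with h | h
  · obtain ⟨d, rfl⟩ := Nat.exists_eq_add_of_le h
    refine key hα hβ hα' hβ' s d ?_
    push_cast at hst
    rwa [sub_add_cancel_left, abs_neg, abs_of_nonneg (Nat.cast_nonneg d)] at hst
  · obtain ⟨d, rfl⟩ := Nat.exists_eq_add_of_le h
    have := key hβ hα hβ' hα' t d (by
      push_cast at hst
      rwa [add_sub_cancel_left, abs_of_nonneg (Nat.cast_nonneg d)] at hst)
    linarith

/-- Moving a vertex with as many neighbours inside its community as outside of it to the other
community does not decrease the likelihood much. -/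
theorem graphWeight_le_two_mul_flip {pa pb ε : ℝ} (hpa : 0 ≤ pa) (hpb : 0 ≤ pb) (hpa' : pa ≤ ε)
    (hpb' : pb ≤ ε) (hε : ε < 1) {x : Fin n → Fin 2} {v : Fin n} {j : ℕ}
    (hj : 0 < pa ^ j * pb ^ j) (hbal : (|∑ w, spin x w| + 1) * ε ≤ 1 / 2)
    {G : SimpleGraph (Fin n)} {R : Finset (Fin n)} (hG : ∀ w, G.Adj v w ↔ w ∈ R)
    (h1 : (inside x v ∩ R).card = j) (h2 : (outside x v ∩ R).card = j) :
    graphWeight (prob pa pb x) G ≤ 2 * graphWeight (prob pa pb (flip v x)) G := by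
  classical
  -- The two weights differ only through the star of `v`. There the edges contribute `pa ^ j * pb ^
  -- j` for both labellings, so only the non-edges have to be compared.
  have hw := graphWeight_mul_starWeight (q := prob pa pb x) (q' := prob pa pb (flip v x))
    (v := v) (prob_symm _ _ _) (prob_symm _ _ _) (fun u w hu hw => by simp [prob, flip, hu, hw]) G
  have hN : (Finset.univ.filter fun w => G.Adj v w) = R := by
    ext w
    simp [hG]
  rw [hN, starWeight_balanced pa pb h1 h2, starWeight_balanced pa pb (x := flip v x) (j := j)
    (by rw [inside_flip, h2]) (by rw [outside_flip, h1]), inside_flip, outside_flip] at hw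
  have hi : j ≤ (inside x v).card := h1 ▸ Finset.card_le_card Finset.inter_subset_left
  have ho : j ≤ (outside x v).card := h2 ▸ Finset.card_le_card Finset.inter_subset_left
  have hε0 : 0 ≤ ε := hpa.trans hpa'
  have hst : |(((inside x v).card - j : ℕ) : ℝ) - ((outside x v).card - j : ℕ)| * ε ≤ 1 / 2 := by
    refine le_trans (mul_le_mul_of_nonneg_right ?_ hε0) hbal
    rw [Nat.cast_sub hi, Nat.cast_sub ho, card_inside, card_outside]
    rw [show ((n : ℝ) + spin x v * ∑ w, spin x w) / 2 - 1 - j - ((n - spin x v * ∑ w, spin x w) / 2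
      - j) = spin x v * ∑ w, spin x w - 1 by ring]
    refine (abs_sub _ _).trans ?_
    rw [abs_mul]
    rcases spin_eq_or x v with h | h <;> simp [h]
  have hle := pow_mul_pow_le_two_mul hpa hpb hpa' hpb' hε.le hst
  have hpos : ∀ s t : ℕ, 0 < (1 - pa) ^ s * (1 - pb) ^ t := fun s t =>
    mul_pos (pow_pos (by linarith) s) (pow_pos (by linarith) t)
  have hw' : 0 ≤ graphWeight (prob pa pb (flip v x)) G :=
    graphWeight_nonneg (prob_nonneg hpa hpb) (prob_le (by linarith) (by linarith)) G
  refine le_of_mul_le_mul_right ?_ (mul_pos hj (hpos ((outside x v).card - j)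
    ((inside x v).card - j)))
  rw [hw]
  have := mul_le_mul_of_nonneg_left hle (mul_nonneg hw' hj.le)
  linarith

/-! ### Stirling-type estimates and the probability of a balanced neighbourhood. -/

theorem factorial_mul_exp_le (j : ℕ) :
    (j.factorial : ℝ) * Real.exp j ≤ ((j : ℝ) + 1) ^ (j + 1) := by
  induction j with
  | zero => simp
  | succ j ih =>
    -- This is (1 - 1/(j + 2))^(j + 2) ≤ exp(-1).
    have h1 : Real.exp 1 * ((j : ℝ) + 1) ^ (j + 2) ≤ ((j : ℝ) + 2) ^ (j + 2) := by
      have hp : (0 : ℝ) < (j : ℝ) + 1 := by positivity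
      have hp2 : (0 : ℝ) < (j : ℝ) + 2 := by positivity
      have h2 : 1 - 1 / ((j : ℝ) + 2) ≤ Real.exp (-(1 / ((j : ℝ) + 2))) := by
        have := Real.add_one_le_exp (-(1 / ((j : ℝ) + 2)))
        linarith
      have h3 : ((j : ℝ) + 1) ≤ (j + 2) * Real.exp (-(1 / ((j : ℝ) + 2))) := by
        refine le_trans (le_of_eq ?_) (mul_le_mul_of_nonneg_left h2 hp2.le)
        field_simp
        ring
      have h4 := pow_le_pow_left₀ hp.le h3 (j + 2)
      rw [mul_pow, ← Real.exp_nat_mul] at h4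
      have h5 : ((j + 2 : ℕ) : ℝ) * -(1 / ((j : ℝ) + 2)) = -1 := by
        push_cast
        field_simp
      rw [h5] at h4
      calc Real.exp 1 * ((j : ℝ) + 1) ^ (j + 2)
          ≤ Real.exp 1 * (((j : ℝ) + 2) ^ (j + 2) * Real.exp (-1)) :=
            mul_le_mul_of_nonneg_left h4 (Real.exp_nonneg _)
        _ = (Real.exp 1 * Real.exp (-1)) * ((j : ℝ) + 2) ^ (j + 2) := by ring
        _ = ((j : ℝ) + 2) ^ (j + 2) := by rw [← Real.exp_add]; simp
    rw [Nat.factorial_succ]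
    push_cast
    rw [Real.exp_add]
    calc ((j : ℝ) + 1) * j.factorial * (Real.exp j * Real.exp 1)
        = Real.exp 1 * (j + 1) * (j.factorial * Real.exp j) := by ring
      _ ≤ Real.exp 1 * (j + 1) * ((j : ℝ) + 1) ^ (j + 1) :=
          mul_le_mul_of_nonneg_left ih (by positivity)
      _ = Real.exp 1 * ((j : ℝ) + 1) ^ (j + 2) := by ring
      _ ≤ ((j : ℝ) + 2) ^ (j + 2) := h1
      _ = _ := by norm_num [add_assoc]

/-- At ⌊L⌋ the term of the exponential series is largest, and it equals exp L up to a factor linear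
in L; such a factor is harmless when L is of order log n. -/
theorem exp_le_mul_pow_div_factorial {L : ℝ} (hL : 0 ≤ L) :
    Real.exp (L - 2) / (L + 1) ≤ L ^ ⌊L⌋₊ / (⌊L⌋₊).factorial := by
  set j := ⌊L⌋₊ with hj
  have hjL : (j : ℝ) ≤ L := Nat.floor_le hL
  have hLj : L < j + 1 := Nat.lt_floor_add_one L
  have h1 := factorial_mul_exp_le j
  have h2 : ((j : ℝ) + 1) ^ j ≤ Real.exp 1 * (j : ℝ) ^ j := by
    rcases Nat.eq_zero_or_pos j with h | h
    · rw [h]; simp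
    · have hp : (0 : ℝ) < j := by exact_mod_cast h
      have h3 : ((j : ℝ) + 1) ≤ j * Real.exp (1 / j) := by
        have := mul_le_mul_of_nonneg_left (Real.add_one_le_exp (1 / (j : ℝ))) hp.le
        rw [mul_add, mul_one_div_cancel hp.ne', mul_one] at this
        linarith
      have h4 := pow_le_pow_left₀ (by positivity) h3 j
      rw [mul_pow, ← Real.exp_nat_mul, mul_one_div_cancel hp.ne'] at h4
      linarith
  have hf : (0 : ℝ) < j.factorial := by exact_mod_cast j.factorial_pos
  rw [div_le_div_iff₀ (by positivity) hf]
  have h5 : (j : ℝ) ^ j ≤ L ^ j := pow_le_pow_left₀ (Nat.cast_nonneg j) hjL j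
  have h6 : Real.exp (L - 2) * Real.exp 1 ≤ Real.exp j := by
    rw [← Real.exp_add]
    exact Real.exp_le_exp.2 (by linarith)
  have h7 : Real.exp (L - 2) * Real.exp 1 * j.factorial ≤
      Real.exp 1 * (L ^ j * (L + 1)) := by
    calc Real.exp (L - 2) * Real.exp 1 * j.factorial ≤ Real.exp j * j.factorial :=
          mul_le_mul_of_nonneg_right h6 hf.le
      _ ≤ ((j : ℝ) + 1) ^ (j + 1) := by linarith
      _ = ((j : ℝ) + 1) ^ j * (j + 1) := pow_succ _ _
      _ ≤ (Real.exp 1 * (j : ℝ) ^ j) * (j + 1) := mul_le_mul_of_nonneg_right h2 (by positivity)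
      _ ≤ (Real.exp 1 * L ^ j) * (L + 1) := by gcongr
      _ = _ := by ring
  have h8 := Real.exp_pos 1
  nlinarith

theorem exp_neg_le_one_sub_pow {p ε : ℝ} (hp : 0 ≤ p) (hpε : p ≤ ε) (hε : ε < 1) {s t : ℕ}
    (hst : s ≤ t) : Real.exp (-(t * p / (1 - ε))) ≤ (1 - p) ^ s := by
  have h1 : Real.exp (-(p / (1 - ε))) ≤ 1 - p := by
    have h2 : 0 < 1 - ε := by linarith
    have h3 : 0 < 1 - p := by linarith
    have h4 : p / (1 - p) ≤ p / (1 - ε) := div_le_div_of_nonneg_left hp h2 (by linarith)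
    rw [Real.exp_neg, inv_le_comm₀ (Real.exp_pos _) h3]
    refine le_trans (le_of_eq ?_) (Real.add_one_le_exp _)|>.trans (Real.exp_le_exp.2 h4)
    field_simp
    ring
  calc Real.exp (-(t * p / (1 - ε))) = Real.exp (-(p / (1 - ε))) ^ t := by
        rw [← Real.exp_nat_mul]; congr 1; ring
    _ ≤ (1 - p) ^ t := pow_le_pow_left₀ (Real.exp_nonneg _) h1 t
    _ ≤ (1 - p) ^ s := pow_le_pow_of_le_one (by linarith) (by linarith) hst

/-- Number of balanced neighbourhoods times the weight of each. Since binom(m, j) ≥ M^j / j! on both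
sides, the edge part is at least (L^j / j!)² with j = ⌊L⌋, and the non-edges contribute at least
exp(-D). -/
theorem exp_le_sum_starWeight {pa pb ε L M D : ℝ} (hpa : 0 ≤ pa) (hpb : 0 ≤ pb) (hpa' : pa ≤ ε)
    (hpb' : pb ≤ ε) (hε : ε < 1) (x : Fin n → Fin 2) (H : Finset (Fin n)) (v : Fin n)
    (hL : 0 ≤ L) (hM : 0 < M) (hLM : L ^ 2 ≤ M ^ 2 * (pa * pb))
    (hin : M ≤ ((inside x v \ H).card : ℝ) + 1 - ⌊L⌋₊)
    (hout : M ≤ ((outside x v \ H).card : ℝ) + 1 - ⌊L⌋₊)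
    (hD : (inside x v).card * pa / (1 - ε) + (outside x v).card * pb / (1 - ε) ≤ D) :
    (Real.exp (L - 2) / (L + 1)) ^ 2 * Real.exp (-D) ≤
      ∑ R ∈ balancedStars x H ⌊L⌋₊ v, starWeight (prob pa pb x) v R := by
  set j := ⌊L⌋₊ with hj
  have hsum : ∑ R ∈ balancedStars x H j v, starWeight (prob pa pb x) v R =
      (((inside x v \ H).card.choose j : ℝ) * (outside x v \ H).card.choose j) * (pa ^ j * pb ^ j *
      ((1 - pa) ^ ((inside x v).card - j) * (1 - pb) ^ ((outside x v).card - j))) := by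
    rw [Finset.sum_congr rfl fun R hR => starWeight_balanced pa pb (mem_balancedStars hR).2.1
      (mem_balancedStars hR).2.2, Finset.sum_const, card_balancedStars, nsmul_eq_mul]
    push_cast
    rfl
  have hchoose : ∀ m : ℕ, M ≤ (m : ℝ) + 1 - j → M ^ j / j.factorial ≤ (m.choose j : ℝ) := by
    intro m hm
    have hlt : j ≤ m + 1 := by
      have : (j : ℝ) < m + 1 := by linarith
      exact_mod_cast this.le
    refine le_trans ?_ (Nat.pow_le_choose j m)
    refine div_le_div_of_nonneg_right (pow_le_pow_left₀ hM.le ?_ j) (Nat.cast_nonneg _)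
    rw [Nat.cast_sub hlt]
    push_cast
    exact hm
  have hexp := exp_le_mul_pow_div_factorial hL
  have hA : (Real.exp (L - 2) / (L + 1)) ^ 2 ≤
      (((inside x v \ H).card.choose j : ℝ) * (outside x v \ H).card.choose j) *
        (pa ^ j * pb ^ j) := by
    calc (Real.exp (L - 2) / (L + 1)) ^ 2 ≤ (L ^ j / j.factorial) ^ 2 :=
          pow_le_pow_left₀ (by positivity) hexp 2
      _ = (L ^ 2) ^ j / (j.factorial : ℝ) ^ 2 := by rw [div_pow]; ring
      _ ≤ (M ^ 2 * (pa * pb)) ^ j / (j.factorial : ℝ) ^ 2 := by gcongr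
      _ = (M ^ j / j.factorial * (M ^ j / j.factorial)) * (pa ^ j * pb ^ j) := by
          rw [mul_pow, mul_pow]; ring
      _ ≤ _ := by
          refine mul_le_mul_of_nonneg_right ?_ (by positivity)
          exact mul_le_mul (hchoose _ hin) (hchoose _ hout) (by positivity) (Nat.cast_nonneg _)
  have hB : Real.exp (-D) ≤
      (1 - pa) ^ ((inside x v).card - j) * (1 - pb) ^ ((outside x v).card - j) := by
    calc Real.exp (-D) ≤ Real.exp (-((inside x v).card * pa / (1 - ε))) *
          Real.exp (-((outside x v).card * pb / (1 - ε))) := by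
          rw [← Real.exp_add]
          exact Real.exp_le_exp.2 (by linarith)
      _ ≤ _ := mul_le_mul (exp_neg_le_one_sub_pow hpa hpa' hε (Nat.sub_le _ _))
          (exp_neg_le_one_sub_pow hpb hpb' hε (Nat.sub_le _ _)) (Real.exp_nonneg _)
          (pow_nonneg (by linarith) _)
  rw [hsum, ← mul_assoc]
  exact mul_le_mul hA hB (Real.exp_nonneg _) (by positivity)

end Communities

/-! ### Existence of a cheap flip below the threshold. -/

theorem tendsto_exp_mul_div_sq_atTop {γ κ : ℝ} (hγ : 0 < γ) (hκ : 0 ≤ κ) :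
    Tendsto (fun y : ℝ => Real.exp (γ * y) / (κ * y + 1) ^ 2) atTop atTop := by
  have h := (tendsto_exp_mul_div_rpow_atTop 2 γ hγ).const_mul_atTop
    (show 0 < 1 / (κ + 1) ^ 2 by positivity)
  refine tendsto_atTop_mono' atTop ?_ h
  filter_upwards [eventually_ge_atTop 1] with y hy
  have hy0 : 0 < y := by linarith
  rw [show (2 : ℝ) = ((2 : ℕ) : ℝ) by norm_num, Real.rpow_natCast, div_mul_div_comm, one_mul,
    ← mul_pow]
  refine div_le_div_of_nonneg_left (Real.exp_nonneg _) (by positivity) ?_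
  refine pow_le_pow_left₀ (by positivity) ?_ 2
  linarith

set_option maxHeartbeats 1000000 in
/-- For balanced communities, with high probability the labels remain almost as likely if a suitable
vertex changes its community. -/
theorem graphProb_not_exists_flip_le {n : ℕ} {a b ℓ κ γ δ K : ℝ} (ha : 0 ≤ a) (hb : 0 ≤ b)
    (hn : (0 : ℝ) < n) (hnexp : (n : ℝ) = Real.exp ℓ) (hℓ : 0 < ℓ) (hκdef : κ = √a * √b / 2)
    (hγκ : 2 * γ = 1 - (a + b) / 2 + 2 * κ) (hδ0 : 0 < δ) (hδ1 : δ ≤ 1 / 2)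
    (hδS : δ * (2 * κ + (a + b) / 2) ≤ γ) (hK0 : 0 ≤ K) (hKn : K ≤ δ / 16 * n)
    (hκℓ : κ * ℓ ≤ δ / 16 * n) (hεK : (K + 1) * ((a + b) * ℓ / n) ≤ δ / 16)
    (hμn : 8 ≤ δ / 8 * Real.exp (-4) * (Real.exp (γ * ℓ) / (κ * ℓ + 1) ^ 2))
    (hnδ : 8 ≤ n * δ) (x : Fin n → Fin 2) (hx : |∑ u, spin x u| ≤ K) :
    graphProb (prob (a * ℓ / n) (b * ℓ / n) x) (fun G => ¬ ∃ v,
        graphWeight (prob (a * ℓ / n) (b * ℓ / n) x) G ≤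
          2 * graphWeight (prob (a * ℓ / n) (b * ℓ / n) (flip v x)) G) ≤ 1 / 4 := by
  have hκ : 0 ≤ κ := by rw [hκdef]; positivity
  have hsa := Real.sq_sqrt ha
  have hsb := Real.sq_sqrt hb
  obtain ⟨ε, hεdef⟩ : ∃ ε, ε = (a + b) * ℓ / n := ⟨_, rfl⟩
  rw [← hεdef] at hεK
  have hε0 : 0 ≤ ε := by rw [hεdef]; positivity
  have hε : ε ≤ δ / 16 := by
    have := mul_nonneg hK0 hε0
    linarith
  obtain ⟨pa, hpa⟩ : ∃ pa, pa = a * ℓ / n := ⟨_, rfl⟩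
  obtain ⟨pb, hpb⟩ : ∃ pb, pb = b * ℓ / n := ⟨_, rfl⟩
  rw [← hpa, ← hpb]
  have hpa0 : 0 ≤ pa := by rw [hpa]; positivity
  have hpb0 : 0 ≤ pb := by rw [hpb]; positivity
  have hpaε : pa ≤ ε := by rw [hpa, hεdef]; gcongr; linarith
  have hpbε : pb ≤ ε := by rw [hpb, hεdef]; gcongr; linarith
  have hε1 : ε < 1 := by linarith
  -- `κ * ℓ` is √(ab)/2 · log n, the likeliest common number of neighbours on the two sides. With
  -- the same factor 1 - δ in `M`, the relation L² = M² · pa · pb holds exactly.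
  obtain ⟨L, hL⟩ : ∃ L, L = (1 - δ) * (κ * ℓ) := ⟨_, rfl⟩
  have hκℓ0 : 0 ≤ κ * ℓ := by positivity
  have hL0 : 0 ≤ L := by
    rw [hL]
    exact mul_nonneg (by linarith) hκℓ0
  have hLκ : L ≤ κ * ℓ := by
    rw [hL]
    exact mul_le_of_le_one_left hκℓ0 (by linarith)
  obtain ⟨M, hM⟩ : ∃ M, M = (1 - δ) * n / 2 := ⟨_, rfl⟩
  have hM0 : 0 < M := by
    have : 0 < (1 - δ) * n := mul_pos (by linarith) hn
    rw [hM]; linarith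
  have hjL : (⌊L⌋₊ : ℝ) ≤ L := Nat.floor_le hL0
  -- If a or b vanishes, then `L = 0` and the product is an empty one: the vertices considered are
  -- isolated.
  have hjpos : 0 < pa ^ ⌊L⌋₊ * pb ^ ⌊L⌋₊ := by
    rcases eq_or_lt_of_le ha with h0 | h0
    · have : L = 0 := by rw [hL, hκdef, ← h0]; simp
      rw [this]; simp
    · rcases eq_or_lt_of_le hb with h0' | h0'
      · have : L = 0 := by rw [hL, hκdef, ← h0']; simp
        rw [this]; simp
      · have hpa1 : 0 < pa := by rw [hpa]; positivity
        have hpb1 : 0 < pb := by rw [hpb]; positivity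
        positivity
  -- The reserve `H` is a positive proportion of the vertices, but small enough to leave at least
  -- `M` available vertices in each community.
  obtain ⟨H, -, hH⟩ := Finset.exists_subset_card_eq (s := (Finset.univ : Finset (Fin n)))
    (n := ⌊δ * n / 4⌋₊) (by
      rw [Finset.card_univ, Fintype.card_fin]
      refine Nat.floor_le_of_le ?_
      have := mul_le_mul_of_nonneg_right hδ1 hn.le
      linarith)
  have hHle : (H.card : ℝ) ≤ δ * n / 4 := by
    rw [hH]; exact Nat.floor_le (by positivity)
  have hHge : δ * n / 8 ≤ H.card := by
    have h1 := Nat.lt_floor_add_one (δ * n / 4)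
    rw [hH]
    linarith
  have hcards : ∀ v, (n : ℝ) / 2 - K / 2 - 1 ≤ (inside x v).card ∧
      ((inside x v).card : ℝ) ≤ (n + K) / 2 ∧ (n : ℝ) / 2 - K / 2 - 1 ≤ (outside x v).card ∧
      ((outside x v).card : ℝ) ≤ (n + K) / 2 := by
    intro v
    have h1 : |spin x v * ∑ w, spin x w| ≤ K := by
      rw [abs_mul]
      rcases spin_eq_or x v with h | h <;> simpa [h] using hx
    rw [abs_le] at h1
    rw [card_inside, card_outside]
    refine ⟨?_, ?_, ?_, ?_⟩ <;> linarith [h1.1, h1.2]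
  have hμv : ∀ v, (Real.exp (L - 2) / (L + 1)) ^ 2 * Real.exp (-((1 + δ) * ((a + b) / 2 * ℓ))) ≤
      ∑ R ∈ balancedStars x H ⌊L⌋₊ v, starWeight (prob pa pb x) v R := by
    intro v
    obtain ⟨hi1, hi2, ho1, ho2⟩ := hcards v
    have hsd : ∀ S : Finset (Fin n), (n : ℝ) / 2 - K / 2 - 1 ≤ S.card →
        M ≤ ((S \ H).card : ℝ) + 1 - ⌊L⌋₊ := by
      intro S hS
      have h1 : (S.card : ℝ) ≤ (S \ H).card + H.card := by
        have := Finset.le_card_sdiff H S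
        exact_mod_cast (by omega : S.card ≤ (S \ H).card + H.card)
      rw [hM]
      linarith
    refine exp_le_sum_starWeight hpa0 hpb0 hpaε hpbε hε1 x H v hL0 hM0 (le_of_eq ?_)
      (hsd _ hi1) (hsd _ ho1) ?_
    · rw [hL, hM, hpa, hpb, hκdef]
      have : ((1 - δ) * (√a * √b / 2 * ℓ)) ^ 2 =
          (1 - δ) ^ 2 * ((√a) ^ 2 * (√b) ^ 2) * ℓ ^ 2 / 4 := by
        ring
      rw [this, hsa, hsb]
      field_simp
      ring
    · have hterm : ∀ (t s : ℝ), 0 ≤ s → t ≤ (n + K) / 2 →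
          t * (s * ℓ / n) / (1 - ε) ≤ (1 + δ) * (s / 2 * ℓ) := by
        intro t s hs ht
        rw [div_le_iff₀ (by linarith)]
        have h1 : t * (s * ℓ / n) ≤ (n + δ / 16 * n) / 2 * (s * ℓ / n) :=
          mul_le_mul_of_nonneg_right (by linarith) (by positivity)
        have h2 : (n + δ / 16 * n) / 2 * (s * ℓ / n) = (1 + δ / 16) * (s / 2 * ℓ) := by
          field_simp
        have h3 : 1 + δ / 16 ≤ (1 + δ) * (1 - ε) := by
          have := mul_le_mul_of_nonneg_left hε (show 0 ≤ 1 + δ by linarith)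
          nlinarith
        have h4 : 0 ≤ s / 2 * ℓ := by positivity
        have h5 := mul_le_mul_of_nonneg_right h3 h4
        linarith
      have h1 := hterm _ a ha hi2
      have h2 := hterm _ b hb ho2
      rw [hpa, hpb]
      linarith
  -- In units of log n the exponent of the mean is 1 + 2κ - (a + b)/2 - δ(2κ + (a + b)/2), that is
  -- 2γ minus a loss of at most γ.
  have hμ8 : 8 ≤ ∑ v ∈ H, ∑ R ∈ balancedStars x H ⌊L⌋₊ v, starWeight (prob pa pb x) v R := by
    refine le_trans ?_ (Finset.card_nsmul_le_sum H _ _ fun v _ => hμv v)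
    rw [nsmul_eq_mul]
    refine hμn.trans ?_
    have hX : (0 : ℝ) ≤ (Real.exp (L - 2) / (L + 1)) ^ 2 *
        Real.exp (-((1 + δ) * ((a + b) / 2 * ℓ))) := by positivity
    refine le_trans ?_ (mul_le_mul_of_nonneg_right hHge hX)
    have e1 : δ * n / 8 * ((Real.exp (L - 2) / (L + 1)) ^ 2 *
        Real.exp (-((1 + δ) * ((a + b) / 2 * ℓ)))) =
        δ / 8 * (Real.exp (ℓ + (2 * (L - 2) + -((1 + δ) * ((a + b) / 2 * ℓ)))) / (L + 1) ^ 2) := by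
      rw [Real.exp_add, Real.exp_add, ← hnexp, div_pow, ← Real.exp_nat_mul]
      push_cast
      ring
    have e2 : δ / 8 * Real.exp (-4) * (Real.exp (γ * ℓ) / (κ * ℓ + 1) ^ 2) =
        δ / 8 * (Real.exp (γ * ℓ + -4) / (κ * ℓ + 1) ^ 2) := by
      rw [Real.exp_add]
      ring
    rw [e1, e2]
    refine mul_le_mul_of_nonneg_left ?_ (by positivity)
    refine div_le_div₀ (Real.exp_nonneg _) (Real.exp_le_exp.2 ?_) (by positivity)
      (pow_le_pow_left₀ (by positivity) (by linarith) 2)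
    have h1 : γ * ℓ ≤ (1 - (a + b) / 2 + 2 * κ - δ * (2 * κ + (a + b) / 2)) * ℓ :=
      mul_le_mul_of_nonneg_right (by linarith) (by linarith)
    rw [hL]
    linarith
  have hfin := graphProb_forall_not_exists_star_le (prob_nonneg hpa0 hpb0) hε1
    (prob_le hpaε hpbε) (prob_symm pa pb x) H (balancedStars x H ⌊L⌋₊)
    (fun v R hR => (mem_balancedStars hR).1) (by linarith)
  -- The bound 1/4 is split evenly between the reciprocal of the mean and the dependence 1/(1 - ε) -
  -- 1.
  have h1 : 1 / (∑ v ∈ H, ∑ R ∈ balancedStars x H ⌊L⌋₊ v, starWeight (prob pa pb x) v R) ≤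
      1 / 8 := one_div_le_one_div_of_le (by norm_num) hμ8
  have h2 : 1 / (1 - ε) ≤ 9 / 8 := by
    rw [div_le_iff₀ (by linarith)]
    linarith
  refine le_trans (graphProb_mono (prob_nonneg hpa0 hpb0)
    (prob_le (by linarith) (by linarith)) fun G hG v _ hR => hG ?_) (hfin.trans (by linarith))
  obtain ⟨R, hR, hGR⟩ := hR
  obtain ⟨-, hc1, hc2⟩ := mem_balancedStars hR
  refine ⟨v, graphWeight_le_two_mul_flip hpa0 hpb0 hpaε hpbε hε1 hjpos ?_ hGR hc1 hc2⟩
  have : (|∑ w, spin x w| + 1) * ε ≤ (K + 1) * ε := mul_le_mul_of_nonneg_right (by linarith) hε0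
  linarith

/-- Below the threshold and for balanced communities, with high probability the labels remain
almost as likely if a suitable vertex changes its community. -/
theorem eventually_exists_flip {a b : ℝ} (ha : 0 ≤ a) (hb : 0 ≤ b) (h : |√a - √b| < √2) :
    ∀ᶠ n : ℕ in atTop, ∀ x : Fin n → Fin 2, |∑ u, spin x u| ≤ (n : ℝ) ^ (3 / 4 : ℝ) →
      graphProb (prob (a * Real.log n / n) (b * Real.log n / n) x) (fun G => ¬ ∃ v,
        graphWeight (prob (a * Real.log n / n) (b * Real.log n / n) x) G ≤
          2 * graphWeight (prob (a * Real.log n / n) (b * Real.log n / n) (flip v x)) G) ≤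
        1 / 4 := by
  set κ := √a * √b / 2 with hκdef
  have hκ : 0 ≤ κ := by positivity
  have hsa := Real.sq_sqrt ha
  have hsb := Real.sq_sqrt hb
  -- This is half the exponent of the expected number of balanced vertices, positive exactly below
  -- the threshold; the other half is left for the losses from `δ`.
  set γ := (1 - (√a - √b) ^ 2 / 2) / 2 with hγdef
  have hγ : 0 < γ := by
    have h2 : (√a - √b) ^ 2 < 2 := by
      have := sq_lt_sq' (by linarith [abs_nonneg (√a - √b), Real.sqrt_nonneg 2]) h
      rwa [sq_abs, Real.sq_sqrt (by norm_num)] at this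
    rw [hγdef]
    linarith
  have hγκ : 2 * γ = 1 - (a + b) / 2 + 2 * κ := by
    rw [hγdef, hκdef]
    linarith [hsa, hsb, sub_sq (√a) (√b)]
  obtain ⟨δ, hδ0, hδ1, hδS⟩ : ∃ δ : ℝ, 0 < δ ∧ δ ≤ 1 / 2 ∧
      δ * (2 * κ + (a + b) / 2) ≤ γ := by
    have hS : 0 < 2 * κ + (a + b) / 2 + 1 := by positivity
    refine ⟨min (1 / 2) (γ / (2 * κ + (a + b) / 2 + 1)), by positivity, min_le_left _ _, ?_⟩
    have h1 := min_le_right (1 / 2) (γ / (2 * κ + (a + b) / 2 + 1))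
    rw [le_div_iff₀ hS] at h1
    have h2 : 0 < min (1 / 2) (γ / (2 * κ + (a + b) / 2 + 1)) := by positivity
    nlinarith
  set c := a + b + κ + 1 with hc
  have hc1 : 1 ≤ c := by rw [hc]; linarith
  have hT : Tendsto (fun n : ℕ => 2 * c * (Real.log n / (n : ℝ) ^ (1 / 4 : ℝ))) atTop
      (𝓝 (2 * c * 0)) :=
    ((isLittleO_log_rpow_atTop (by norm_num : (0 : ℝ) < 1 / 4)).tendsto_div_nhds_zero.comp
      (tendsto_natCast_atTop_atTop (R := ℝ))).const_mul (2 * c)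
  have hlog : Tendsto (fun n : ℕ => Real.log n) atTop atTop :=
    Real.tendsto_log_atTop.comp (tendsto_natCast_atTop_atTop (R := ℝ))
  have hμ := ((tendsto_exp_mul_div_sq_atTop hγ hκ).const_mul_atTop
    (show 0 < δ / 8 * Real.exp (-4) by positivity)).comp hlog
  filter_upwards [hT.eventually (eventually_le_nhds (by simpa using by positivity :
    2 * c * 0 < δ / 16)), hlog.eventually (eventually_ge_atTop 1),
    hμ.eventually (eventually_ge_atTop 8), (tendsto_natCast_atTop_atTop (R := ℝ)).eventually
    (eventually_ge_atTop (8 / δ)), eventually_gt_atTop 0] with n hTn hℓ hμn hnδ hn0 x hx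
  simp only [Function.comp_apply] at hμn
  have hn : (0 : ℝ) < n := by exact_mod_cast hn0
  have hn1 : (1 : ℝ) ≤ n := by exact_mod_cast hn0
  set ℓ := Real.log n with hℓdef
  -- The exponent exceeds 1/2, so that Chebyshev's inequality applies to the imbalance, and is below
  -- 1, so that K log n / n tends to zero.
  set K := (n : ℝ) ^ (3 / 4 : ℝ) with hK
  have hK1 : 1 ≤ K := Real.one_le_rpow hn1 (by norm_num)
  have hTK : c * (ℓ * (K + 1)) ≤ δ / 16 * n := by
    have hroot : 0 < (n : ℝ) ^ (1 / 4 : ℝ) := Real.rpow_pos_of_pos hn _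
    have hprod : K * (n : ℝ) ^ (1 / 4 : ℝ) = n := by
      rw [hK, ← Real.rpow_add hn]; norm_num
    rw [← mul_div_assoc, div_le_iff₀ hroot] at hTn
    have h1 := mul_le_mul_of_nonneg_right hTn (by linarith : 0 ≤ K)
    have h2 : c * (ℓ * (K + 1)) ≤ 2 * c * ℓ * K := by
      have := mul_le_mul_of_nonneg_left hK1 (show 0 ≤ c * ℓ by positivity)
      linarith
    calc c * (ℓ * (K + 1)) ≤ 2 * c * ℓ * K := h2
      _ ≤ δ / 16 * (n : ℝ) ^ (1 / 4 : ℝ) * K := h1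
      _ = δ / 16 * n := by rw [mul_assoc, mul_comm _ K, hprod]
  have hℓK : 0 ≤ ℓ * (K + 1) := by positivity
  have hcmono : ∀ d, 0 ≤ d → d ≤ c → d * (ℓ * (K + 1)) ≤ δ / 16 * n := fun d _ hdc =>
    (mul_le_mul_of_nonneg_right hdc hℓK).trans hTK
  have hKn : K ≤ δ / 16 * n := by
    refine le_trans ?_ (hcmono 1 zero_le_one hc1)
    have := mul_le_mul_of_nonneg_right hℓ (show 0 ≤ K + 1 by linarith)
    linarith
  have hκℓ : κ * ℓ ≤ δ / 16 * n := by
    have := hcmono κ hκ (by rw [hc]; linarith)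
    have h2 : 0 ≤ κ * ℓ * K := by positivity
    linarith
  have habℓ := hcmono (a + b) (by positivity) (by rw [hc]; linarith)
  have hεK : (K + 1) * ((a + b) * ℓ / n) ≤ δ / 16 := by
    rw [← mul_div_assoc, div_le_iff₀ hn]
    linarith
  exact graphProb_not_exists_flip_le ha hb hn (Real.exp_log hn).symm (by linarith) hκdef hγκ hδ0
    hδ1 hδS (by linarith) hKn hκℓ hεK hμn ((div_le_iff₀ hδ0).1 hnδ) x hx

/-! ### From cheap flips to the failure of every estimator. -/

theorem agreement_flip_ne_one {n : ℕ} (hn : 2 ≤ n) {x y : Fin n → Fin 2}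
    (h : agreement x y = 1) (v : Fin n) : agreement (flip v x) y ≠ 1 := by
  intro h'
  rw [agreement_eq_one_iff (by omega)] at h h'
  obtain ⟨π, hπ⟩ := h
  obtain ⟨π', hπ'⟩ := h'
  -- A permutation of two labels is determined by one value, so any vertex other than `v` fixes the
  -- relabelling; this needs `2 ≤ n`.
  have hfix : ∀ π π' : Equiv.Perm (Fin 2), ∀ i, π i = π' i → ∀ j, π j = π' j := by decide
  have : Nontrivial (Fin n) := Fin.nontrivial_iff_two_le.2 hn
  obtain ⟨u, hu⟩ := exists_ne v
  have h1 : π (y u) = π' (y u) := by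
    rw [← hπ, ← hπ']
    simp [flip, hu]
  have h2 := hfix π π' _ h1 (y v)
  rw [← hπ, ← hπ'] at h2
  simp [flip] at h2

open scoped Classical in
theorem card_agreement_le {n : ℕ} (hn : 0 < n) (y : Fin n → Fin 2) :
    (Finset.univ.filter fun x : Fin n → Fin 2 => agreement x y = 1).card ≤ 2 := by
  have hsub : (Finset.univ.filter fun x : Fin n → Fin 2 => agreement x y = 1) ⊆
      (Finset.univ : Finset (Equiv.Perm (Fin 2))).image fun π i => π (y i) := by
    intro x hx
    obtain ⟨π, hπ⟩ := (agreement_eq_one_iff hn x y).1 (Finset.mem_filter.1 hx).2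
    exact Finset.mem_image.2 ⟨π, Finset.mem_univ π, (funext hπ).symm⟩
  refine (Finset.card_le_card hsub).trans (Finset.card_image_le.trans ?_)
  rw [Finset.card_univ, Fintype.card_perm]
  simp

open scoped Classical in
/-- If labels recovered from `y` can be flipped at a vertex without much loss of weight, then much
weight is on labels that are not recovered from `y`. -/
theorem sum_agreement_le {n : ℕ} (hn : 2 ≤ n) (W : (Fin n → Fin 2) → ℝ) (hW : ∀ x, 0 ≤ W x)
    (y : Fin n → Fin 2) :
    ∑ x, (if ∃ v, W x ≤ 2 * W (flip v x) then W x else 0) *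
        (if agreement x y = 1 then 1 else 0) ≤
      4 * ∑ x, W x * (1 - if agreement x y = 1 then 1 else 0) := by
  set F := ∑ x, W x * (1 - if agreement x y = 1 then (1 : ℝ) else 0) with hF
  have hnn : ∀ x, 0 ≤ W x * (1 - if agreement x y = 1 then (1 : ℝ) else 0) := fun x =>
    mul_nonneg (hW x) (by split_ifs <;> norm_num)
  have hF0 : 0 ≤ F := Finset.sum_nonneg fun x _ => hnn x
  -- The flip of a recovered labelling is not recovered, so its weight is part of `F`. At most two
  -- labellings are recovered from `y`, each of weight at most 2F if it has a cheap flip.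
  have hterm : ∀ x, (if ∃ v, W x ≤ 2 * W (flip v x) then W x else 0) *
      (if agreement x y = 1 then 1 else 0) ≤ if agreement x y = 1 then 2 * F else 0 := by
    intro x
    split_ifs with h1 h2
    · obtain ⟨v, hv⟩ := h1
      have h3 := Finset.single_le_sum (fun z _ => hnn z) (Finset.mem_univ (flip v x))
      rw [if_neg (agreement_flip_ne_one hn h2 v), sub_zero, mul_one] at h3
      linarith
    · simp
    · rw [zero_mul]; positivity
    · simp
  refine (Finset.sum_le_sum fun x _ => hterm x).trans ?_
  rw [← Finset.sum_filter, Finset.sum_const, nsmul_eq_mul]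
  have hcard : ((Finset.univ.filter fun x : Fin n → Fin 2 => agreement x y = 1).card : ℝ) ≤ 2 := by
    exact_mod_cast card_agreement_le (by omega) y
  nlinarith

open scoped Classical in
theorem toReal_toOuterMeasure_eq_sum {n : ℕ} (p : PMF (Fin n → Fin 2)) (x : Fin n → Fin 2) :
    (p.toOuterMeasure {y | agreement x y = 1}).toReal =
      ∑ y, (p y).toReal * if agreement x y = 1 then 1 else 0 := by
  rw [PMF.toOuterMeasure_apply_fintype, ENNReal.toReal_sum]
  · refine Finset.sum_congr rfl fun y _ => ?_
    by_cases h : agreement x y = 1 <;> simp [h]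
  · intro y _
    by_cases h : agreement x y = 1 <;> simp [h, PMF.apply_ne_top]

open scoped Classical in
/-- An estimator fails with a probability that is at least proportional to the probability that the
labels remain almost as likely after the flip of a vertex. -/
theorem sum_graphProb_flip_le {n : ℕ} (hn : 2 ≤ n) (q : (Fin n → Fin 2) → Fin n → Fin n → ℝ)
    (h0 : ∀ x u v, 0 ≤ q x u v) (h1 : ∀ x u v, q x u v ≤ 1)
    (Xhat : SimpleGraph (Fin n) → PMF (Fin n → Fin 2)) :
    ∑ x : Fin n → Fin 2, (1 / 2 : ℝ) ^ n * graphProb (q x) (fun G => ∃ v,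
        graphWeight (q x) G ≤ 2 * graphWeight (q (flip v x)) G) ≤
      5 * (1 - ∑ x : Fin n → Fin 2, (1 / 2 : ℝ) ^ n * graphMean (q x) fun G =>
        ((Xhat G).toOuterMeasure {y | agreement x y = 1}).toReal) := by
  set ψ : (Fin n → Fin 2) → SimpleGraph (Fin n) → ℝ := fun x G =>
    ((Xhat G).toOuterMeasure {y | agreement x y = 1}).toReal with hψ
  have hψ' : ∀ x G, ψ x G = ∑ y, (Xhat G y).toReal * if agreement x y = 1 then 1 else 0 :=
    fun x G => toReal_toOuterMeasure_eq_sum (Xhat G) x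
  have hone : ∀ G, ∑ y, (Xhat G y).toReal = 1 := by
    intro G
    rw [← ENNReal.toReal_sum fun y _ => (Xhat G).apply_ne_top y,
      ← tsum_fintype (L := .unconditional _), PMF.tsum_coe, ENNReal.toReal_one]
  have hG : ∀ G, ∑ x, graphWeight (q x) G * (if ∃ v, graphWeight (q x) G ≤
      2 * graphWeight (q (flip v x)) G then 1 else 0) ≤
      5 * ∑ x, graphWeight (q x) G * (1 - ψ x G) := by
    intro G
    set W : (Fin n → Fin 2) → ℝ := fun x => graphWeight (q x) G with hWdef
    have hW : ∀ x, 0 ≤ W x := fun x => graphWeight_nonneg (h0 x) (h1 x) G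
    set B : (Fin n → Fin 2) → ℝ := fun x => if ∃ v, W x ≤ 2 * W (flip v x) then W x else 0
      with hB
    have hBW : ∀ x, B x ≤ W x := by
      intro x
      rw [hB]
      dsimp only
      split_ifs
      · exact le_rfl
      · exact hW x
    have hψ1 : ∀ x, 1 - ψ x G = ∑ y, (Xhat G y).toReal *
        (1 - if agreement x y = 1 then 1 else 0) := by
      intro x
      simp only [mul_sub, mul_one, Finset.sum_sub_distrib]
      rw [hone, hψ']
    have hψle : ∀ x, 0 ≤ 1 - ψ x G := by
      intro x
      rw [hψ1]
      exact Finset.sum_nonneg fun y _ => mul_nonneg ENNReal.toReal_nonneg (by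
        split_ifs <;> norm_num)
    -- A randomized estimate is a mixture of deterministic ones, so the inequality for a fixed `y`
    -- can be averaged. The recovered part of `B` costs 4 times the failure weight and the
    -- unrecovered part once, giving 5.
    have hmain : ∑ x, B x * ψ x G ≤ 4 * ∑ x, W x * (1 - ψ x G) := by
      have e1 : ∑ x, B x * ψ x G =
          ∑ y, (Xhat G y).toReal * ∑ x, B x * (if agreement x y = 1 then 1 else 0) := by
        simp only [hψ', Finset.mul_sum]
        rw [Finset.sum_comm]
        exact Finset.sum_congr rfl fun y _ => Finset.sum_congr rfl fun x _ => by ring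
      have e2 : 4 * ∑ x, W x * (1 - ψ x G) = ∑ y, (Xhat G y).toReal *
          (4 * ∑ x, W x * (1 - if agreement x y = 1 then 1 else 0)) := by
        simp only [hψ1, Finset.mul_sum]
        rw [Finset.sum_comm]
        exact Finset.sum_congr rfl fun y _ => Finset.sum_congr rfl fun x _ => by ring
      rw [e1, e2]
      exact Finset.sum_le_sum fun y _ =>
        mul_le_mul_of_nonneg_left (sum_agreement_le hn W hW y) ENNReal.toReal_nonneg
    have hrest : ∑ x, B x * (1 - ψ x G) ≤ ∑ x, W x * (1 - ψ x G) :=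
      Finset.sum_le_sum fun x _ => mul_le_mul_of_nonneg_right (hBW x) (hψle x)
    have hsplit : ∑ x, W x * (if ∃ v, W x ≤ 2 * W (flip v x) then 1 else 0) =
        ∑ x, B x * ψ x G + ∑ x, B x * (1 - ψ x G) := by
      rw [← Finset.sum_add_distrib]
      refine Finset.sum_congr rfl fun x _ => ?_
      rw [hB]
      dsimp only
      split_ifs <;> ring
    rw [hsplit]
    linarith
  have hR : 1 - ∑ x : Fin n → Fin 2, (1 / 2 : ℝ) ^ n * graphMean (q x) (ψ x) =
      ∑ G, (1 / 2 : ℝ) ^ n * ∑ x, graphWeight (q x) G * (1 - ψ x G) := by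
    have e : 1 - ∑ x : Fin n → Fin 2, (1 / 2 : ℝ) ^ n * graphMean (q x) (ψ x) =
        ∑ x : Fin n → Fin 2, ((1 / 2 : ℝ) ^ n - (1 / 2 : ℝ) ^ n * graphMean (q x) (ψ x)) := by
      rw [Finset.sum_sub_distrib, sum_half_pow]
    rw [e]
    simp only [Finset.mul_sum]
    rw [Finset.sum_comm]
    refine Finset.sum_congr rfl fun x _ => ?_
    rw [← Finset.mul_sum]
    simp only [mul_sub, mul_one, Finset.sum_sub_distrib]
    have := graphMean_one (q x)
    simp only [graphMean, mul_one] at this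
    rw [this, graphMean]
    ring
  rw [hR, Finset.mul_sum]
  simp only [graphProb, graphMean, Finset.mul_sum]
  rw [Finset.sum_comm]
  refine Finset.sum_le_sum fun G _ => ?_
  have := mul_le_mul_of_nonneg_left (hG G) (show (0 : ℝ) ≤ (1 / 2) ^ n by positivity)
  simp only [Finset.mul_sum] at this ⊢
  refine le_trans (le_of_eq ?_) (this.trans (le_of_eq ?_))
  · refine Finset.sum_congr rfl fun x _ => ?_
    congr!
  · exact Finset.sum_congr rfl fun x _ => by ring

theorem not_solvable_of_lt_threshold {a b : ℝ} (ha : 0 ≤ a) (hb : 0 ≤ b)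
    (h : |√a - √b| < √2) :
    ¬ ExactRecoverySolvable fun n => SSBM n 2 (logProb a n) (logProb b n) := by
  classical
  rintro ⟨Xhat, hX⟩
  -- Success above 19/20 would bound the probability of a cheap flip by 5 · 1/20 = 1/4. It is at
  -- least 3/4 · 3/4, the second factor being the weight of the balanced labels once n ≥ 16.
  have hev : ∀ᶠ n : ℕ in atTop, ENNReal.ofReal (19 / 20) <
      successProb (SSBM n 2 (logProb a n) (logProb b n)) (Xhat n) :=
    hX.eventually (lt_mem_nhds (by
      rw [← ENNReal.ofReal_one]
      exact (ENNReal.ofReal_lt_ofReal_iff one_pos).2 (by norm_num)))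
  obtain ⟨n, hn, hflip, hpa, hpb, hn16⟩ := (hev.and ((eventually_exists_flip ha hb h).and
    ((logProb_eventually ha).and ((logProb_eventually hb).and (eventually_ge_atTop 16))))).exists
  rw [successProb_eq] at hn
  have hs := (ENNReal.ofReal_lt_ofReal_iff_of_nonneg (by norm_num)).1 hn
  set A := logProb a n
  set B := logProb b n
  rw [← hpa, ← hpb] at hflip
  have h0 : ∀ (x : Fin n → Fin 2) u v, 0 ≤ prob (A : ℝ) B x u v :=
    fun x => prob_nonneg A.2.1 B.2.1
  have h1 : ∀ (x : Fin n → Fin 2) u v, prob (A : ℝ) B x u v ≤ 1 := fun x => prob_le A.2.2 B.2.2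
  have hle := sum_graphProb_flip_le (by omega) (fun x => prob (A : ℝ) B x) h0 h1 (Xhat n)
  have hnR : (16 : ℝ) ≤ n := by exact_mod_cast hn16
  have hn0 : (0 : ℝ) < n := by linarith
  set K := (n : ℝ) ^ (3 / 4 : ℝ) with hK
  have hK0 : 0 < K := Real.rpow_pos_of_pos hn0 _
  have hcheb := sum_unbalanced_le n hK0
  have hKn : (n : ℝ) / K ^ 2 ≤ 1 / 4 := by
    have h2 : K ^ 2 = n * √n := by
      rw [hK, ← Real.rpow_natCast, ← Real.rpow_mul hn0.le, Real.sqrt_eq_rpow]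
      nth_rewrite 2 [← Real.rpow_one (n : ℝ)]
      rw [← Real.rpow_add hn0]
      norm_num
    have h3 : 4 ≤ √(n : ℝ) := Real.le_sqrt_of_sq_le (by linarith)
    rw [div_le_iff₀ (by positivity), h2]
    nlinarith
  have hx : ∀ x : Fin n → Fin 2, (1 / 2 : ℝ) ^ n * (3 / 4) -
      (1 / 2) ^ n * (if |∑ u, spin x u| ≤ K then 0 else 1) * (3 / 4) ≤
      (1 / 2) ^ n * graphProb (prob (A : ℝ) B x) (fun G => ∃ v,
        graphWeight (prob (A : ℝ) B x) G ≤ 2 * graphWeight (prob (A : ℝ) B (flip v x)) G) := by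
    intro x
    split_ifs with hbal
    · rw [mul_zero, zero_mul, sub_zero]
      refine mul_le_mul_of_nonneg_left ?_ (by positivity)
      have h2 := hflip x hbal
      rw [graphProb_not] at h2
      linarith
    · rw [mul_one, sub_self]
      exact mul_nonneg (by positivity) (graphProb_nonneg (h0 x) (h1 x) _)
  have hsum := Finset.sum_le_sum fun x (_ : x ∈ Finset.univ) => hx x
  rw [Finset.sum_sub_distrib, ← Finset.sum_mul, ← Finset.sum_mul, sum_half_pow] at hsum
  linarith

end

end BlockModel

theorem mainTheorem4 (a b : ℝ) (ha : 0 ≤ a) (hb : 0 ≤ b) :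
    (√2 < |√a - √b| →
      BlockModel.ExactRecoverySolvable
          (fun n => BlockModel.SSBM n 2 (BlockModel.logProb a n) (BlockModel.logProb b n)) ∧
        BlockModel.ExactRecoveryEfficientlySolvable
          (fun n => BlockModel.SSBM n 2 (BlockModel.logProb a n) (BlockModel.logProb b n))) ∧
    (|√a - √b| < √2 →
      ¬ BlockModel.ExactRecoverySolvable
          (fun n => BlockModel.SSBM n 2 (BlockModel.logProb a n) (BlockModel.logProb b n))) := by
  refine ⟨fun h => ?_, BlockModel.not_solvable_of_lt_threshold ha hb⟩
  have heff := BlockModel.efficientlySolvable_of_threshold_lt ha hb h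
  exact ⟨BlockModel.solvable_of_efficientlySolvable heff, heff⟩
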